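/- **Classification of positive monads.** Consider the list, numbered $1,\dots,124$, of the smooth ambient toric fourfolds $\mathcal A$ whose fan consists of the cones over the faces of a reflexive polytope $\Delta^\circ\subset\mathbb R^4$ with vertices $e_1,\dots,e_4$ (the standard unit vectors) and $v_5,\dots,v_k$. Let $X\subset\mathcal A$ be the anticanonical Calabi–Yau threefold, let $\mathcal N=\mathcal O(\sum_\rho D_\rho)$ be its normal bundle, let $h=k-4=h^{1,1}(\mathcal A)=h^{1,1}(X)$, and identify $\mathrm{Pic}(X)$, the Kähler cone and the Mori cone (its dual) of $X$ with those of $\mathcal A$; Chern classes and intersection numbers of $X$ are computed torically. The space is *simple* if its Kähler cone is simplicial. For a simple space let $\tilde J_1,\dots,\tilde J_h$ be the integral generators of the Kähler cone, $\tilde d_{rst}=\int_X\tilde J_r\tilde J_s\tilde J_t$ and $\tilde c_{2r}=\int_X c_2(X)\tilde J_r$; the space is a *candidate* if for some $N\in\{3,4,5\}$ there are integers $b^s\ge 1$ with $\sum_{s,t}\tilde d_{rst}b^s\le\frac2N\tilde c_{2r}$ for all $r$. For $N\in\{3,4,5\}$, an *anomaly-free positive $SU(N)$ monad* on $X$ is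 a pair $B=\bigoplus_{i=1}^{r_B}\mathcal O_X(b_i)$, $C=\bigoplus_{j=1}^{r_C}\mathcal O_X(c_j)$ (defining $0\to V\to B\to C\to0$) such that 1. $r_B-r_C=N$ and $\sum_i b_i=\sum_j c_j$ (so $c_1(V)=0$); 2. all $b_i$ and $c_j$ lie in the (open) Kähler cone; 3. all $c_j-b_i$ lie in the closed Kähler cone and are nonzero; 4. $c_2(X)-c_2(V)$ lies in the Mori cone, that is, $\sum_j\int_X c_j^2L-\sum_i\int_X b_i^2L\le 2\int_X c_2(X)L$ for every class $L$ in the closed Kähler cone. Monads are counted *modulo permutation*: the order of the summands of $B$ and of $C$ is disregarded, and, if $\mathcal A$ is a product of projective spaces, monads that differ by an exchange of projective space factors of equal dimension are identified. No other identification is made. Then exactly 101 of the 124 spaces are simple, exactly 18 of these are candidates, and anomaly-free positive $SU(3)$, $SU(4)$ or $SU(5)$ monads exist on exactly 11 simple spaces, all of which are candidates. The 11 spaces (given by $v_5,\dots,v_k$) and the exact numbers of monads modulo permutation are | No. | $v_5,\dots,v_k$ | $SU(3)$ | $SU(4)$ | $SU(5)$ | |---|---|---|---|---| | $1_P$ |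 $(-1,-1,-1,-1)$ | 20 | 14 | 9 | | $2_P$ | $(-1,0,0,0),(0,-1,-1,-1)$ | 611 | 308 | 56 | | 3 | $(-1,0,0,0),(1,-1,-1,-1)$ | 4 | 0 | 0 | | 4 | $(-1,-1,0,0),(1,0,-1,-1)$ | 9 | 0 | 0 | | 6 | $(-1,-1,-1,0),(1,0,0,-1)$ | 153 | 35 | 19 | | $7_P$ | $(0,-1,-1,0),(-1,0,0,-1)$ | 38 | 27 | 10 | | 12 | $(-1,0,0,0),(0,-1,-1,0),(0,1,0,-1)$ | 74 | 0 | 0 | | 17 | $(-1,0,0,0),(1,0,-1,0),(0,-1,0,-1)$ | 34 | 0 | 0 | | 22 | $(-1,-1,0,0),(0,1,-1,0),(1,0,0,-1)$ | 9 | 0 | 0 | | $26_P$ | $(0,-1,0,0),(-1,0,0,0),(0,0,-1,-1)$ | 304 | 135 | 0 | | $40_P$ | $(0,0,0,-1),(0,0,-1,0),(0,-1,0,0),(-1,0,0,0)$ | 251 | 70 | 0 | The simple spaces that are products of projective spaces are exactly the five marked $P$: $\mathbb P^4$, $\mathbb P^1\times\mathbb P^3$, $\mathbb P^2\times\mathbb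 P^2$, $\mathbb P^1\times\mathbb P^1\times\mathbb P^2$, $(\mathbb P^1)^4$. In total there are 2190 monads: 1853 on these five spaces and 337 (the new ones) on the others. By structure group (new ones in parentheses) there are 1507 (283) for $SU(3)$, 589 (35) for $SU(4)$ and 94 (19) for $SU(5)$. Among them, those whose index $\mathrm{ind}(V)=\frac12\int_X c_3(V)=\frac16\left(\sum_i\int_X b_i^3-\sum_j\int_X c_j^3\right)$ equals $3k$ for some nonzero integer $k$ dividing the Euler number $\chi(X)$ number 265 (64) in total: 204 (59) for $SU(3)$, 57 (5) for $SU(4)$ and 4 (0) for $SU(5)$. -/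

import Mathlib

namespace ToricMonad

/-- Toric data of a smooth ambient toric fourfold `𝒜`. The fan is the collection of cones over the
faces of a polytope `Δ°` in `ℝ⁴` whose vertices are the four standard unit vectors together with
the `h` lattice vectors `extra r`. The number of vertices is `k = 4 + h` and `h = h¹¹(𝒜)`. -/
structure ToricSpace where
  h : ℕ
  extra : Fin h → Fin 4 → ℤ

/-- The smooth toric ambient fourfolds number `1` to `124`, in this order. Listed are the vertices of
`Δ°` other than the four standard unit vectors, which are vertices of every `Δ°`. -/
def database : List ToricSpace := [
  ⟨1,![![-1,-1,-1,-1]]⟩, ⟨2,![![-1,0,0,0],![0,-1,-1,-1]]⟩, ⟨2,![![-1,0,0,0],![1,-1,-1,-1]]⟩,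
  ⟨2,![![-1,-1,0,0],![1,0,-1,-1]]⟩, ⟨2,![![-1,-1,0,0],![1,1,-1,-1]]⟩,
  ⟨2,![![-1,-1,-1,0],![1,0,0,-1]]⟩, ⟨2,![![0,-1,-1,0],![-1,0,0,-1]]⟩,
  ⟨2,![![-1,0,0,0],![2,-1,-1,-1]]⟩, ⟨2,![![-1,-1,0,0],![2,0,-1,-1]]⟩,
  ⟨2,![![-1,0,0,0],![3,-1,-1,-1]]⟩, ⟨3,![![-1,0,0,0],![-1,-1,0,0],![1,0,-1,-1]]⟩,
  ⟨3,![![-1,0,0,0],![0,-1,-1,0],![0,1,0,-1]]⟩, ⟨3,![![-1,0,0,0],![0,-1,-1,0],![1,1,1,-1]]⟩,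
  ⟨3,![![-1,0,0,0],![0,-1,-1,-1],![1,1,0,0]]⟩, ⟨3,![![-1,0,0,0],![1,-1,-1,-1],![1,1,0,0]]⟩,
  ⟨3,![![-1,0,0,0],![1,-1,-1,0],![0,1,0,-1]]⟩, ⟨3,![![-1,0,0,0],![1,0,-1,0],![0,-1,0,-1]]⟩,
  ⟨3,![![-1,0,0,0],![1,-1,-1,0],![1,1,1,-1]]⟩, ⟨3,![![-1,0,0,0],![1,-1,0,0],![-1,1,-1,-1]]⟩,
  ⟨3,![![-1,0,0,0],![1,-1,0,0],![0,1,-1,-1]]⟩, ⟨3,![![-1,0,0,0],![1,-1,0,0],![1,0,-1,-1]]⟩,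
  ⟨3,![![-1,-1,0,0],![0,1,-1,0],![1,0,0,-1]]⟩, ⟨3,![![-1,-1,0,0],![1,1,-1,-1],![0,-1,1,0]]⟩,
  ⟨3,![![-1,-1,0,0],![1,0,-1,0],![0,0,1,-1]]⟩, ⟨3,![![-1,-1,0,0],![1,0,-1,0],![1,0,0,-1]]⟩,
  ⟨3,![![0,-1,0,0],![-1,0,0,0],![0,0,-1,-1]]⟩, ⟨3,![![0,-1,0,0],![-1,0,0,0],![1,0,-1,-1]]⟩,
  ⟨3,![![0,-1,0,0],![-1,0,0,0],![1,1,-1,-1]]⟩, ⟨3,![![0,-1,-1,0],![-1,0,0,-1],![1,1,0,0]]⟩,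
  ⟨3,![![0,-1,-1,0],![-1,0,0,-1],![1,1,1,0]]⟩, ⟨3,![![-1,0,0,0],![-1,-1,0,0],![2,0,-1,-1]]⟩,
  ⟨3,![![-1,0,0,0],![2,-1,-1,-1],![1,1,0,0]]⟩, ⟨3,![![-1,0,0,0],![2,-1,-1,0],![0,1,0,-1]]⟩,
  ⟨3,![![-1,0,0,0],![1,-1,0,0],![0,2,-1,-1]]⟩, ⟨3,![![-1,0,0,0],![1,-1,0,0],![2,-1,-1,-1]]⟩,
  ⟨3,![![-1,0,0,0],![1,-1,0,0],![2,0,-1,-1]]⟩, ⟨3,![![-1,-1,0,0],![1,0,-1,-1],![2,0,-1,-1]]⟩,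
  ⟨3,![![0,-1,0,0],![-1,0,0,0],![2,0,-1,-1]]⟩,
  ⟨4,![![0,-1,-1,0],![-1,0,0,-1],![1,1,0,0],![0,0,1,1]]⟩,
  ⟨4,![![0,0,0,-1],![0,0,-1,0],![0,-1,0,0],![-1,0,0,0]]⟩,
  ⟨4,![![-1,0,0,0],![-1,-1,0,0],![0,0,-1,-1],![1,0,1,0]]⟩,
  ⟨4,![![-1,0,0,0],![-1,-1,0,0],![1,0,-1,-1],![1,0,1,0]]⟩,
  ⟨4,![![-1,0,0,0],![-1,-1,0,0],![1,0,-1,0],![0,0,1,-1]]⟩,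
  ⟨4,![![-1,0,0,0],![-1,1,0,0],![1,-1,-1,0],![0,-1,0,-1]]⟩,
  ⟨4,![![-1,0,0,0],![-1,0,-1,0],![1,0,0,-1],![1,-1,0,0]]⟩,
  ⟨4,![![-1,0,0,0],![0,-1,-1,0],![1,1,0,0],![0,1,0,-1]]⟩,
  ⟨4,![![-1,0,0,0],![0,-1,-1,0],![1,0,0,-1],![0,1,1,1]]⟩,
  ⟨4,![![-1,0,0,0],![0,-1,-1,0],![1,1,0,0],![0,0,1,-1]]⟩,
  ⟨4,![![-1,0,0,0],![0,-1,-1,0],![1,1,0,0],![1,-1,0,-1]]⟩,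
  ⟨4,![![-1,0,0,0],![0,-1,-1,0],![1,1,0,0],![1,1,0,-1]]⟩,
  ⟨4,![![-1,0,0,0],![1,-1,-1,0],![1,1,0,0],![0,1,0,-1]]⟩,
  ⟨4,![![-1,0,0,0],![1,-1,0,0],![1,0,0,-1],![1,0,-1,0]]⟩,
  ⟨4,![![-1,0,0,0],![1,-1,0,0],![1,0,-1,0],![-1,1,1,-1]]⟩,
  ⟨4,![![-1,0,0,0],![1,-1,-1,0],![1,1,0,0],![0,0,1,-1]]⟩,
  ⟨4,![![-1,0,0,0],![1,-1,-1,0],![1,1,0,0],![1,1,0,-1]]⟩,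
  ⟨4,![![-1,0,0,0],![1,-1,0,0],![-1,1,-1,-1],![1,0,1,0]]⟩,
  ⟨4,![![-1,0,0,0],![1,-1,0,0],![0,1,-1,0],![0,0,1,-1]]⟩,
  ⟨4,![![-1,0,0,0],![1,-1,0,0],![0,1,-1,0],![0,1,0,-1]]⟩,
  ⟨4,![![-1,0,0,0],![1,-1,0,0],![0,0,-1,-1],![1,0,1,0]]⟩,
  ⟨4,![![-1,0,0,0],![1,-1,0,0],![0,1,-1,-1],![1,0,1,0]]⟩,
  ⟨4,![![-1,0,0,0],![1,-1,0,0],![1,-1,-1,0],![0,1,0,-1]]⟩,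
  ⟨4,![![-1,0,0,0],![1,-1,0,0],![1,0,-1,-1],![1,0,1,0]]⟩,
  ⟨4,![![-1,0,0,0],![1,-1,0,0],![1,0,-1,0],![0,0,1,-1]]⟩,
  ⟨4,![![0,-1,0,0],![-1,0,0,0],![-1,-1,0,0],![1,1,-1,-1]]⟩,
  ⟨4,![![0,-1,0,0],![-1,0,0,0],![-1,1,0,0],![1,0,-1,-1]]⟩,
  ⟨4,![![0,-1,0,0],![-1,0,0,0],![-1,1,0,0],![1,1,-1,-1]]⟩,
  ⟨4,![![0,-1,0,0],![-1,0,0,0],![-1,0,-1,0],![1,0,0,-1]]⟩,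
  ⟨4,![![0,-1,0,0],![-1,0,0,0],![0,0,-1,-1],![1,0,1,0]]⟩,
  ⟨4,![![0,-1,0,0],![-1,0,0,0],![0,1,0,-1],![1,0,-1,0]]⟩,
  ⟨4,![![0,-1,0,0],![-1,0,0,0],![0,1,-1,0],![1,0,-1,-1]]⟩,
  ⟨4,![![0,-1,0,0],![-1,0,0,0],![1,0,-1,-1],![0,1,1,0]]⟩,
  ⟨4,![![0,-1,0,0],![-1,0,0,0],![1,0,-1,-1],![1,0,1,0]]⟩,
  ⟨4,![![0,-1,0,0],![-1,0,0,0],![1,0,0,-1],![1,0,-1,0]]⟩,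
  ⟨4,![![0,-1,0,0],![-1,0,0,0],![1,0,-1,0],![0,0,1,-1]]⟩,
  ⟨4,![![0,-1,0,0],![-1,0,0,0],![1,1,0,0],![0,0,-1,-1]]⟩,
  ⟨4,![![0,-1,0,0],![-1,0,0,0],![1,1,0,0],![1,0,-1,-1]]⟩,
  ⟨4,![![0,-1,0,0],![-1,0,0,0],![1,1,0,0],![1,1,-1,-1]]⟩,
  ⟨4,![![0,0,-1,0],![0,-1,0,0],![-1,0,0,0],![1,0,0,-1]]⟩,
  ⟨4,![![0,0,-1,0],![0,-1,0,0],![-1,0,0,0],![1,1,1,-1]]⟩,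
  ⟨4,![![0,-1,-1,0],![-1,0,0,-1],![1,1,1,0],![0,0,-1,1]]⟩,
  ⟨4,![![0,-1,-1,0],![-1,0,0,-1],![1,1,1,0],![1,1,0,0]]⟩,
  ⟨4,![![0,-1,0,0],![-1,0,0,0],![-1,1,0,0],![2,0,-1,-1]]⟩,
  ⟨4,![![0,-1,0,0],![-1,0,0,0],![1,1,0,0],![2,0,-1,-1]]⟩,
  ⟨4,![![0,-1,0,0],![-1,0,0,0],![1,1,0,0],![2,1,-1,-1]]⟩,
  ⟨4,![![0,-1,0,0],![-1,0,0,0],![1,1,0,0],![2,2,-1,-1]]⟩,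
  ⟨5,![![0,0,0,-1],![0,0,-1,0],![0,-1,0,0],![-1,0,0,0],![1,1,0,0]]⟩,
  ⟨5,![![0,0,0,-1],![0,0,-1,0],![0,-1,0,0],![-1,0,0,0],![1,1,1,1]]⟩,
  ⟨5,![![0,-1,0,0],![-1,0,0,0],![-1,1,0,0],![0,1,-1,0],![1,-1,1,-1]]⟩,
  ⟨5,![![0,-1,0,0],![-1,0,0,0],![-1,1,0,0],![1,0,0,-1],![1,0,-1,0]]⟩,
  ⟨5,![![0,-1,0,0],![-1,0,0,0],![-1,1,0,0],![1,0,-1,0],![0,0,1,-1]]⟩,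
  ⟨5,![![0,-1,0,0],![-1,0,0,0],![-1,0,-1,0],![1,1,0,0],![0,-1,0,-1]]⟩,
  ⟨5,![![0,-1,0,0],![-1,0,0,0],![-1,0,-1,0],![1,1,0,0],![1,0,0,-1]]⟩,
  ⟨5,![![0,-1,0,0],![-1,0,0,0],![0,0,-1,-1],![1,0,0,1],![0,1,1,0]]⟩,
  ⟨5,![![0,-1,0,0],![-1,0,0,0],![0,-1,-1,0],![1,1,0,0],![1,0,0,-1]]⟩,
  ⟨5,![![0,-1,0,0],![-1,0,0,0],![0,-1,-1,0],![1,1,0,0],![1,1,0,-1]]⟩,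
  ⟨5,![![0,-1,0,0],![-1,0,0,0],![1,1,0,0],![1,0,-1,0],![0,0,1,-1]]⟩,
  ⟨5,![![0,-1,0,0],![-1,0,0,0],![1,1,0,0],![1,0,-1,0],![1,0,0,-1]]⟩,
  ⟨5,![![0,-1,0,0],![-1,0,0,0],![1,1,0,0],![0,0,-1,-1],![1,1,1,1]]⟩,
  ⟨5,![![0,-1,0,0],![-1,0,0,0],![1,1,0,0],![0,1,-1,0],![1,0,0,-1]]⟩,
  ⟨5,![![0,-1,0,0],![-1,0,0,0],![1,1,0,0],![1,1,-1,0],![0,0,1,-1]]⟩,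
  ⟨5,![![0,-1,0,0],![-1,0,0,0],![1,1,0,0],![1,0,-1,0],![1,1,0,-1]]⟩,
  ⟨5,![![0,-1,0,0],![-1,0,0,0],![1,1,0,0],![1,1,-1,0],![1,1,0,-1]]⟩,
  ⟨5,![![0,0,-1,0],![0,-1,0,0],![-1,0,0,0],![0,-1,-1,0],![1,1,1,-1]]⟩,
  ⟨5,![![0,0,-1,0],![0,-1,0,0],![-1,0,0,0],![0,1,1,0],![1,0,0,-1]]⟩,
  ⟨5,![![0,0,-1,0],![0,-1,0,0],![-1,0,0,0],![1,1,0,0],![1,0,0,-1]]⟩,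
  ⟨5,![![0,0,-1,0],![0,-1,0,0],![-1,0,0,0],![1,1,0,0],![0,-1,0,-1]]⟩,
  ⟨5,![![0,0,-1,0],![0,-1,0,0],![-1,0,0,0],![1,1,0,0],![1,1,0,-1]]⟩,
  ⟨5,![![1,-1,0,0],![-1,1,0,0],![0,-1,0,0],![-1,0,0,0],![0,0,-1,-1]]⟩,
  ⟨5,![![1,-1,0,0],![-1,1,0,0],![0,-1,0,0],![-1,0,0,0],![1,0,-1,-1]]⟩,
  ⟨5,![![1,-1,0,0],![-1,1,0,0],![0,-1,0,0],![-1,0,0,0],![1,1,-1,-1]]⟩,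
  ⟨5,![![1,-1,0,0],![-1,1,-1,0],![0,-1,0,-1],![0,-1,1,-1],![-1,1,-1,1]]⟩,
  ⟨5,![![1,-1,0,0],![-1,1,0,0],![0,-1,0,0],![-1,0,0,0],![2,0,-1,-1]]⟩,
  ⟨6,![![0,0,0,-1],![0,0,-1,0],![0,-1,0,0],![-1,0,0,0],![1,1,0,0],![0,0,1,1]]⟩,
  ⟨6,![![0,0,1,-1],![0,0,-1,1],![0,0,0,-1],![0,0,-1,0],![0,-1,0,0],![-1,0,0,0]]⟩,
  ⟨6,![![1,1,-1,-1],![-1,-1,1,1],![0,0,0,-1],![0,0,-1,0],![0,-1,0,0],![-1,0,0,0]]⟩,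
  ⟨6,![![0,1,-1,0],![0,-1,1,0],![0,0,-1,0],![0,-1,0,0],![-1,0,0,0],![1,0,0,-1]]⟩,
  ⟨6,![![1,0,-1,0],![-1,0,1,0],![0,0,-1,0],![0,-1,0,0],![-1,0,0,0],![1,0,0,-1]]⟩,
  ⟨6,![![1,-1,0,0],![-1,1,0,0],![0,-1,0,0],![-1,0,0,0],![-1,0,-1,0],![1,0,0,-1]]⟩,
  ⟨6,![![1,-1,0,0],![-1,1,0,0],![0,-1,0,0],![-1,0,0,0],![-1,1,-1,0],![1,0,0,-1]]⟩,
  ⟨6,![![1,-1,0,0],![-1,1,0,0],![0,-1,0,0],![-1,0,0,0],![0,1,0,-1],![1,0,-1,0]]⟩,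
  ⟨6,![![1,-1,0,0],![-1,1,0,0],![0,-1,0,0],![-1,0,0,0],![1,0,0,-1],![1,0,-1,0]]⟩,
  ⟨6,![![1,-1,0,0],![-1,1,0,0],![0,-1,0,0],![-1,0,0,0],![1,0,-1,0],![0,0,1,-1]]⟩,
  ⟨7,![![0,0,1,-1],![0,0,-1,1],![0,0,0,-1],![0,0,-1,0],![0,-1,0,0],![-1,0,0,0],![1,1,0,0]]⟩,
  ⟨8,![![1,0,0,-1],![0,1,-1,0],![0,-1,1,0],![-1,0,0,1],![0,0,0,-1],![0,0,-1,0],![0,-1,0,0],![-1,0,0,0]]⟩]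

/-- The ambient space number `n`, for `1 ≤ n ≤ 124`. -/
def space (n : ℕ) : ToricSpace := database.getD (n - 1) ⟨0, ![]⟩

namespace ToricSpace

variable (A : ToricSpace)

/-! ### Fan, Picard group and Kähler cone -/

/-- The index set of the vertices `v_ρ` of `Δ°`, that is, of the edges of the fan. -/
abbrev Ray : Type := Fin (4 + A.h)

/-- The vertex `v_ρ` of `Δ°`. -/
def vertex : A.Ray → Fin 4 → ℤ :=
  Fin.append (fun i => Pi.single i 1) A.extra

/-- `⟨m, v_ρ⟩` for `m ∈ M_ℝ = ℝ⁴`. -/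
noncomputable def pairing (m : Fin 4 → ℝ) (ρ : A.Ray) : ℝ := ∑ i, m i * (A.vertex ρ i : ℝ)

/-- The vertices `v_ρ`, `ρ ∈ S`, are the generators of a cone of the fan: they are the vertices on
a face of `Δ°`, cut out by a point `m` of the polytope `Δ` dual to `Δ°`. -/
def IsCone (S : Finset A.Ray) : Prop :=
  ∃ m : Fin 4 → ℝ, (∀ ρ, -1 ≤ A.pairing m ρ) ∧ ∀ ρ, ρ ∈ S ↔ A.pairing m ρ = -1

/-- The maximal cones of the (simplicial, complete) fan are those with four generators. -/
def IsMaxCone (S : Finset A.Ray) : Prop := A.IsCone S ∧ S.card = 4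

/-- `Pic(𝒜) ≅ H²(𝒜, ℤ) ≅ ℤ^{k-4}`. For the favourable hypersurface `X` this is also `Pic(X)`. -/
abbrev Pic : Type := Fin A.h → ℤ

/-- The class in `Pic(𝒜)` of the toric divisor `D_ρ`, i.e. the column `β_ρ` of the charge matrix.
The rows of this matrix are the linear relations `v_{4+r} - ∑ i, (v_{4+r})_i e_i = 0`, which form
a `ℤ`-basis of the lattice of all linear relations between the vertices. -/
def divisor : A.Ray → A.Pic :=
  Fin.append (fun i r => - A.extra r i) (fun r => Pi.single r 1)

/-- `L ∈ H²(𝒜, ℝ)` is a Kähler class: `L = ∑ a_ρ [D_ρ]` with strictly convex support function,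
where `m_σ` denotes the linear function that equals the support function on the cone `σ`. -/
def IsKahler (L : Fin A.h → ℝ) : Prop :=
  ∃ a : A.Ray → ℝ, (∀ r, ∑ ρ, a ρ * (A.divisor ρ r : ℝ) = L r) ∧
    ∀ S, A.IsMaxCone S → ∃ m : Fin 4 → ℝ,
      (∀ ρ ∈ S, A.pairing m ρ = - a ρ) ∧ ∀ ρ ∉ S, - a ρ < A.pairing m ρ

/-- `L ∈ H²(𝒜, ℝ)` lies in the closed Kähler cone (the nef cone): `L = ∑ a_ρ [D_ρ]` with convex
support function. -/
def IsNef (L : Fin A.h → ℝ) : Prop :=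
  ∃ a : A.Ray → ℝ, (∀ r, ∑ ρ, a ρ * (A.divisor ρ r : ℝ) = L r) ∧
    ∀ S, A.IsMaxCone S → ∃ m : Fin 4 → ℝ,
      (∀ ρ ∈ S, A.pairing m ρ = - a ρ) ∧ ∀ ρ ∉ S, - a ρ ≤ A.pairing m ρ

/-- The real cohomology class of an integral class. -/
def toReal (L : A.Pic) : Fin A.h → ℝ := fun r => (L r : ℝ)

/-- `A` is simple: the Kähler cone is simplicial, i.e. it has as many facets as its dimension. -/
def IsSimple : Prop :=
  ∃ J : Module.Basis (Fin A.h) ℝ (Fin A.h → ℝ), ∀ L : Fin A.h → ℝ,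
    A.IsNef L ↔ ∃ t : Fin A.h → ℝ, (∀ r, 0 ≤ t r) ∧ L = ∑ r, t r • J r

/-- A `ℤ`-basis `J̃_r` of `H²(X, ℤ)` consisting of the generators of the Kähler cone. -/
def IsKahlerBasis (J : Module.Basis (Fin A.h) ℤ A.Pic) : Prop :=
  ∀ L : Fin A.h → ℝ,
    A.IsNef L ↔ ∃ t : Fin A.h → ℝ, (∀ r, 0 ≤ t r) ∧ L = ∑ r, t r • A.toReal (J r)

/-- `𝒜` is a product of projective spaces: the edges fall into `h` blocks (the homogeneous
coordinates of the factors) such that the vertices of each block add up to zero. -/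
def IsProjectiveProduct : Prop :=
  ∃ q : A.Ray → Fin A.h, Function.Surjective q ∧
    ∀ r, ∑ ρ ∈ Finset.univ.filter (fun ρ => q ρ = r), A.vertex ρ = 0

/-! ### Intersection numbers and Chern classes -/

/-- `κ` is the quadruple intersection form of `𝒜` on `Pic(𝒜)`: it is symmetric and multilinear,
four distinct toric divisors have intersection number `1` if their edges span a cone, and toric
divisors (possibly repeated) whose edges do not lie in a common cone have intersection number `0`. -/
def IsIntersectionForm (κ : MultilinearMap ℤ (fun _ : Fin 4 => A.Pic) ℤ) : Prop :=
  (∀ (g : Equiv.Perm (Fin 4)) (x : Fin 4 → A.Pic), κ (x ∘ g) = κ x) ∧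
  (∀ ρ : Fin 4 → A.Ray, Function.Injective ρ → (∃ S, A.IsCone S ∧ ∀ i, ρ i ∈ S) →
    κ (fun i => A.divisor (ρ i)) = 1) ∧
  (∀ ρ : Fin 4 → A.Ray, (¬ ∃ S, A.IsCone S ∧ ∀ i, ρ i ∈ S) →
    κ (fun i => A.divisor (ρ i)) = 0)

open Classical in
/-- The quadruple intersection form of `𝒜`. -/
noncomputable def intersectionForm : MultilinearMap ℤ (fun _ : Fin 4 => A.Pic) ℤ :=
  if hκ : ∃ κ, A.IsIntersectionForm κ then hκ.choose else 0

/-- The class of the normal bundle of the anticanonical (Calabi-Yau) hypersurface `X`. -/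
def normalBundle : A.Pic := ∑ ρ, A.divisor ρ

/-- The triple intersection form `∫_X a ∧ b ∧ c` of `X`. -/
noncomputable def triple (a b c : A.Pic) : ℤ := A.intersectionForm ![a, b, c, A.normalBundle]

/-- `∫_X c₂(X) ∧ L`, where `c₂(X) = ∑_{ρ<σ} D_ρ D_σ`. -/
noncomputable def chern2 (L : A.Pic) : ℤ :=
  ∑ ρ, ∑ σ ∈ Finset.Ioi ρ, A.triple (A.divisor ρ) (A.divisor σ) L

/-- The Euler number `χ(X) = ∫_X c₃(X)`, where
`c₃(X) = ∑_{ρ<σ<τ} D_ρ D_σ D_τ - (∑_{ρ<σ} D_ρ D_σ) (∑_τ D_τ)`. -/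
noncomputable def eulerNumber : ℤ :=
  (∑ ρ, ∑ σ ∈ Finset.Ioi ρ, ∑ τ ∈ Finset.Ioi σ,
    A.triple (A.divisor ρ) (A.divisor σ) (A.divisor τ)) - A.chern2 A.normalBundle

/-- The bounds `(2/N) c̃₂ᵣ(X) ≥ M_{rs} b_max^s`, `M_{rs} = ∑_t d̃_{rst}`, in the basis of generators
of the Kähler cone, have a solution in strictly positive integers `b_max^s` for `N = 3`, `4` or `5`. -/
def IsCandidate : Prop :=
  ∃ J : Module.Basis (Fin A.h) ℤ A.Pic, A.IsKahlerBasis J ∧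
    ∃ N ∈ ({3, 4, 5} : Finset ℕ), ∃ b : Fin A.h → ℤ, (∀ s, 1 ≤ b s) ∧
      ∀ r, ∑ s, (∑ t, (A.triple (J r) (J s) (J t) : ℚ)) * (b s : ℚ)
        ≤ 2 / (N : ℚ) * (A.chern2 (J r) : ℚ)

/-! ### Monads -/

/-- The data of a monad `0 → V → B → C → 0` on `X`: the direct sums `B` and `C` of line bundles on
`X`, i.e. finite families of classes in `Pic(X)` up to the order of the summands. -/
@[ext] structure MonadData where
  B : Multiset A.Pic
  C : Multiset A.Pic

variable {A}

/-- `∫_X c₂(V) ∧ L` for a monad with `c₁(V) = 0`. -/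
noncomputable def MonadData.chern2 (V : A.MonadData) (L : A.Pic) : ℚ :=
  (((V.C.map fun c => A.triple c c L).sum - (V.B.map fun b => A.triple b b L).sum : ℤ) : ℚ) / 2

/-- `ind(V) = ½ ∫_X c₃(V)`, where `c₃(V) = ⅓ (∑ b³ - ∑ c³)`. -/
noncomputable def MonadData.index (V : A.MonadData) : ℚ :=
  (((V.B.map fun b => A.triple b b b).sum - (V.C.map fun c => A.triple c c c).sum : ℤ) : ℚ) / 3 / 2

/-- Anomaly-free positive `SU(N)` monads. -/
structure MonadData.IsPositiveMonad (V : A.MonadData) (N : ℕ) : Prop where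
  /-- `V` has rank `N`. -/
  rank_eq : Multiset.card V.B = Multiset.card V.C + N
  /-- Positivity of `B`. -/
  pos_B : ∀ b ∈ V.B, A.IsKahler (A.toReal b)
  /-- Positivity of `C`. -/
  pos_C : ∀ c ∈ V.C, A.IsKahler (A.toReal c)
  /-- Bundleness: the summands of `C ⊗ B*` lie in the closed Kähler cone. -/
  bundle : ∀ b ∈ V.B, ∀ c ∈ V.C, A.IsNef (A.toReal (c - b))
  /-- Non-triviality: `B` and `C` have no line bundle in common. -/
  nontrivial : ∀ b ∈ V.B, ∀ c ∈ V.C, b ≠ c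
  /-- `c₁(V) = 0`. -/
  chern1_eq_zero : V.B.sum = V.C.sum
  /-- Anomaly cancellation: `c₂(X) - c₂(V)` lies in the Mori cone, the dual of the Kähler cone. -/
  anomaly : ∀ L : A.Pic, A.IsNef (A.toReal L) → V.chern2 L ≤ (A.chern2 L : ℚ)

/-- The basic three-family constraint: `ind(V) = 3k` with `k ≠ 0` and `k ∣ χ(X)`. -/
def MonadData.IsThreeFamily (V : A.MonadData) : Prop :=
  ∃ k : ℤ, k ≠ 0 ∧ V.index = 3 * (k : ℚ) ∧ k ∣ A.eulerNumber

variable (A)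

/-- Automorphisms of `Pic(𝒜)` induced by exchanging projective space factors of equal dimension, for
`𝒜 = ∏ ℙ^{n_i}`. There, each `D_ρ` is one of the hyperplane classes `H_i`, and `H_i` occurs `n_i + 1`
times among the `D_ρ`, so that these are the automorphisms `H_i ↦ H_{g(i)}` with `n_{g(i)} = n_i`. -/
def IsFactorExchange (φ : A.Pic ≃+ A.Pic) : Prop :=
  A.IsProjectiveProduct ∧ ∃ g : Equiv.Perm A.Ray, ∀ ρ, φ (A.divisor ρ) = A.divisor (g ρ)

/-- Monads are identified if they agree up to the order of the summands of `B` and `C` (which is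
built into multisets) and, on products of projective spaces, up to exchanging equal factors. -/
def monadSetoid : Setoid A.MonadData where
  r V W := V = W ∨ ∃ φ : A.Pic ≃+ A.Pic, A.IsFactorExchange φ ∧
    W.B = V.B.map φ ∧ W.C = V.C.map φ
  iseqv :=
    { refl := fun V => Or.inl rfl
      symm := by
        rintro V W (rfl | ⟨φ, ⟨hp, g, hg⟩, hB, hC⟩)
        · exact Or.inl rfl
        · refine Or.inr ⟨φ.symm, ⟨hp, g.symm, fun ρ => ?_⟩, ?_, ?_⟩
          · rw [AddEquiv.symm_apply_eq, hg, Equiv.apply_symm_apply]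
          · rw [hB, Multiset.map_map]; simp
          · rw [hC, Multiset.map_map]; simp
      trans := by
        rintro U V W (rfl | ⟨φ, ⟨hp, g, hg⟩, hB, hC⟩) (rfl | ⟨ψ, ⟨hp', k, hk⟩, hB', hC'⟩)
        · exact Or.inl rfl
        · exact Or.inr ⟨ψ, ⟨hp', k, hk⟩, hB', hC'⟩
        · exact Or.inr ⟨φ, ⟨hp, g, hg⟩, hB, hC⟩
        · refine Or.inr ⟨φ.trans ψ, ⟨hp, g.trans k, fun ρ => ?_⟩, ?_, ?_⟩
          · simp [hg, hk]
          · rw [hB', hB, Multiset.map_map]; rfl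
          · rw [hC', hC, Multiset.map_map]; rfl }

/-- Monads modulo permutation. -/
abbrev MonadClass : Type := Quotient A.monadSetoid

/-- The classes of anomaly-free positive `SU(N)` monads. -/
def positiveClasses (N : ℕ) : Set A.MonadClass :=
  Quotient.mk A.monadSetoid '' {V | V.IsPositiveMonad N}

/-- The classes of anomaly-free positive `SU(N)` monads with the three-family constraint. -/
def threeFamilyClasses (N : ℕ) : Set A.MonadClass :=
  Quotient.mk A.monadSetoid '' {V | V.IsPositiveMonad N ∧ V.IsThreeFamily}

end ToricSpace

/-! ### The classification -/

/-- The numbers of the simple spaces. -/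
def simpleSpaces : Set ℕ := {n | n ∈ Set.Icc 1 124 ∧ (space n).IsSimple}

/-- The numbers of the simple spaces not eliminated by the bounds on `b_max`. -/
def candidateSpaces : Set ℕ := {n | n ∈ simpleSpaces ∧ (space n).IsCandidate}

/-- The numbers of the simple spaces that are products of projective spaces. -/
def productSpaces : Set ℕ := {n | n ∈ simpleSpaces ∧ (space n).IsProjectiveProduct}

/-- The numbers of the simple spaces with an anomaly-free positive monad of rank `3`, `4` or `5`. -/
def monadSpaces : Set ℕ :=
  {n | n ∈ simpleSpaces ∧
    ∃ N ∈ ({3, 4, 5} : Finset ℕ), ∃ V : (space n).MonadData, V.IsPositiveMonad N}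

/-- All anomaly-free positive `SU(N)` monads on simple spaces, modulo permutation. -/
def models (N : ℕ) : Set (Σ n : ℕ, (space n).MonadClass) :=
  {x | x.1 ∈ simpleSpaces ∧ x.2 ∈ (space x.1).positiveClasses N}

/-- Those satisfying the three-family constraint. -/
def threeFamilyModels (N : ℕ) : Set (Σ n : ℕ, (space n).MonadClass) :=
  {x | x.1 ∈ simpleSpaces ∧ x.2 ∈ (space x.1).threeFamilyClasses N}

/-- The models on products of projective spaces. -/
def onProducts : Set (Σ n : ℕ, (space n).MonadClass) := {x | x.1 ∈ productSpaces}

/-- The numbers of positive `SU(3)`, `SU(4)` and `SU(5)` monads on the space number `n`. -/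
def monadTable : ℕ → ℕ × ℕ × ℕ
  | 1 => (20, 14, 9)
  | 2 => (611, 308, 56)
  | 3 => (4, 0, 0)
  | 4 => (9, 0, 0)
  | 6 => (153, 35, 19)
  | 7 => (38, 27, 10)
  | 12 => (74, 0, 0)
  | 17 => (34, 0, 0)
  | 22 => (9, 0, 0)
  | 26 => (304, 135, 0)
  | 40 => (251, 70, 0)
  | _ => (0, 0, 0)

end ToricMonad

open ToricMonad

namespace ToricMonad

/-! ### Computable checks on lists

The basic list functions are defined by recursors, which the kernel evaluates fast. -/

section Primitives

variable {α β : Type}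

/-! The classification is a finite computation, made rigorous by certificates: for each space a list
of linear relations between the vertices and a list of nef classes is given, and every geometric
statement follows from arithmetic checks on these lists.

Fan. A relation of positive total degree shows that the rays with positive coefficient do not lie in
a common cone (`IsCone.not_posSupport_subset`). The four-element sets of rays that contain none of
these supports are enumerated, and each is confirmed to span a maximal cone by its dual basis. So
the maximal cones are known exactly (`Fan.isMaxCone_iff`), and nef and Kähler classes are recognized
by finitely many inequalities.

Kähler cone. For a simple space, `h` relations that are nonnegative on nef classes form a basis dual
to `h` nef classes; the nef cone lies between the cone over the latter and the dual of the former,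
which coincide (`kahlerBasisOfCheck`). For the other spaces the order defined by the nef cone
violates the Riesz decomposition property, which holds for every simplicial cone
(`IsSimple.exists_nef_le`).

Intersection numbers. A sum of fourth powers of linear forms is suggested by torus localization at
the fixed points. The localization theorem itself is not needed: after scaling by a common
denominator, the sum is checked to have the values that characterize the intersection form, and
linear equivalence of divisors (`Fan.dvd_of_dvd_divisor`) yields both uniqueness and integrality.

Candidates. The intersection numbers of the Kähler generators are nonnegative, so the bounds on
`b_max` have a solution if and only if `N = 3` and all `b = 1` is one
(`KahlerBasis.isCandidate_iff`).

Monads. In Kähler coordinates the nef cone is an orthant. Let `u` be the coordinatewise supremum of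
`B` and `e` the sum of the generators, so that `e ≤ b ≤ u ≤ c`. Rank and first Chern class give `∑
(u - b) + ∑ (c - u) = N u`, and the anomaly condition becomes `∑ (b - e)(u - b) + ∑ (c - e)(c - u) ≤
2 c₂ - N e u` on the generators, where all terms on the left are nonnegative (`sum_excess`). This
bounds `u`, hence proves that monads live on candidates, and reduces the classification for fixed
`u` to decomposing the vector `N u` into nonzero vectors of bounded total cost. The search is
complete by `HasForm.exists_complete`; its results are tested again, so that it is also sound.

Counting. In each class modulo exchange of factors, the search keeps a representative that minimizes
an encoding of `u` and, next, an order-independent hash. Pairwise distinct hashes of the results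
show that no class occurs twice (`HasForm.encard_classes`). Summation over the finitely many simple
spaces gives the totals. -/

def lmap (f : α → β) (l : List α) : List β := List.rec [] (fun a _ ih => f a :: ih) l

def lall (f : α → Bool) (l : List α) : Bool :=
  List.rec true (fun a _ ih => Bool.rec false ih (f a)) l

def lany (f : α → Bool) (l : List α) : Bool :=
  List.rec false (fun a _ ih => Bool.rec ih true (f a)) l

def lfilter (f : α → Bool) (l : List α) : List α :=
  List.rec [] (fun a _ ih => Bool.rec ih (a :: ih) (f a)) l

def lappend (l k : List α) : List α := List.rec k (fun a _ ih => a :: ih) l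

/-- The entry number `i`. -/
def lget (d : α) (l : List α) : ℕ → α :=
  List.rec (fun _ => d) (fun a _ ih i => Nat.rec a (fun j _ => ih j) i) l

/-- The list `[(x_0, k), (x_1, k + 1), …]`. -/
def withIndex (l : List α) : ℕ → List (α × ℕ) :=
  List.rec (fun _ => []) (fun a _ ih k => (a, k) :: ih (Nat.succ k)) l

def lsum (l : List ℤ) : ℤ := List.rec 0 (fun a _ ih => Int.add a ih) l

def lprod (l : List ℤ) : ℤ := List.rec 1 (fun a _ ih => Int.mul a ih) l

/-- The scalar product of two integer vectors. -/
def dot (x : List ℤ) : List ℤ → ℤ :=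
  List.rec (fun _ => 0)
    (fun a _ ih y => List.rec 0 (fun b y' _ => Int.add (Int.mul a b) (ih y')) y) x

def nonnegB : ℤ → Bool
  | .ofNat _ => true
  | .negSucc _ => false

def posB : ℤ → Bool
  | .ofNat n => Nat.blt 0 n
  | .negSucc _ => false

def zeroB : ℤ → Bool
  | .ofNat n => Nat.beq n 0
  | .negSucc _ => false

def eqB (a b : ℤ) : Bool := zeroB (Int.sub a b)

/-- The list `[k, …, k + n - 1]`. -/
def upFrom (n : ℕ) : ℕ → List ℕ := Nat.rec (fun _ => []) (fun _ ih k => k :: ih (Nat.succ k)) n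

/-- The set of the entries of a list, encoded as a number. -/
def mask (l : List ℕ) : ℕ := List.rec 0 (fun a _ ih => Nat.lor (Nat.shiftLeft 1 a) ih) l

/-- Inclusion of sets encoded as numbers. -/
def subB (P S : ℕ) : Bool := Nat.beq (Nat.land P S) P

end Primitives

/-- The list `[0, …, n - 1]`. -/
def upTo (n : ℕ) : List ℕ := upFrom n 0

def unitVec (n i : ℕ) : List ℤ := lmap (fun j => Bool.rec 0 1 (Nat.beq j i)) (upTo n)

/-! ### Computable toric data: vertices, divisor classes, maximal cones, localization. -/

namespace ToricSpace

/-- The vertices other than the standard unit vectors, as a list. -/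
def rows (A : ToricSpace) : List (List ℤ) :=
  List.ofFn fun r => List.ofFn (A.extra r)

end ToricSpace

/-- The vertices of `Δ°`. -/
def vertexList (X : List (List ℤ)) : List (List ℤ) :=
  lappend (lmap (unitVec 4) (upTo 4)) X

/-- The classes of the toric divisors. -/
def divisorList (X : List (List ℤ)) : List (List ℤ) :=
  lappend (lmap (fun i => lmap (fun v => Int.neg (lget 0 v i)) X) (upTo 4))
    (lmap (unitVec X.length) (upTo X.length))

/-- Sublists of length `k` of a list of rays which contain none of the sets in `Ps`. -/
def faces (Ps : List ℕ) (k : ℕ) : List ℕ → List (List ℕ) :=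
  Nat.rec (fun _ => [[]]) (fun _ ih l => List.rec [] (fun a l' ih' =>
    lappend (lfilter (fun S => lall (fun P => not (subB P (mask S))) Ps) (lmap (a :: ·) (ih l')))
      ih') l) k

/-- The rays `ρ` at which the functional `l` is positive. -/
def posSupport (ds : List (List ℤ)) (l : List ℤ) : List ℕ :=
  lmap Prod.snd (lfilter (fun d => posB (dot l d.1)) (withIndex ds 0))

/-- The rays `ρ` at which the functional `l` is negative. -/
def negSupport (ds : List (List ℤ)) (l : List ℤ) : List ℕ :=
  lmap Prod.snd (lfilter (fun d => not (nonnegB (dot l d.1))) (withIndex ds 0))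

/-- The basis of `ℤ⁴` dual to four vectors that form a basis. -/
def dualBasis : List (List ℤ) → List (List ℤ)
  | [[a0, a1, a2, a3], [b0, b1, b2, b3], [c0, c1, c2, c3], [d0, d1, d2, d3]] =>
    let s0 := a0 * b1 - b0 * a1
    let s1 := a0 * b2 - b0 * a2
    let s2 := a0 * b3 - b0 * a3
    let s3 := a1 * b2 - b1 * a2
    let s4 := a1 * b3 - b1 * a3
    let s5 := a2 * b3 - b2 * a3
    let t5 := c2 * d3 - d2 * c3
    let t4 := c1 * d3 - d1 * c3
    let t3 := c1 * d2 - d1 * c2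
    let t2 := c0 * d3 - d0 * c3
    let t1 := c0 * d2 - d0 * c2
    let t0 := c0 * d1 - d0 * c1
    -- Laplace expansion of the determinant by the minors `s` of the first two vectors and `t` of
    -- the last two. For a lattice basis it is `±1`, so that multiplication by `e` replaces the
    -- division of the cofactors by the determinant.
    let e := s0 * t5 - s1 * t4 + s2 * t3 + s3 * t2 - s4 * t1 + s5 * t0
    [[(b1 * t5 - b2 * t4 + b3 * t3) * e, (-b0 * t5 + b2 * t2 - b3 * t1) * e,
      (b0 * t4 - b1 * t2 + b3 * t0) * e, (-b0 * t3 + b1 * t1 - b2 * t0) * e],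
     [(-a1 * t5 + a2 * t4 - a3 * t3) * e, (a0 * t5 - a2 * t2 + a3 * t1) * e,
      (-a0 * t4 + a1 * t2 - a3 * t0) * e, (a0 * t3 - a1 * t1 + a2 * t0) * e],
     [(d1 * s5 - d2 * s4 + d3 * s3) * e, (-d0 * s5 + d2 * s2 - d3 * s1) * e,
      (d0 * s4 - d1 * s2 + d3 * s0) * e, (-d0 * s3 + d1 * s1 - d2 * s0) * e],
     [(-c1 * s5 + c2 * s4 - c3 * s3) * e, (c0 * s5 - c2 * s2 + c3 * s1) * e,
      (-c0 * s4 + c1 * s2 - c3 * s0) * e, (c0 * s3 - c1 * s1 + c2 * s0) * e]]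
  | _ => []

/-- A maximal cone of the fan: its rays, the dual basis, the values of the dual basis on the
vertices, and these values on the vertices outside the cone. -/
structure ConeData where
  S : List ℕ
  U : List (List ℤ)
  w : List (List ℤ × ℕ)
  out : List (List ℤ × ℕ)

/-- For a cone that passes `ConeData.check`, the sum of the dual basis takes the value `1` exactly
on the generators, and so `out` lists precisely the rays outside the cone. -/
def coneData (vs : List (List ℤ)) (S : List ℕ) : ConeData :=
  let U := dualBasis (lmap (lget [] vs) S)
  let w := withIndex (lmap (fun v => lmap (fun u => dot u v) U) vs) 0
  ⟨S, U, w, lfilter (fun p => posB (Int.sub 1 (lsum p.1))) w⟩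

def unitMatrixB (M : List (List ℤ)) (n : ℕ) : Bool :=
  lall (fun i => lall (fun j => eqB (lget 0 (lget [] M i) j) (Bool.rec 0 1 (Nat.beq j i))) (upTo n))
    (upTo n)

/-- `dualBasis` is dual to the generators, and all other vertices lie above the facet. -/
def ConeData.check (c : ConeData) : Bool :=
  unitMatrixB (lmap (fun s => (lget ([], 0) c.w s).1) c.S) 4 &&
  lall (fun p => posB (Int.sub 1 (lsum p.1)) || lany (Nat.beq p.2) c.S) c.w

/-- Whether the values `a_ρ + ⟨m_S, v_ρ⟩` of the divisor class `L = ∑ a_ρ D_ρ` at the rays outside the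
cone have the property `f`. -/
def ConeData.test (f : ℤ → Bool) (c : ConeData) (L : List ℤ) : Bool :=
  let a := 0 :: 0 :: 0 :: 0 :: L
  let aS := lmap (lget 0 a) c.S
  lall (fun p => f (Int.sub (lget 0 a p.2) (dot aS p.1))) c.out

/-- The combinatorial data of a space: divisor classes, sets of rays without a common cone, and the
maximal cones. -/
structure FanData where
  ds : List (List ℤ)
  Ps : List (List ℕ)
  masks : List ℕ
  cones : List ConeData
  coneMasks : List ℕ

def fanData (X ls : List (List ℤ)) : FanData :=
  let ds := divisorList X
  let Ps := lmap (posSupport ds) ls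
  let masks := lmap mask Ps
  let Ss := faces masks 4 (upTo (Nat.add 4 X.length))
  ⟨ds, Ps, masks, lmap (coneData (vertexList X)) Ss, lmap mask Ss⟩

def vecSum (n : ℕ) (xs : List (List ℤ)) : List ℤ :=
  lmap (fun i => lsum (lmap (fun x => lget 0 x i) xs)) (upTo n)

/-- The first condition makes each positive support a set of rays without a common cone; the second
confirms that every four-element set that survives this exclusion is a maximal cone. Together they
determine the maximal cones. -/
def FanData.check (F : FanData) (ls : List (List ℤ)) : Bool :=
  lall (fun l => posB (lsum (lmap (dot l) F.ds))) ls && lall ConeData.check F.cones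

/-- `l` is nonnegative on the nef cone, since it is a relation with nonnegative coefficients outside
a cone of the fan. -/
def FanData.moriCheck (F : FanData) (l : List ℤ) : Bool :=
  let Q := mask (negSupport F.ds l)
  lany (subB Q) F.coneMasks

/-- The linear form of the localization formula for the fixed point of a maximal cone. -/
def localForm (h : ℕ) (c : ConeData) (ξ : List ℤ) : List ℤ :=
  let z := withIndex (lmap (fun u => dot u ξ) c.U) 0
  lmap (fun r => Int.neg (lsum (lmap (fun p =>
    Bool.rec 0 p.1 (Nat.beq (lget 0 c.S p.2) (Nat.add 4 r))) z))) (upTo h)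

/-- The vector of the localization formula. -/
def torusWeight : List ℤ := [9, -4, -2, -1]

/-- A common denominator of the localization formula. -/
def commonDenom : ℤ := 43243200

abbrev LocalForms : Type := List (ℤ × List ℤ)

/-- The summands of the localization formula: the coefficient of a fixed point is the inverse of the
product of its tangent weights, cleared of denominators. Neither the localization theorem nor the
exactness of the division is assumed anywhere, since `intersectionCheck` tests the resulting form
directly. -/
def localForms (h : ℕ) (F : FanData) : LocalForms :=
  lmap (fun c => (Int.tdiv commonDenom (lprod (lmap (fun u => dot u torusWeight) c.U)),
    localForm h c torusWeight)) F.cones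

def coeffSum (f : LocalForms) : ℤ := lsum (lmap Prod.fst f)

/-- Multiplication of the coefficients by the values at `x`. -/
def mulForm (x : List ℤ) (f : LocalForms) : LocalForms :=
  lfilter (fun p => not (zeroB p.1)) (lmap (fun p => (Int.mul p.1 (dot p.2 x), p.2)) f)

/-- Multiplication of the coefficients by the entries number `r`. -/
def mulCoord (r : ℕ) (f : LocalForms) : LocalForms :=
  lfilter (fun p => not (zeroB p.1)) (lmap (fun p => (Int.mul p.1 (lget 0 p.2 r), p.2)) f)

/-- `∑ a λ^k` vanishes as a polynomial of degree `k`. -/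
def vanishes (k : ℕ) : ℕ → LocalForms → Bool :=
  Nat.rec (fun _ f => zeroB (coeffSum f))
    (fun _ ih h f => lall (fun r => ih (Nat.succ r) (mulCoord r f)) (upTo h)) k

def mulForms (xs : List (List ℤ)) (f : LocalForms) : LocalForms :=
  List.rec f (fun x _ ih => mulForm x ih) xs

/-- The three conditions: the form takes the value `commonDenom` on each maximal cone; a product
containing a nonface times arbitrary remaining factors vanishes (nothing has to be checked if the
nonface has more than four rays); and every set of fewer than four rays without a nonface lies in a
maximal cone. -/
def FanData.intersectionCheck (F : FanData) (h : ℕ) : Bool :=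
  let f := localForms h F
  lall (fun c => eqB (coeffSum (mulForms (lmap (lget [] F.ds) c.S) f)) commonDenom) F.cones &&
  lall (fun P => Nat.blt 4 P.length ||
    vanishes (Nat.sub 4 P.length) h (mulForms (lmap (lget [] F.ds) P) f)) F.Ps &&
  lall (fun k => lall (fun T => lany (subB (mask T)) F.coneMasks)
    (faces F.masks k (upTo (Nat.add 4 h)))) (upTo 4)

def isIdentity (h : ℕ) (M J : List (List ℤ)) : Bool :=
  unitMatrixB (lmap (fun l => lmap (fun x => dot l x) J) M) h

/-- The nef cone is squeezed between the cone over the nef classes `J` and the dual of the cone over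
the relations `M`, which are nonnegative on nef classes. Duality of `J` and `M` makes the two cones
equal. One Kähler class `E` suffices to identify the open cone as well. -/
def simpleCheck (X ls J : List (List ℤ)) : Bool :=
  let F := fanData X ls
  let h := X.length
  let M := ls.take h
  let E := vecSum h J
  Nat.beq J.length h && F.check ls && isIdentity h M J && lall F.moriCheck M &&
  lall (fun c => lall (c.test nonnegB) J && c.test posB E) F.cones &&
  F.intersectionCheck h

end ToricMonad

/-! ### Certificates: relations between the vertices and nef classes of the 124 spaces. -/

namespace ToricMonad

/-- For each space, functionals on the Picard group given by linear relations between the vertices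
(one for each set of rays that is minimal among those without a common cone), and classes in the nef
cone. If the space is simple, the first `h` relations generate the Mori cone and the classes are the
dual basis; otherwise the classes are `a, c₁, …, c_k` as in `nonsimpleCheck`. A vector is given by
its entries, increased by two, as decimal digits. -/
def relationData : List (List ℕ × List ℕ) := [
  ([3],[3]), ([23,32],[23,32]), ([23,32],[23,32]), ([23,32],[23,32]), ([23,32],[23,32]), ([32,23],
    [32,23]), ([23,32],[23,32]), ([23,32],[23,32]), ([23,32],[23,32]), ([23,32],[23,32]), ([223,132,
    322],[223,232,332]), ([322,232,223],[322,232,223]), ([233,323,221,322,232],[232,322,331]),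
    ([233,323,221,322,232],[232,322,331]), ([233,323,221,322,232],[232,322,331]), ([223,232,322],
    [223,232,322]), ([232,223,322],[232,223,322]), ([233,323,221,322,232],[232,322,331]), ([123,232,
    322],[223,232,323]), ([223,232,322],[223,232,322]), ([223,232,322],[223,232,322]), ([223,232,
    322],[223,232,322]), ([232,321,223,322,233],[232,322,323]), ([223,232,322],[223,232,322]),
    ([223,232,322],[223,232,322]), ([223,232,322],[223,232,322]), ([223,232,322],[223,232,322]),
    ([223,232,322],[223,232,322]), ([233,323,221,232,322],[232,322,331]), ([233,323,221,232,322],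
    [232,322,331]), ([223,132,322],[223,232,332]), ([233,323,221,322,232],[232,322,331]), ([223,232,
    322],[223,232,322]), ([223,232,322],[223,232,322]), ([213,232,322],[223,233,322]), ([223,232,
    322],[223,232,322]), ([223,313,231,322,232],[233,322,332]), ([223,232,322],[223,232,322]),
    ([2333,3233,2212,2221,2322,2323,3222,3223,3232,2332],[2322,3222,3312,3321]), ([2223,2232,2322,
    3222],[2223,2232,2322,3222]), ([2233,1322,3223,2221,3222,2232],[2232,2322,3322,3331]), ([2233,
    1322,3223,2221,3222,2232],[2232,2322,3322,3331]), ([2223,2232,1322,3222],[2223,2232,2322,3322]),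
    ([3222,2322,3122,2213,2232,2223,3231,2332,1323],[2233,3233,3323]), ([2223,2232,1322,3222],[2223,
    2232,2322,3322]), ([2223,2332,3232,2212,3222,2322],[2223,2322,3222,3312]), ([2323,2232,3233,
    2211,3222,2221,2322],[2322,2331,3222,3321]), ([2223,2332,3232,2212,3222,2322],[2223,2322,3222,
    3312]), ([2212,3222,3232,2321,2322,2223,2332,3123,2233],[3222,3313,3322]), ([2213,2332,3232,
    2212,3222,2322],[2223,2322,3222,3311]), ([2223,2332,3232,2212,3222,2322],[2223,2322,3222,3312]),
    ([2223,2232,2322,3222],[2223,2232,2322,3222]), ([2232,2322,3221,2223,3222,2323,2233],[2232,2322,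
    3222,3223]), ([2223,2332,3232,2212,3222,2322],[2223,2322,3222,3312]), ([2213,2332,3232,2212,
    3222,2322],[2223,2322,3222,3311]), ([1232,2322,2221,3223,3222,2233],[2232,2322,3231,3232]),
    ([2223,2232,2322,3222],[2223,2232,2322,3222]), ([2223,2232,2322,3222],[2223,2232,2322,3222]),
    ([2233,2322,3223,2221,3222,2232],[2232,2322,3222,3231]), ([2233,2322,3223,2221,3222,2232],[2232,
    2322,3222,3231]), ([2223,2132,2322,3222],[2223,2232,2332,3222]), ([2233,2322,3223,2221,3222,
    2232],[2232,2322,3222,3231]), ([2223,2232,2322,3222],[2223,2232,2322,3222]), ([2223,1232,2132,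
    3312,2322,3222],[2223,2332,3232,3332]), ([2223,2232,3132,2312,2322,3222],[2223,2332,3222,3322]),
    ([2223,2232,3132,2312,2322,3222],[2223,2332,3222,3322]), ([2223,2132,2322,3222],[2223,2232,2332,
    3222]), ([2233,2323,2221,3222,2322,2232],[2232,2322,2331,3222]), ([2223,2232,2322,3222],[2223,
    2232,2322,3222]), ([2232,1313,2213,3231,2322,3222,2223],[2233,2322,3223,3322]), ([2233,2322,
    3223,2221,3222,2232],[2232,2322,3222,3231]), ([2233,2323,2221,3222,2322,2232],[2232,2322,2331,
    3222]), ([2223,2232,2322,3222],[2223,2232,2322,3222]), ([2223,2232,2322,3222],[2223,2232,2322,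
    3222]), ([2223,2332,3232,2212,2322,3222],[2223,2322,3222,3312]), ([2223,2332,3232,2212,2322,
    3222],[2223,2322,3222,3312]), ([2213,2332,3232,2212,2322,3222],[2223,2322,3222,3311]), ([2223,
    2232,2322,3222],[2223,2232,2322,3222]), ([2233,2323,3223,2221,2232,2322,3222],[2232,2322,3222,
    3331]), ([2223,3232,2212,2211,2322,1323,3222,3221,2332,2333],[2322,3313,3322]), ([2332,3232,
    2221,2213,2322,3222,2323],[2322,3222,3311,3312]), ([2223,2232,3132,2312,2322,3222],[2223,2332,
    3222,3322]), ([2223,2332,3232,2212,2322,3222],[2223,2322,3222,3312]), ([2213,2332,3232,2212,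
    2322,3222],[2223,2322,3222,3311]), ([2203,2332,3232,2212,2322,3222],[2223,2322,3222,3310]),
    ([22233,22323,22221,23222,32222,22232,22322],[22232,22322,22331,23222,32222]), ([22232,22322,
    23222,32222,12221,21221,22121,22211,33223,32323,32233,23323,23233,22333],[23331,32331,34330]),
    ([23222,22322,32222,23122,22232,31322,32221,22223,13223,22323,22233],[23322,33223,33322]),
    ([22223,22232,22322,31322,23122,23222,32222],[22223,22232,23322,32222,33222]), ([22223,22232,
    22322,31322,23122,23222,32222],[22223,22232,23322,32222,33222]), ([12223,21322,23232,32232,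
    22212,23222,32222],[22223,22322,23322,32223,33313]), ([22223,21322,23232,32232,22212,23222,
    32222],[22223,22322,23322,32222,33312]), ([22333,23232,22212,32223,22221,23222,32222,22322,
    22332,22323],[22322,23222,23312,32222,32321]), ([22223,12322,23232,32232,22212,23222,32222],
    [22223,22322,23222,32322,33312]), ([22213,12322,23232,32232,22212,23222,32222],[22223,22322,
    23222,32322,33311]), ([22223,22232,23322,32322,22122,23222,32222],[22223,22232,23222,32222,
    33122]), ([22223,22232,23322,32322,22122,23222,32222],[22223,22232,23222,32222,33122]), ([22122,
    23222,32222,32322,23322,22133,12221,21221,22321,22232,33223],[23231,33130,33231]), ([22223,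
    22232,23322,32322,22122,23222,32222],[22223,22232,23222,32222,33122]), ([22223,22132,23322,
    32322,22122,23222,32222],[22223,22232,23222,32222,33112]), ([22123,22232,23322,32322,22122,
    23222,32222],[22223,22232,23222,32222,33121]), ([22123,22132,23322,32322,22122,23222,32222],
    [22223,22232,23222,32222,33111]), ([22322,23222,12232,32222,21232,33212,22221,32223,23223,22323,
    22233],[23232,33232,33341]), ([22223,22322,23232,32232,22212,23222,32222],[22223,22322,23222,
    32222,33212]), ([22223,22332,23232,22212,32222,22322,23222],[22223,22322,23222,23312,32222]),
    ([21223,22332,23232,22212,32222,22322,23222],[22223,22322,23223,23313,32222]), ([22213,22332,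
    23232,22212,32222,22322,23222],[22223,22322,23222,23311,32222]), ([23222,12322,22232,32222,
    22322,21232,33222,32132,23312,22223],[22332,23332,32332]), ([23222,12322,22232,32222,22322,
    21232,33222,32132,23312,22223],[22332,23332,32332]), ([23222,12322,22232,32222,22322,21232,
    33222,32132,23312,22223],[22332,23332,32332]), ([32222,22312,23221,23222,22223,12322,12232,
    23132,11323,22233,22322,22232,21323,21233,33222,32223,33132,32133],[22332,23323,23332,32332]),
    ([23222,12322,22232,32222,22322,21232,33222,32132,23312,22223],[22332,23332,32332]), ([222332,
    223232,222212,232223,322223,222221,222322,223222,232222,322222],[222322,223222,223312,232222,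
    322222,332221]), ([222223,222232,232222,123222,222322,322222,223222,212322,332222,321322,
    233122],[223322,233322,323322]), ([222223,222232,222322,223222,332222,232222,123222,122322,
    233212,232312,123312,233221,232321,123321,322222,212232,212223,321232,321223,211233,322132,
    322123,212133,321133,233311],[223333,232333,324333]), ([222232,232222,123222,222322,322222,
    223222,212322,222223,332222,321322,233122],[223322,233322,323322]), ([232222,123222,222232,
    222322,322222,223222,212232,222223,332222,321232,233212],[223232,233232,323232]), ([232222,
    123222,222322,322222,223222,212322,222132,222223,332222,321322,233122],[223332,233332,323332]),
    ([232222,123222,222322,322222,223222,212322,212232,222223,332222,321322,233122],[223322,233332,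
    323322]), ([232222,123222,222322,322222,223222,212322,222223,222232,332222,321322,233122],
    [223322,233322,323322]), ([232222,123222,222322,322222,223222,212322,222223,222232,332222,
    321322,233122],[223322,233322,323322]), ([232222,123222,222322,322222,223222,212322,222232,
    222223,332222,321322,233122],[223322,233322,323322]), ([2222221,2222232,2222322,2322222,1232222,
    2223222,3222222,2232222,2123222,3322222,3213222,2331222,2222323,2222233],[2233222,2333222,
    3233222]), ([22232222,12223222,22222223,22322222,21222322,22222232,23222222,22222322,22122232,
    32222222,22223222,22212223,32232222,32221223,23322222,23222132,22322312,22233221],[22222332,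
    22322332,23222332])]

/-- The vector with `h` entries whose entries, increased by two, are the decimal digits of `n`. -/
def digitVec (h n : ℕ) : List ℤ :=
  (upTo h).map fun i => ((n / 10 ^ (h - 1 - i) % 10 : ℕ) : ℤ) - 2

/-- The relations of the space number `n`. -/
def relations (n : ℕ) : List (List ℤ) :=
  (relationData.getD (n - 1) ([], [])).1.map (digitVec (space n).h)

/-- The nef classes given for the space number `n`. -/
def nefClasses (n : ℕ) : List (List ℤ) :=
  (relationData.getD (n - 1) ([], [])).2.map (digitVec (space n).h)

/-- The numbers of the spaces that are not simple. -/
def nonsimpleNumbers : List ℕ :=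
  [44, 49, 80, 87, 88, 98, 103, 108, 109, 110, 111, 112, 114, 115, 116, 117, 118, 119, 120, 121, 122, 123, 124]

end ToricMonad

namespace ToricMonad

/-! ### The basic list functions -/

section Primitives

variable {α β : Type}

@[simp] theorem lmap_eq (f : α → β) (l : List α) : lmap f l = l.map f := by
  induction l with
  | nil => rfl
  | cons a l ih => exact congrArg (f a :: ·) ih

@[simp] theorem lall_iff (f : α → Bool) (l : List α) : lall f l = true ↔ ∀ a ∈ l, f a = true := by
  induction l with
  | nil => simp [lall]
  | cons a l ih =>
    have : lall f (a :: l) = Bool.rec false (lall f l) (f a) := rfl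
    rw [this]
    cases h : f a <;> simp [h, ih]

@[simp] theorem lany_iff (f : α → Bool) (l : List α) : lany f l = true ↔ ∃ a ∈ l, f a = true := by
  induction l with
  | nil => simp [lany]
  | cons a l ih =>
    have : lany f (a :: l) = Bool.rec (lany f l) true (f a) := rfl
    rw [this]
    cases h : f a <;> simp [h, ih]

@[simp] theorem lfilter_eq (f : α → Bool) (l : List α) : lfilter f l = l.filter f := by
  induction l with
  | nil => rfl
  | cons a l ih =>
    have : lfilter f (a :: l) = Bool.rec (lfilter f l) (a :: lfilter f l) (f a) := rfl
    rw [this, ih]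
    cases h : f a <;> simp [h]

@[simp] theorem lappend_eq (l k : List α) : lappend l k = l ++ k := by
  induction l with
  | nil => rfl
  | cons a l ih => exact congrArg (a :: ·) ih

@[simp] theorem lget_eq (d : α) (l : List α) (i : ℕ) : lget d l i = l.getD i d := by
  induction l generalizing i with
  | nil => rfl
  | cons a l ih => cases i with
    | zero => rfl
    | succ i => exact ih i

theorem withIndex_eq (l : List α) (k : ℕ) : withIndex l k = l.zipIdx k := by
  induction l generalizing k with
  | nil => rfl
  | cons a l ih => exact congrArg ((a, k) :: ·) (ih (k + 1))

@[simp] theorem lsum_eq (l : List ℤ) : lsum l = l.sum := by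
  induction l with
  | nil => rfl
  | cons a l ih => exact congrArg (a + ·) ih

@[simp] theorem dot_nil (y : List ℤ) : dot [] y = 0 := rfl

@[simp] theorem dot_cons_nil (a : ℤ) (x : List ℤ) : dot (a :: x) [] = 0 := rfl

@[simp] theorem dot_cons_cons (a b : ℤ) (x y : List ℤ) : dot (a :: x) (b :: y) = a * b + dot x y :=
  rfl

theorem dot_eq_sum {n : ℕ} (x y : List ℤ) (h : y.length ≤ n) :
    dot x y = ∑ i : Fin n, x.getD i 0 * y.getD i 0 := by
  induction n generalizing x y with
  | zero => obtain rfl : y = [] := List.length_eq_zero_iff.mp (by omega); cases x <;> simp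
  | succ n ih =>
    cases x with
    | nil => simp
    | cons a x => cases y with
      | nil => simp
      | cons b y =>
        rw [Fin.sum_univ_succ, dot_cons_cons, ih x y (by simpa using h)]
        simp

@[simp] theorem nonnegB_iff (a : ℤ) : nonnegB a = true ↔ 0 ≤ a := by
  cases a with
  | ofNat n => simp [nonnegB]
  | negSucc n => simp [nonnegB]

@[simp] theorem posB_iff (a : ℤ) : posB a = true ↔ 0 < a := by
  cases a with
  | ofNat n => simp [posB, Nat.blt, Nat.succ_le_iff]
  | negSucc n => simp [posB]

@[simp] theorem zeroB_iff (a : ℤ) : zeroB a = true ↔ a = 0 := by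
  cases a with
  | ofNat n => simp [zeroB]
  | negSucc n => simp [zeroB]

@[simp] theorem eqB_iff (a b : ℤ) : eqB a b = true ↔ a = b := by
  rw [eqB, zeroB_iff]
  exact sub_eq_zero

theorem upFrom_eq (n k : ℕ) : upFrom n k = List.range' k n := by
  induction n generalizing k with
  | zero => rfl
  | succ n ih => exact congrArg (k :: ·) (ih (k + 1))

@[simp] theorem upTo_eq (n : ℕ) : upTo n = List.range n := by
  rw [upTo, upFrom_eq, List.range_eq_range']

theorem testBit_mask (l : List ℕ) (i : ℕ) : (mask l).testBit i = decide (i ∈ l) := by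
  induction l with
  | nil => simp [mask]
  | cons a l ih =>
    have : mask (a :: l) = (1 <<< a) ||| mask l := rfl
    rw [this, Nat.testBit_or, ih, Nat.one_shiftLeft, Nat.testBit_two_pow]
    simp [eq_comm]

theorem subB_mask (P S : List ℕ) : subB (mask P) (mask S) = true ↔ P ⊆ S := by
  have : subB (mask P) (mask S) = Nat.beq (mask P &&& mask S) (mask P) := rfl
  rw [this, Nat.beq_eq]
  constructor
  · intro h i hi
    have := congrArg (fun m => Nat.testBit m i) h
    simpa [testBit_mask, hi] using this
  · intro h
    apply Nat.eq_of_testBit_eq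
    intro i
    have := @h i
    simp only [Nat.testBit_and, testBit_mask]
    by_cases hP : i ∈ P <;> simp_all

@[simp] theorem unitVec_eq (n i : ℕ) :
    unitVec n i = (List.range n).map fun j => if j = i then 1 else 0 := by
  rw [unitVec, lmap_eq, upTo_eq]
  refine List.map_congr_left fun j _ => ?_
  by_cases h : j = i
  · have : Nat.beq j i = true := by simpa using h
    rw [this, if_pos h]
  · have : Nat.beq j i = false := by rw [← Bool.not_eq_true, Nat.beq_eq]; exact h
    rw [this, if_neg h]

theorem getD_map_range {f : ℕ → α} {n i : ℕ} (d : α) (h : i < n) :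
    ((List.range n).map f).getD i d = f i := by
  simp [List.getD, h]

theorem getD_map_of_lt {f : α → β} {l : List α} {i : ℕ} (d : β) (d' : α) (h : i < l.length) :
    (l.map f).getD i d = f (l.getD i d') := by
  simp [List.getD, h]

end Primitives

/-! ### Enumeration of the sets of rays that contain no nonface. -/

theorem faces_zero (Ps l : List ℕ) : faces Ps 0 l = [[]] := rfl

theorem faces_succ_nil (Ps : List ℕ) (k : ℕ) : faces Ps (k + 1) [] = [] := rfl

theorem faces_succ_cons (Ps : List ℕ) (k a : ℕ) (l : List ℕ) :
    faces Ps (k + 1) (a :: l) = (((faces Ps k l).map (a :: ·)).filter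
      fun S => lall (fun P => not (subB P (mask S))) Ps) ++ faces Ps (k + 1) l := by
  rw [← lfilter_eq, ← lmap_eq, ← lappend_eq]
  rfl

/-- Pruning partial sets loses nothing, because a subset of a set without nonfaces contains no
nonface either. -/
theorem mem_faces (Ps : List (List ℕ)) {k : ℕ} {l S : List ℕ} (hS : S.Sublist l)
    (hk : S.length = k) (hP : ∀ P ∈ Ps, ¬ P ⊆ S) : S ∈ faces (Ps.map mask) k l := by
  induction l generalizing k S with
  | nil =>
    obtain rfl := List.eq_nil_of_sublist_nil hS
    subst hk
    simp [faces_zero]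
  | cons a l ih =>
    cases k with
    | zero => simp [faces_zero, List.length_eq_zero_iff.mp hk]
    | succ k =>
      rw [faces_succ_cons, List.mem_append]
      cases hS with
      | cons _ h => exact Or.inr (ih h hk hP)
      | cons_cons _ h =>
        rename_i S'
        refine Or.inl (List.mem_filter.mpr ⟨List.mem_map.mpr ⟨S', ih h (by simpa using hk)
          fun P hPm hsub => hP P hPm fun i hi => List.mem_cons_of_mem _ (hsub hi), rfl⟩, ?_⟩)
        simp only [lall_iff, List.mem_map]
        rintro _ ⟨P, hPm, rfl⟩
        have : ¬ subB (mask P) (mask (a :: S')) = true := fun h' => hP P hPm ((subB_mask _ _).mp h')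
        simpa using this

/-- The case `k = 0` is excluded from the last claim because the empty set is produced without being
tested. -/
theorem faces_spec (Ps : List (List ℕ)) {k : ℕ} {l S : List ℕ}
    (hS : S ∈ faces (Ps.map mask) k l) : S.Sublist l ∧ S.length = k ∧
      (k ≠ 0 → ∀ P ∈ Ps, ¬ P ⊆ S) := by
  induction l generalizing k S with
  | nil => cases k <;> simp_all [faces_zero, faces_succ_nil]
  | cons a l ih =>
    cases k with
    | zero => simp_all [faces_zero]
    | succ k =>
      rw [faces_succ_cons, List.mem_append, List.mem_filter, List.mem_map] at hS
      rcases hS with ⟨⟨S', hS', rfl⟩, h⟩ | h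
      · obtain ⟨h1, h2, -⟩ := ih hS'
        refine ⟨h1.cons_cons a, by simp [h2], fun _ P hP hsub => ?_⟩
        simp only [lall_iff, List.mem_map] at h
        have := h _ ⟨P, hP, rfl⟩
        rw [(subB_mask _ _).mpr hsub] at this
        simp at this
      · obtain ⟨h1, h2, h3⟩ := ih h
        exact ⟨h1.cons a, h2, h3⟩

end ToricMonad

/-! ### Nef and Kähler classes through support functions; the maximal cones of the fan. -/

namespace ToricMonad

namespace ToricSpace

variable (A : ToricSpace)

/-! ### Linear relations and support functions -/

@[simp] theorem vertex_castAdd (i : Fin 4) : A.vertex (Fin.castAdd A.h i) = Pi.single i 1 := by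
  simp [vertex]

@[simp] theorem vertex_natAdd (r : Fin A.h) : A.vertex (Fin.natAdd 4 r) = A.extra r := by
  simp [vertex]

@[simp] theorem divisor_castAdd (i : Fin 4) :
    A.divisor (Fin.castAdd A.h i) = fun r => - A.extra r i := by
  simp [divisor]

@[simp] theorem divisor_natAdd (r : Fin A.h) : A.divisor (Fin.natAdd 4 r) = Pi.single r 1 := by
  simp [divisor]

theorem sum_divisor_vertex (r : Fin A.h) (i : Fin 4) :
    ∑ ρ, A.divisor ρ r * A.vertex ρ i = 0 := by
  rw [Fin.sum_univ_add]
  simp [Pi.single_apply]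

/-- The values of the linear functional `l` on the toric divisors. -/
def relation (l : A.Pic) (ρ : A.Ray) : ℤ := ∑ r, l r * A.divisor ρ r

theorem sum_relation_vertex (l : A.Pic) (i : Fin 4) : ∑ ρ, A.relation l ρ * A.vertex ρ i = 0 := by
  simp_rw [relation, Finset.sum_mul, mul_assoc]
  rw [Finset.sum_comm]
  simp_rw [← Finset.mul_sum, A.sum_divisor_vertex, mul_zero, Finset.sum_const_zero]

theorem sum_relation_pairing (l : A.Pic) (m : Fin 4 → ℝ) :
    ∑ ρ, (A.relation l ρ : ℝ) * A.pairing m ρ = 0 := by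
  have h : ∀ i, ∑ ρ, (A.relation l ρ : ℝ) * (A.vertex ρ i : ℝ) = 0 := fun i => by
    exact_mod_cast A.sum_relation_vertex l i
  simp_rw [pairing, Finset.mul_sum]
  rw [Finset.sum_comm]
  refine Finset.sum_eq_zero fun i _ => ?_
  rw [← mul_zero (m i), ← h i, Finset.mul_sum]
  exact Finset.sum_congr rfl fun ρ _ => by ring

theorem sum_relation_class (l : A.Pic) {a : A.Ray → ℝ} {L : Fin A.h → ℝ}
    (ha : ∀ r, ∑ ρ, a ρ * (A.divisor ρ r : ℝ) = L r) :
    ∑ ρ, (A.relation l ρ : ℝ) * a ρ = ∑ r, (l r : ℝ) * L r := by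
  simp_rw [← ha, relation, Finset.mul_sum]
  rw [Finset.sum_comm]
  refine Finset.sum_congr rfl fun ρ _ => ?_
  push_cast
  rw [Finset.sum_mul]
  exact Finset.sum_congr rfl fun r _ => by ring

/-- The divisor without contributions of the first four rays in a given class. -/
def lift {R : Type*} [Zero R] (L : Fin A.h → R) : A.Ray → R := Fin.append (fun _ => 0) L

@[simp] theorem lift_castAdd {R : Type*} [Zero R] (L : Fin A.h → R) (i : Fin 4) :
    A.lift L (Fin.castAdd A.h i) = 0 := by simp [lift]

@[simp] theorem lift_natAdd {R : Type*} [Zero R] (L : Fin A.h → R) (r : Fin A.h) :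
    A.lift L (Fin.natAdd 4 r) = L r := by simp [lift]

theorem sum_lift_divisor (L : Fin A.h → ℝ) (r : Fin A.h) :
    ∑ ρ, A.lift L ρ * (A.divisor ρ r : ℝ) = L r := by
  rw [Fin.sum_univ_add]
  simp [Pi.single_apply]

/-- Representatives of the same class differ by a linear function. Its coefficients can be read off
on the first four rays, which are the standard basis and on which the lift vanishes. -/
theorem sub_lift_eq_pairing {a : A.Ray → ℝ} {L : Fin A.h → ℝ}
    (ha : ∀ r, ∑ ρ, a ρ * (A.divisor ρ r : ℝ) = L r) :
    ∃ m : Fin 4 → ℝ, ∀ ρ, a ρ - A.lift L ρ = A.pairing m ρ := by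
  refine ⟨fun i => a (Fin.castAdd A.h i), fun ρ => ?_⟩
  induction ρ using Fin.addCases with
  | left i => simp [pairing, Pi.single_apply]
  | right r =>
    rw [lift_natAdd, ← ha r, Fin.sum_univ_add]
    simp [pairing, Pi.single_apply]

theorem pairing_add (m m' : Fin 4 → ℝ) (ρ : A.Ray) :
    A.pairing (m + m') ρ = A.pairing m ρ + A.pairing m' ρ := by
  simp [pairing, add_mul, Finset.sum_add_distrib]

theorem pairing_smul (t : ℝ) (m : Fin 4 → ℝ) (ρ : A.Ray) :
    A.pairing (t • m) ρ = t * A.pairing m ρ := by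
  simp [pairing, Finset.mul_sum, mul_assoc]

/-- Adding a linear function to the local functions `m_σ` compensates a change of representative, so
the existential over divisors can be replaced by one normalized representative. -/
theorem isNef_iff (L : Fin A.h → ℝ) : A.IsNef L ↔ ∀ S, A.IsMaxCone S → ∃ m : Fin 4 → ℝ,
    (∀ ρ ∈ S, A.pairing m ρ = - A.lift L ρ) ∧ ∀ ρ ∉ S, - A.lift L ρ ≤ A.pairing m ρ := by
  constructor
  · rintro ⟨a, ha, h⟩ S hS
    obtain ⟨m, h1, h2⟩ := h S hS
    obtain ⟨m', hm'⟩ := A.sub_lift_eq_pairing ha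
    refine ⟨m + m', fun ρ hρ => ?_, fun ρ hρ => ?_⟩
    · rw [pairing_add, h1 ρ hρ, ← hm' ρ]; ring
    · rw [pairing_add, ← hm' ρ]; linarith [h2 ρ hρ]
  · exact fun h => ⟨A.lift L, A.sum_lift_divisor L, h⟩

theorem isKahler_iff (L : Fin A.h → ℝ) : A.IsKahler L ↔ ∀ S, A.IsMaxCone S → ∃ m : Fin 4 → ℝ,
    (∀ ρ ∈ S, A.pairing m ρ = - A.lift L ρ) ∧ ∀ ρ ∉ S, - A.lift L ρ < A.pairing m ρ := by
  constructor
  · rintro ⟨a, ha, h⟩ S hS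
    obtain ⟨m, h1, h2⟩ := h S hS
    obtain ⟨m', hm'⟩ := A.sub_lift_eq_pairing ha
    refine ⟨m + m', fun ρ hρ => ?_, fun ρ hρ => ?_⟩
    · rw [pairing_add, h1 ρ hρ, ← hm' ρ]; ring
    · rw [pairing_add, ← hm' ρ]; linarith [h2 ρ hρ]
  · exact fun h => ⟨A.lift L, A.sum_lift_divisor L, h⟩

variable {A}

theorem lift_add (L L' : Fin A.h → ℝ) (ρ : A.Ray) :
    A.lift (L + L') ρ = A.lift L ρ + A.lift L' ρ := by
  induction ρ using Fin.addCases <;> simp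

theorem lift_smul (t : ℝ) (L : Fin A.h → ℝ) (ρ : A.Ray) :
    A.lift (t • L) ρ = t * A.lift L ρ := by
  induction ρ using Fin.addCases <;> simp

theorem IsNef.add {L L' : Fin A.h → ℝ} (h : A.IsNef L) (h' : A.IsNef L') : A.IsNef (L + L') := by
  rw [isNef_iff] at *
  intro S hS
  obtain ⟨m, h1, h2⟩ := h S hS
  obtain ⟨m', h1', h2'⟩ := h' S hS
  refine ⟨m + m', fun ρ hρ => ?_, fun ρ hρ => ?_⟩
  · rw [pairing_add, h1 ρ hρ, h1' ρ hρ, lift_add]; ring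
  · rw [pairing_add, lift_add]; linarith [h2 ρ hρ, h2' ρ hρ]

theorem IsKahler.add_isNef {L L' : Fin A.h → ℝ} (h : A.IsKahler L) (h' : A.IsNef L') :
    A.IsKahler (L + L') := by
  rw [isNef_iff] at *
  rw [isKahler_iff] at *
  intro S hS
  obtain ⟨m, h1, h2⟩ := h S hS
  obtain ⟨m', h1', h2'⟩ := h' S hS
  refine ⟨m + m', fun ρ hρ => ?_, fun ρ hρ => ?_⟩
  · rw [pairing_add, h1 ρ hρ, h1' ρ hρ, lift_add]; ring
  · rw [pairing_add, lift_add]; linarith [h2 ρ hρ, h2' ρ hρ]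

theorem IsNef.smul {L : Fin A.h → ℝ} (h : A.IsNef L) {t : ℝ} (ht : 0 ≤ t) : A.IsNef (t • L) := by
  rw [isNef_iff] at *
  intro S hS
  obtain ⟨m, h1, h2⟩ := h S hS
  refine ⟨t • m, fun ρ hρ => ?_, fun ρ hρ => ?_⟩
  · rw [pairing_smul, h1 ρ hρ, lift_smul]; ring
  · rw [pairing_smul, lift_smul]; nlinarith [h2 ρ hρ]

theorem IsKahler.smul {L : Fin A.h → ℝ} (h : A.IsKahler L) {t : ℝ} (ht : 0 < t) :
    A.IsKahler (t • L) := by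
  rw [isKahler_iff] at *
  intro S hS
  obtain ⟨m, h1, h2⟩ := h S hS
  refine ⟨t • m, fun ρ hρ => ?_, fun ρ hρ => ?_⟩
  · rw [pairing_smul, h1 ρ hρ, lift_smul]; ring
  · rw [pairing_smul, lift_smul]; nlinarith [h2 ρ hρ]

theorem isNef_zero : A.IsNef 0 := by
  rw [isNef_iff]
  refine fun S _ => ⟨0, fun ρ _ => ?_, fun ρ _ => ?_⟩ <;>
  · have : A.lift (0 : Fin A.h → ℝ) ρ = 0 := by induction ρ using Fin.addCases <;> simp
    simp [pairing, this]

theorem IsNef.sum {ι : Type*} (s : Finset ι) {L : ι → Fin A.h → ℝ}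
    (h : ∀ i ∈ s, A.IsNef (L i)) : A.IsNef (∑ i ∈ s, L i) := by
  classical
  induction s using Finset.induction_on with
  | empty => simpa using isNef_zero
  | insert i s hi ih =>
    rw [Finset.sum_insert hi]
    exact (h i (by simp)).add (ih fun j hj => h j (by simp [hj]))

/-- A relation with nonnegative coefficients outside a maximal cone is nonnegative on nef classes. -/
theorem IsNef.relation_nonneg {L : Fin A.h → ℝ} (h : A.IsNef L) (l : A.Pic) {S : Finset A.Ray}
    (hS : A.IsMaxCone S) (hl : ∀ ρ ∉ S, 0 ≤ A.relation l ρ) : 0 ≤ ∑ r, (l r : ℝ) * L r := by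
  obtain ⟨m, h1, h2⟩ := (A.isNef_iff L).mp h S hS
  have e : ∑ r, (l r : ℝ) * L r = ∑ ρ, (A.relation l ρ : ℝ) * (A.lift L ρ + A.pairing m ρ) := by
    simp_rw [mul_add, Finset.sum_add_distrib]
    rw [A.sum_relation_pairing, add_zero, A.sum_relation_class l (A.sum_lift_divisor L)]
  rw [e]
  refine Finset.sum_nonneg fun ρ _ => ?_
  by_cases hρ : ρ ∈ S
  · rw [h1 ρ hρ]; simp
  · exact mul_nonneg (by exact_mod_cast hl ρ hρ) (by linarith [h2 ρ hρ])

theorem IsKahler.relation_pos {L : Fin A.h → ℝ} (h : A.IsKahler L) (l : A.Pic) {S : Finset A.Ray}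
    (hS : A.IsMaxCone S) (hl : ∀ ρ ∉ S, 0 ≤ A.relation l ρ) {σ : A.Ray} (hσ : σ ∉ S)
    (hlσ : 0 < A.relation l σ) : 0 < ∑ r, (l r : ℝ) * L r := by
  obtain ⟨m, h1, h2⟩ := (A.isKahler_iff L).mp h S hS
  have e : ∑ r, (l r : ℝ) * L r = ∑ ρ, (A.relation l ρ : ℝ) * (A.lift L ρ + A.pairing m ρ) := by
    simp_rw [mul_add, Finset.sum_add_distrib]
    rw [A.sum_relation_pairing, add_zero, A.sum_relation_class l (A.sum_lift_divisor L)]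
  rw [e]
  refine Finset.sum_pos' (fun ρ _ => ?_) ⟨σ, Finset.mem_univ _, ?_⟩
  · by_cases hρ : ρ ∈ S
    · rw [h1 ρ hρ]; simp
    · exact mul_nonneg (by exact_mod_cast hl ρ hρ) (by linarith [h2 ρ hρ])
  · exact mul_pos (by exact_mod_cast hlσ) (by linarith [h2 σ hσ])

/-- The rays with positive coefficient in a relation of positive total degree do not lie in a common
cone. -/
theorem IsCone.not_posSupport_subset {S : Finset A.Ray} (hS : A.IsCone S) (l : A.Pic)
    (hl : 0 < ∑ ρ, A.relation l ρ) : ∃ ρ, 0 < A.relation l ρ ∧ ρ ∉ S := by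
  by_contra hcon
  push Not at hcon
  obtain ⟨m, h1, h2⟩ := hS
  -- Termwise: a positive coefficient meets a ray of the cone, where the pairing is `-1`; elsewhere
  -- the coefficient is nonpositive and the pairing at least `-1`.
  have h3 : ∑ ρ, (A.relation l ρ : ℝ) * A.pairing m ρ ≤ ∑ ρ, - (A.relation l ρ : ℝ) := by
    refine Finset.sum_le_sum fun ρ _ => ?_
    rcases lt_or_ge 0 (A.relation l ρ) with h | h
    · rw [(h2 ρ).mp (hcon ρ h)]; simp
    · have : (A.relation l ρ : ℝ) ≤ 0 := by exact_mod_cast h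
      nlinarith [h1 ρ]
  rw [A.sum_relation_pairing, Finset.sum_neg_distrib] at h3
  have : (0 : ℝ) < ∑ ρ, (A.relation l ρ : ℝ) := by exact_mod_cast hl
  linarith

/-! ### Maximal cones -/

variable (A) in
/-- A maximal cone with the basis of `M` dual to its generators. -/
structure Facet where
  S : Fin 4 → A.Ray
  u : Fin 4 → Fin 4 → ℤ
  dual : ∀ k j, ∑ i, u k i * A.vertex (S j) i = if j = k then 1 else 0
  lt_one : ∀ ρ, (∀ j, ρ ≠ S j) → ∑ k, ∑ i, u k i * A.vertex ρ i < 1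

namespace Facet

variable (F : A.Facet)

/-- The values of the dual basis. -/
def w (k : Fin 4) (ρ : A.Ray) : ℤ := ∑ i, F.u k i * A.vertex ρ i

theorem w_S (k j : Fin 4) : F.w k (F.S j) = if j = k then 1 else 0 := F.dual k j

theorem injective : Function.Injective F.S := by
  intro j j' h
  have h1 := F.w_S j j
  have h2 := F.w_S j j'
  rw [h, h2] at h1
  by_contra hne
  rw [if_neg fun h => hne h.symm] at h1
  simp at h1

def rays : Finset A.Ray := Finset.univ.image F.S

theorem mem_rays {ρ : A.Ray} : ρ ∈ F.rays ↔ ∃ j, F.S j = ρ := by simp [rays]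

theorem card_rays : F.rays.card = 4 := by
  rw [rays, Finset.card_image_of_injective _ F.injective]; simp

/-- The linear function with values `- b k` on the generators. -/
noncomputable def linear (b : Fin 4 → ℤ) : Fin 4 → ℝ := fun i => - ∑ k, (b k : ℝ) * F.u k i

theorem pairing_linear (b : Fin 4 → ℤ) (ρ : A.Ray) :
    A.pairing (F.linear b) ρ = - ((∑ k, b k * F.w k ρ : ℤ) : ℝ) := by
  simp only [pairing, linear, w, neg_mul, Finset.sum_neg_distrib, Finset.sum_mul]
  rw [Finset.sum_comm]
  push_cast
  simp_rw [Finset.mul_sum, mul_assoc]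

theorem pairing_linear_S (b : Fin 4 → ℤ) (j : Fin 4) : A.pairing (F.linear b) (F.S j) = - b j := by
  rw [pairing_linear]
  simp [w_S]

/-- The supporting point of the facet is minus the sum of the dual basis. -/
theorem isMaxCone : A.IsMaxCone F.rays := by
  refine ⟨⟨F.linear 1, fun ρ => ?_, fun ρ => ?_⟩, F.card_rays⟩
  · by_cases h : ∃ j, F.S j = ρ
    · obtain ⟨j, rfl⟩ := h
      rw [pairing_linear_S]; simp
    · push Not at h
      have := F.lt_one ρ fun j hj => h j hj.symm
      rw [pairing_linear, neg_le_neg_iff]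
      simp only [Pi.one_apply, one_mul, w]
      exact_mod_cast this.le
  · rw [mem_rays]
    constructor
    · rintro ⟨j, rfl⟩
      rw [pairing_linear_S]; simp
    · intro h
      by_contra hcon
      push Not at hcon
      have := F.lt_one ρ fun j hj => hcon j hj.symm
      rw [pairing_linear, neg_inj] at h
      simp only [Pi.one_apply, one_mul, w] at h
      have h' : ∑ k, ∑ i, F.u k i * A.vertex ρ i = 1 := by exact_mod_cast h
      omega

/-- The coefficients of the divisor without contributions of the rays of the cone in a class. -/
def coeff (L : A.Pic) (ρ : A.Ray) : ℤ := A.lift L ρ - ∑ k, A.lift L (F.S k) * F.w k ρ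

theorem lift_toReal (L : A.Pic) (ρ : A.Ray) : A.lift (A.toReal L) ρ = ((A.lift L ρ : ℤ) : ℝ) := by
  induction ρ using Fin.addCases <;> simp [toReal]

theorem linear_lift_spec (L : A.Pic) :
    (∀ ρ ∈ F.rays, A.pairing (F.linear fun k => A.lift L (F.S k)) ρ = - A.lift (A.toReal L) ρ) ∧
    ∀ ρ, A.pairing (F.linear fun k => A.lift L (F.S k)) ρ + A.lift (A.toReal L) ρ =
      (F.coeff L ρ : ℝ) := by
  refine ⟨fun ρ hρ => ?_, fun ρ => ?_⟩
  · obtain ⟨j, rfl⟩ := F.mem_rays.mp hρ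
    rw [pairing_linear_S, lift_toReal]
  · rw [pairing_linear, lift_toReal, coeff]
    push_cast
    ring

theorem sum_w_divisor (k : Fin 4) : ∑ ρ, F.w k ρ • A.divisor ρ = 0 := by
  ext r
  simp only [w, Finset.sum_apply, Pi.smul_apply, smul_eq_mul, Finset.sum_mul, Pi.zero_apply]
  rw [Finset.sum_comm]
  refine Finset.sum_eq_zero fun i _ => ?_
  rw [← mul_zero (F.u k i), ← A.sum_divisor_vertex r i, Finset.mul_sum]
  exact Finset.sum_congr rfl fun ρ _ => by ring

/-- The principal divisor of the character `u k` contains the generator number `k` once and no other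
ray of the cone. This moves a toric divisor off a cone that contains its ray. -/
theorem divisor_eq (k : Fin 4) :
    A.divisor (F.S k) = ∑ ρ ∈ (F.rays)ᶜ, (- F.w k ρ) • A.divisor ρ := by
  have h := F.sum_w_divisor k
  rw [← Finset.sum_compl_add_sum F.rays, rays,
    Finset.sum_image (fun _ _ _ _ h => F.injective h)] at h
  simp only [w_S, ite_smul, one_smul, zero_smul, Finset.sum_ite_eq', Finset.mem_univ, if_true] at h
  rw [← rays] at h
  simp only [neg_smul, Finset.sum_neg_distrib]
  exact eq_neg_of_add_eq_zero_right h

end Facet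

variable (A) in
/-- The maximal cones of the fan, and sets of rays without a common cone. -/
structure Fan where
  facets : Set A.Facet
  nonfaces : Set (Finset A.Ray)
  not_subset : ∀ P ∈ nonfaces, ∀ S, A.IsCone S → ¬ P ⊆ S
  complete : ∀ T : Finset A.Ray, T.card = 4 → (∀ P ∈ nonfaces, ¬ P ⊆ T) → ∃ F ∈ facets, F.rays = T

namespace Fan

variable (Φ : A.Fan)

/-- A maximal cone contains no nonface, hence is among the enumerated sets, all of which are facets.
-/
theorem isMaxCone_iff (S : Finset A.Ray) : A.IsMaxCone S ↔ ∃ F ∈ Φ.facets, F.rays = S := by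
  constructor
  · rintro ⟨hS, hcard⟩
    exact Φ.complete S hcard fun P hP => Φ.not_subset P hP S hS
  · rintro ⟨F, -, rfl⟩
    exact F.isMaxCone

theorem isNef (L : A.Pic) (h : ∀ F ∈ Φ.facets, ∀ ρ ∉ F.rays, 0 ≤ F.coeff L ρ) :
    A.IsNef (A.toReal L) := by
  rw [isNef_iff]
  intro S hS
  obtain ⟨F, hF, rfl⟩ := (Φ.isMaxCone_iff S).mp hS
  obtain ⟨h1, h2⟩ := F.linear_lift_spec L
  refine ⟨_, h1, fun ρ hρ => ?_⟩
  have : (0 : ℝ) ≤ F.coeff L ρ := by exact_mod_cast h F hF ρ hρ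
  linarith [h2 ρ]

theorem isKahler (L : A.Pic) (h : ∀ F ∈ Φ.facets, ∀ ρ ∉ F.rays, 0 < F.coeff L ρ) :
    A.IsKahler (A.toReal L) := by
  rw [isKahler_iff]
  intro S hS
  obtain ⟨F, hF, rfl⟩ := (Φ.isMaxCone_iff S).mp hS
  obtain ⟨h1, h2⟩ := F.linear_lift_spec L
  refine ⟨_, h1, fun ρ hρ => ?_⟩
  have : (0 : ℝ) < F.coeff L ρ := by exact_mod_cast h F hF ρ hρ
  linarith [h2 ρ]

end Fan

end ToricSpace

end ToricMonad

/-! ### Existence and uniqueness of the intersection form of a pure fan. -/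

namespace ToricMonad

namespace ToricSpace

variable {A : ToricSpace}

/-! ### The intersection form -/

theorem Facet.exists_perm (F : A.Facet) {ρ : Fin 4 → A.Ray} (hρ : Function.Injective ρ)
    (h : ∀ i, ρ i ∈ F.rays) : ∃ g : Equiv.Perm (Fin 4), ρ = F.S ∘ g := by
  have h' : ∀ i, ∃ j, F.S j = ρ i := fun i => F.mem_rays.mp (h i)
  choose g hg using h'
  have hinj : Function.Injective g := fun i j hij => hρ (by rw [← hg i, ← hg j, hij])
  exact ⟨Equiv.ofBijective g (Finite.injective_iff_bijective.mp hinj), funext fun i => (hg i).symm⟩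

namespace Fan

variable (Φ : A.Fan)

/-- Every set of at most four rays containing no nonface lies in a maximal cone. -/
def Pure : Prop :=
  ∀ T : Finset A.Ray, T.card ≤ 4 → (∀ P ∈ Φ.nonfaces, ¬ P ⊆ T) → ∃ F ∈ Φ.facets, T ⊆ F.rays

variable {Φ}

theorem exists_facet_of_not_nonface (hΦ : Φ.Pure) (ρ : Fin 4 → A.Ray)
    (h : ∀ P ∈ Φ.nonfaces, ¬ P ⊆ Finset.univ.image ρ) : ∃ F ∈ Φ.facets, ∀ i, ρ i ∈ F.rays := by
  obtain ⟨F, hF, hsub⟩ := hΦ (Finset.univ.image ρ) (Finset.card_image_le.trans (by simp)) h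
  exact ⟨F, hF, fun i => hsub (by simp)⟩

theorem exists_isCone_iff (hΦ : Φ.Pure) (ρ : Fin 4 → A.Ray) :
    (∃ S, A.IsCone S ∧ ∀ i, ρ i ∈ S) ↔ ∃ F ∈ Φ.facets, ∀ i, ρ i ∈ F.rays := by
  constructor
  · rintro ⟨S, hS, hρ⟩
    refine exists_facet_of_not_nonface hΦ ρ fun P hP hsub => Φ.not_subset P hP S hS
      (hsub.trans fun σ hσ => ?_)
    obtain ⟨i, -, rfl⟩ := Finset.mem_image.mp hσ
    exact hρ i
  · rintro ⟨F, -, h⟩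
    exact ⟨F.rays, F.isMaxCone.1, h⟩

/-- Divisibility of a multilinear form follows from that of its values on four distinct divisors with
a common cone and on divisors without a common cone, by linear equivalence of divisors. -/
theorem dvd_of_dvd_divisor (hΦ : Φ.Pure) (φ : MultilinearMap ℤ (fun _ : Fin 4 => A.Pic) ℤ) (g : ℤ)
    (h1 : ∀ F ∈ Φ.facets, ∀ ρ : Fin 4 → A.Ray, Function.Injective ρ → (∀ i, ρ i ∈ F.rays) →
      g ∣ φ (fun i => A.divisor (ρ i)))
    (h2 : ∀ ρ : Fin 4 → A.Ray, (∃ P ∈ Φ.nonfaces, P ⊆ Finset.univ.image ρ) →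
      g ∣ φ (fun i => A.divisor (ρ i))) (x : Fin 4 → A.Pic) : g ∣ φ x := by
  -- Induction on the number of repetitions among the four divisors.
  have key : ∀ n : ℕ, ∀ ρ : Fin 4 → A.Ray, 4 - (Finset.univ.image ρ).card ≤ n →
      g ∣ φ (fun i => A.divisor (ρ i)) := by
    intro n
    induction n with
    | zero =>
      intro ρ hn
      have hcard : (Finset.univ.image ρ).card = (Finset.univ : Finset (Fin 4)).card :=
        le_antisymm Finset.card_image_le (by rw [Finset.card_univ, Fintype.card_fin]; omega)
      have hinj : Function.Injective ρ := by
        simpa [Set.injOn_univ] using Finset.card_image_iff.mp hcard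
      by_cases h : ∃ P ∈ Φ.nonfaces, P ⊆ Finset.univ.image ρ
      · exact h2 ρ h
      · push Not at h
        obtain ⟨F, hF, hρ⟩ := exists_facet_of_not_nonface hΦ ρ h
        exact h1 F hF ρ hinj hρ
    | succ n ih =>
      intro ρ hn
      by_cases h : ∃ P ∈ Φ.nonfaces, P ⊆ Finset.univ.image ρ
      · exact h2 ρ h
      push Not at h
      obtain ⟨F, hF, hρ⟩ := exists_facet_of_not_nonface hΦ ρ h
      by_cases hinj : Function.Injective ρ
      · exact h1 F hF ρ hinj hρ
      simp only [Function.Injective, not_forall] at hinj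
      obtain ⟨i, j, hij, hne⟩ := hinj
      obtain ⟨k, hk⟩ := F.mem_rays.mp (hρ i)
      -- One of two equal factors is replaced by divisors that do not belong to the facet.
      have e : (fun i => A.divisor (ρ i)) =
          Function.update (fun i => A.divisor (ρ i)) i
            (∑ σ ∈ (F.rays)ᶜ, (- F.w k σ) • A.divisor σ) := by
        rw [← F.divisor_eq k, hk, Function.update_eq_self]
      rw [e, φ.map_update_sum]
      refine Finset.dvd_sum fun σ hσ => ?_
      rw [φ.map_update_smul]
      refine Dvd.dvd.mul_left ?_ _
      have e' : Function.update (fun i => A.divisor (ρ i)) i (A.divisor σ) =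
          fun l => A.divisor (Function.update ρ i σ l) := by
        ext1 l
        by_cases hl : l = i
        · subst hl; simp
        · simp [hl]
      rw [e']
      apply ih
      -- The other copy, at the position `j`, keeps the old ray in the image while `σ` is new, so
      -- the number of distinct rays goes up.
      have hins : insert σ (Finset.univ.image ρ) ⊆ Finset.univ.image (Function.update ρ i σ) := by
        intro τ hτ
        rcases Finset.mem_insert.mp hτ with rfl | hτ
        · exact Finset.mem_image.mpr ⟨i, Finset.mem_univ _, by simp⟩
        · obtain ⟨l, -, rfl⟩ := Finset.mem_image.mp hτ
          by_cases hl : l = i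
          · exact Finset.mem_image.mpr ⟨j, Finset.mem_univ _, by
              rw [Function.update_of_ne (Ne.symm hne), hl, hij]⟩
          · exact Finset.mem_image.mpr ⟨l, Finset.mem_univ _, by rw [Function.update_of_ne hl]⟩
      have hnot : σ ∉ Finset.univ.image ρ := by
        intro hmem
        obtain ⟨l, -, rfl⟩ := Finset.mem_image.mp hmem
        exact (Finset.mem_compl.mp hσ) (hρ l)
      have := Finset.card_le_card hins
      rw [Finset.card_insert_of_notMem hnot] at this
      omega
  have e : x = fun i => ∑ r, x i r • A.divisor (Fin.natAdd 4 r) := by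
    ext i s
    simp [Pi.single_apply]
  rw [e, φ.map_sum]
  refine Finset.dvd_sum fun r _ => ?_
  rw [φ.map_smul_univ]
  exact Dvd.dvd.mul_left (key 4 (fun i => Fin.natAdd 4 (r i)) (by omega)) _

/-- The quotient of a multilinear form by a common divisor of its values. -/
def divForm {ι M : Type*} [AddCommGroup M] (φ : MultilinearMap ℤ (fun _ : ι => M) ℤ)
    (W : ℤ) (h : ∀ x, W ∣ φ x) : MultilinearMap ℤ (fun _ : ι => M) ℤ where
  toFun x := φ x / W
  map_update_add' x i a b := by
    rw [φ.map_update_add, Int.add_ediv_of_dvd_left (h _)]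
  map_update_smul' x i c a := by
    rw [φ.map_update_smul, smul_eq_mul, Int.mul_ediv_assoc _ (h _), smul_eq_mul]

variable {W : ℤ} {φ : MultilinearMap ℤ (fun _ : Fin 4 => A.Pic) ℤ}

/-- The difference of two solutions has values divisible by `0` on the generating products, hence
everywhere. -/
theorem isIntersectionForm_unique (hΦ : Φ.Pure) {κ κ' : MultilinearMap ℤ (fun _ : Fin 4 => A.Pic) ℤ}
    (h : A.IsIntersectionForm κ) (h' : A.IsIntersectionForm κ') : κ = κ' := by
  refine MultilinearMap.ext fun x => ?_
  rw [← sub_eq_zero, ← zero_dvd_iff]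
  change 0 ∣ (κ - κ') x
  refine dvd_of_dvd_divisor hΦ (κ - κ') 0 (fun F hF ρ hinj hρ => ?_) (fun ρ hρ => ?_) x
  · have := (exists_isCone_iff hΦ ρ).mpr ⟨F, hF, hρ⟩
    simp [h.2.1 ρ hinj this, h'.2.1 ρ hinj this]
  · have : ¬ ∃ S, A.IsCone S ∧ ∀ i, ρ i ∈ S := by
      rintro ⟨S, hS, hmem⟩
      obtain ⟨P, hP, hsub⟩ := hρ
      refine Φ.not_subset P hP S hS (hsub.trans fun σ hσ => ?_)
      obtain ⟨i, -, rfl⟩ := Finset.mem_image.mp hσ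
      exact hmem i
    simp [h.2.2 ρ this, h'.2.2 ρ this]

/-- A form with the right values up to the factor `W` is divisible by `W` on all classes, by the
moving argument with `g = W`; the quotient is the integral intersection form. -/
theorem exists_isIntersectionForm (hΦ : Φ.Pure) (hW : W ≠ 0)
    (hsymm : ∀ (g : Equiv.Perm (Fin 4)) (x : Fin 4 → A.Pic), φ (x ∘ g) = φ x)
    (hface : ∀ F ∈ Φ.facets, φ (fun i => A.divisor (F.S i)) = W)
    (hnonface : ∀ ρ : Fin 4 → A.Ray, (∃ P ∈ Φ.nonfaces, P ⊆ Finset.univ.image ρ) →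
      φ (fun i => A.divisor (ρ i)) = 0) :
    ∃ κ, A.IsIntersectionForm κ ∧ ∀ x, W * κ x = φ x := by
  have hval : ∀ F ∈ Φ.facets, ∀ ρ : Fin 4 → A.Ray, Function.Injective ρ →
      (∀ i, ρ i ∈ F.rays) → φ (fun i => A.divisor (ρ i)) = W := by
    intro F hF ρ hinj hρ
    obtain ⟨g, rfl⟩ := F.exists_perm hinj hρ
    rw [← hface F hF]
    exact hsymm g fun i => A.divisor (F.S i)
  have hdvd : ∀ x, W ∣ φ x := dvd_of_dvd_divisor hΦ φ W
    (fun F hF ρ hinj hρ => by rw [hval F hF ρ hinj hρ])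
    (fun ρ hρ => by rw [hnonface ρ hρ]; exact dvd_zero W)
  refine ⟨divForm φ W hdvd, ⟨fun g x => ?_, fun ρ hinj hρ => ?_, fun ρ hρ => ?_⟩, fun x => ?_⟩
  · exact congrArg (· / W) (hsymm g x)
  · obtain ⟨F, hF, hmem⟩ := (exists_isCone_iff hΦ ρ).mp hρ
    change φ _ / W = 1
    rw [hval F hF ρ hinj hmem, Int.ediv_self hW]
  · change φ _ / W = 0
    rw [hnonface ρ, Int.zero_ediv]
    by_contra hcon
    push Not at hcon
    exact hρ ((exists_isCone_iff hΦ ρ).mpr (exists_facet_of_not_nonface hΦ ρ hcon))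
  · exact Int.mul_ediv_cancel' (hdvd x)

end Fan

theorem intersectionForm_spec (h : ∃ κ, A.IsIntersectionForm κ) :
    A.IsIntersectionForm A.intersectionForm := by
  rw [intersectionForm, dif_pos h]
  exact h.choose_spec

/-! ### Sums of powers of linear forms -/

/-- The linear form with given coefficients. -/
def linForm (A : ToricSpace) (l : List ℤ) : A.Pic →ₗ[ℤ] ℤ where
  toFun x := ∑ r : Fin A.h, l.getD r 0 * x r
  map_add' x y := by simp [mul_add, Finset.sum_add_distrib]
  map_smul' c x := by simp [Finset.mul_sum, mul_left_comm]

theorem linForm_apply (l : List ℤ) (x : A.Pic) : A.linForm l x = ∑ r : Fin A.h, l.getD r 0 * x r := rfl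

/-- The form `∑ a λ(x₁) λ(x₂) λ(x₃) λ(x₄)`. -/
def powerForm (A : ToricSpace) (f : LocalForms) : MultilinearMap ℤ (fun _ : Fin 4 => A.Pic) ℤ :=
  (f.map fun p => p.1 • (MultilinearMap.mkPiAlgebra ℤ (Fin 4) ℤ).compLinearMap
    fun _ => A.linForm p.2).sum

theorem powerForm_apply (f : LocalForms) (x : Fin 4 → A.Pic) :
    A.powerForm f x = (f.map fun p => p.1 * ∏ i, A.linForm p.2 (x i)).sum := by
  rw [powerForm]
  induction f with
  | nil => simp
  | cons p f ih => simp [ih]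

theorem powerForm_symm (f : LocalForms) (g : Equiv.Perm (Fin 4)) (x : Fin 4 → A.Pic) :
    A.powerForm f (x ∘ g) = A.powerForm f x := by
  simp only [powerForm_apply, Function.comp_apply]
  congr 1
  refine List.map_congr_left fun p _ => ?_
  rw [Equiv.prod_comp g fun i => A.linForm p.2 (x i)]

/-- A list represents a divisor class. -/
def Represents (l : List ℤ) (x : A.Pic) : Prop := l.length = A.h ∧ ∀ r : Fin A.h, l.getD r 0 = x r

theorem Represents.dot_eq {l : List ℤ} {x : A.Pic} (h : Represents l x) (k : List ℤ) :
    dot k l = A.linForm k x := by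
  rw [dot_eq_sum k l h.1.le, linForm_apply]
  exact Finset.sum_congr rfl fun r _ => by rw [h.2 r]

theorem sum_filter_ne_zero (f : LocalForms) (c : List ℤ → ℤ) :
    ((f.filter fun p => !zeroB p.1).map fun p => p.1 * c p.2).sum =
      (f.map fun p => p.1 * c p.2).sum := by
  induction f with
  | nil => rfl
  | cons p f ih =>
    by_cases h : p.1 = 0
    · have : zeroB p.1 = true := (zeroB_iff _).mpr h
      simp [ih, h]
    · have : zeroB p.1 = false := by rw [← Bool.not_eq_true, zeroB_iff]; exact h
      simp [this, ih]

theorem sum_mulForm {l : List ℤ} {x : A.Pic} (h : Represents l x) (f : LocalForms)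
    (c : List ℤ → ℤ) : ((mulForm l f).map fun p => p.1 * c p.2).sum =
      (f.map fun p => p.1 * (A.linForm p.2 x * c p.2)).sum := by
  rw [mulForm, lfilter_eq, sum_filter_ne_zero, lmap_eq, List.map_map]
  congr 1
  refine List.map_congr_left fun p _ => ?_
  simp only [Function.comp_apply]
  rw [h.dot_eq, ← mul_assoc]
  rfl

theorem sum_mulCoord (r : ℕ) (f : LocalForms) (c : List ℤ → ℤ) :
    ((mulCoord r f).map fun p => p.1 * c p.2).sum =
      (f.map fun p => p.1 * (p.2.getD r 0 * c p.2)).sum := by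
  rw [mulCoord, lfilter_eq, sum_filter_ne_zero, lmap_eq, List.map_map]
  congr 1
  refine List.map_congr_left fun p _ => ?_
  simp only [Function.comp_apply]
  rw [lget_eq, ← mul_assoc]
  rfl

theorem coeffSum_eq (f : LocalForms) : coeffSum f = (f.map fun p => p.1 * 1).sum := by
  simp [coeffSum]

theorem sum_mulForms {ls : List (List ℤ)} {xs : List A.Pic}
    (h : List.Forall₂ Represents ls xs) (f : LocalForms) (c : List ℤ → ℤ) :
    ((mulForms ls f).map fun p => p.1 * c p.2).sum =
      (f.map fun p => p.1 * ((xs.map (A.linForm p.2)).prod * c p.2)).sum := by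
  induction h generalizing c with
  | nil => simp [mulForms]
  | @cons l x ls xs hl _ ih =>
    change ((mulForm l (mulForms ls f)).map fun p => p.1 * c p.2).sum = _
    rw [sum_mulForm hl, ih fun q => A.linForm q x * c q]
    simp only [List.map_cons, List.prod_cons]
    congr 1
    refine List.map_congr_left fun p _ => ?_
    ring

theorem vanishes_succ (k h : ℕ) (f : LocalForms) : vanishes (k + 1) h f =
    lall (fun r => vanishes k (r + 1) (mulCoord r f)) (upTo h) := rfl

/-- Products of coordinates are symmetric, so the check only runs through nonincreasing index
sequences. A position of the largest index is split off at each stage, which keeps the remaining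
indices within the bound of the recursion. -/
theorem sum_eq_zero_of_vanishes {k : ℕ} {f : LocalForms} :
    ∀ h, h ≤ A.h → vanishes k h f = true → ∀ r : Fin k → Fin A.h, (∀ i, (r i : ℕ) < h) →
      (f.map fun p => p.1 * ∏ i, p.2.getD (r i) 0).sum = 0 := by
  induction k generalizing f with
  | zero =>
    intro h _ hv r _
    change zeroB (coeffSum f) = true at hv
    simpa [coeffSum] using hv
  | succ k ih =>
    intro h hh hv r hr
    obtain ⟨i, -, hi⟩ := Finset.exists_max_image Finset.univ (fun i => (r i : ℕ)) ⟨0, by simp⟩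
    rw [vanishes_succ, lall_iff] at hv
    have hv' := hv (r i) (by simpa using hr i)
    have := ih ((r i : ℕ) + 1) (r i).2 hv' (fun j => r (i.succAbove j))
      fun j => Nat.lt_succ_of_le (hi _ (Finset.mem_univ _))
    rw [sum_mulCoord (r i) f (fun q => ∏ j, q.getD (r (i.succAbove j)) 0)] at this
    refine Eq.trans ?_ this
    congr 1
    refine List.map_congr_left fun p _ => ?_
    rw [Fin.prod_univ_succAbove _ i]

end ToricSpace

end ToricMonad

/-! ### From lists to geometry: facets, nef and Kähler classes. -/

namespace ToricMonad

/-! ### Soundness of the checks: the fan -/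

theorem withIndex_ofFn {α : Type} {n : ℕ} (f : Fin n → α) :
    withIndex (List.ofFn f) 0 = (List.finRange n).map fun i => (f i, (i : ℕ)) := by
  rw [withIndex_eq]
  apply List.ext_getElem
  · simp
  · intro i h1 h2
    simp

theorem sum_eq_sum_getD {n : ℕ} (l : List ℤ) (h : l.length ≤ n) :
    l.sum = ∑ i : Fin n, l.getD i 0 := by
  induction n generalizing l with
  | zero => simp [List.length_eq_zero_iff.mp (Nat.le_zero.mp h)]
  | succ n ih =>
    cases l with
    | nil => simp
    | cons a l => rw [Fin.sum_univ_succ, List.sum_cons, ih l (by simpa using h)]; simp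

theorem getD_ofFn {α : Type} {n : ℕ} (f : Fin n → α) (d : α) (i : Fin n) :
    (List.ofFn f).getD i d = f i := by
  simp [List.getD]

theorem length_dualBasis_le (l : List (List ℤ)) : (dualBasis l).length ≤ 4 := by
  unfold dualBasis
  split <;> simp

namespace ToricSpace

variable {A : ToricSpace}

theorem represents_ofFn (x : A.Pic) : Represents (List.ofFn x) x :=
  ⟨by simp, fun r => getD_ofFn x 0 r⟩

variable (A)

@[simp] theorem length_rows : A.rows.length = A.h := by simp [rows]

theorem vertexList_rows : vertexList A.rows = List.ofFn fun ρ => List.ofFn (A.vertex ρ) := by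
  have e : (fun ρ => List.ofFn (A.vertex ρ)) =
      Fin.append (fun i : Fin 4 => unitVec 4 i) fun r => List.ofFn (A.extra r) := by
    ext1 ρ
    induction ρ using Fin.addCases with
    | left i =>
      rw [Fin.append_left, vertex_castAdd, unitVec_eq]
      fin_cases i <;> decide
    | right r => rw [Fin.append_right, vertex_natAdd]
  rw [e, List.ofFn_fin_append, vertexList, lappend_eq, lmap_eq, upTo_eq]
  congr 1

theorem divisorList_rows : divisorList A.rows = List.ofFn fun ρ => List.ofFn (A.divisor ρ) := by
  have e : (fun ρ => List.ofFn (A.divisor ρ)) =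
      Fin.append (fun i : Fin 4 => A.rows.map fun v => - v.getD i 0)
        fun r => unitVec A.h r := by
    ext1 ρ
    induction ρ using Fin.addCases with
    | left i =>
      rw [Fin.append_left, divisor_castAdd, rows, List.map_ofFn]
      congr 1
      ext r
      rw [Function.comp_apply, getD_ofFn]
    | right r =>
      rw [Fin.append_right, divisor_natAdd, unitVec_eq]
      apply List.ext_getElem
      · simp
      · intro i h1 h2
        simp [Pi.single_apply, Fin.ext_iff]
  rw [e, List.ofFn_fin_append, divisorList, lappend_eq, lmap_eq, lmap_eq, upTo_eq, upTo_eq,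
    length_rows]
  congr 1
  · simp only [lmap_eq, lget_eq]
    rfl
  · apply List.ext_getElem <;> simp

/-- The functional with given coefficients. -/
def functional (l : List ℤ) : A.Pic := fun r => l.getD r 0

theorem dot_divisor (l : List ℤ) (ρ : A.Ray) :
    dot l (List.ofFn (A.divisor ρ)) = A.relation (A.functional l) ρ :=
  (represents_ofFn _).dot_eq l

/-- The rays at which a functional is positive. -/
def posRays (l : List ℤ) : List A.Ray :=
  (List.finRange _).filter fun ρ => posB (A.relation (A.functional l) ρ)

theorem mem_posRays {l : List ℤ} {ρ : A.Ray} :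
    ρ ∈ A.posRays l ↔ 0 < A.relation (A.functional l) ρ := by
  simp [posRays]

theorem posSupport_divisorList (l : List ℤ) :
    posSupport (divisorList A.rows) l = (A.posRays l).map fun ρ : A.Ray => (ρ : ℕ) := by
  rw [posSupport, lmap_eq, lfilter_eq, divisorList_rows, withIndex_ofFn, List.filter_map,
    List.map_map, posRays]
  refine congrArg (List.map _) (List.filter_congr fun ρ _ => ?_)
  rw [Function.comp_apply, dot_divisor]

theorem mem_negSupport {l : List ℤ} {ρ : A.Ray} :
    (ρ : ℕ) ∈ negSupport (divisorList A.rows) l ↔ A.relation (A.functional l) ρ < 0 := by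
  rw [negSupport, lmap_eq, lfilter_eq, divisorList_rows, withIndex_ofFn, List.filter_map,
    List.map_map]
  have : ∀ a : ℤ, nonnegB a = false ↔ a < 0 := fun a => by
    rw [← Bool.not_eq_true, nonnegB_iff, not_le]
  simp [dot_divisor, this, Fin.val_inj]

/-- The rays outside a cone and the values of the dual basis. -/
theorem coneData_w (S : List ℕ) : (coneData (vertexList A.rows) S).w =
    (List.finRange _).map fun ρ => ((coneData (vertexList A.rows) S).U.map fun u =>
      dot u (List.ofFn (A.vertex ρ)), (ρ : ℕ)) := by
  simp only [coneData, lmap_eq, vertexList_rows, List.map_ofFn]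
  rw [withIndex_ofFn]
  rfl

theorem dot_vertex (l : List ℤ) (ρ : A.Ray) :
    dot l (List.ofFn (A.vertex ρ)) = ∑ i : Fin 4, l.getD i 0 * A.vertex ρ i := by
  rw [dot_eq_sum (n := 4) _ _ (by simp)]
  exact Finset.sum_congr rfl fun i _ => by rw [getD_ofFn]

variable {A}

/-- The computed data of a cone describe a given maximal cone. -/
structure Describes (c : ConeData) (F : A.Facet) : Prop where
  S_eq : c.S = List.ofFn fun k => (F.S k : ℕ)
  w_eq : ∀ ρ, ρ ∉ F.rays →
    ∃ l : List ℤ, l.length ≤ 4 ∧ (l, (ρ : ℕ)) ∈ c.out ∧ ∀ k : Fin 4, l.getD k 0 = F.w k ρ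

/-- Apart from the length of its result, nothing about `dualBasis` is used: duality to the
generators is certified by the check itself. -/
theorem exists_facet_of_check {S : List ℕ} (hS : S.Sublist (List.range (4 + A.h)))
    (hlen : S.length = 4) (hc : (coneData (vertexList A.rows) S).check = true) :
    ∃ F : A.Facet, Describes (coneData (vertexList A.rows) S) F := by
  set c := coneData (vertexList A.rows) S with hcdef
  have hw : c.w = (List.finRange _).map fun ρ => (c.U.map fun u =>
      dot u (List.ofFn (A.vertex ρ)), (ρ : ℕ)) := A.coneData_w S
  have hcS : c.S = S := rfl
  have hU : c.U.length ≤ 4 := length_dualBasis_le _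
  obtain ⟨f, hf⟩ : ∃ f : Fin 4 → A.Ray, S = List.ofFn fun k => (f k : ℕ) := by
    have hlt : ∀ k : Fin 4, S.getD k 0 < 4 + A.h := fun k => by
      have hk : (k : ℕ) < S.length := by omega
      rw [List.getD_eq_getElem _ _ hk]
      exact List.mem_range.mp (hS.subset (List.getElem_mem hk))
    refine ⟨fun k => ⟨S.getD k 0, hlt k⟩, List.ext_getElem (by rw [hlen, List.length_ofFn]) fun i h1 h2 => ?_⟩
    rw [List.getElem_ofFn]
    exact (List.getD_eq_getElem _ _ h1).symm
  have hval : ∀ (k : Fin 4) (ρ : A.Ray), (c.U.map fun u => dot u (List.ofFn (A.vertex ρ))).getD k 0 =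
      ∑ i : Fin 4, (c.U.getD k []).getD i 0 * A.vertex ρ i := by
    intro k ρ
    rw [← dot_vertex]
    by_cases hk : (k : ℕ) < c.U.length
    · rw [getD_map_of_lt 0 [] hk]
    · push Not at hk
      rw [List.getD_eq_default _ _ (by simpa using hk), List.getD_eq_default _ _ hk, dot_nil]
  rw [ConeData.check, Bool.and_eq_true, lall_iff] at hc
  obtain ⟨h1, h2⟩ := hc
  simp only [unitMatrixB, lall_iff, upTo_eq, List.mem_range, eqB_iff, lget_eq, lmap_eq] at h1
  have hdual : ∀ k j : Fin 4,
      ∑ i : Fin 4, (c.U.getD k []).getD i 0 * A.vertex (f j) i = if j = k then 1 else 0 := by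
    intro k j
    rw [← hval]
    have h := h1 j j.2 k k.2
    rw [getD_map_of_lt [] 0 (by rw [hcS, hlen]; exact j.2), hcS, hf, getD_ofFn, hw,
      getD_map_of_lt ([], 0) (f j) (by simp)] at h
    have e : (List.finRange (4 + A.h)).getD (f j : ℕ) (f j) = f j := by simp [List.getD]
    rw [e] at h
    rw [h]
    by_cases hjk : j = k
    · subst hjk
      rw [if_pos rfl]
      have : Nat.beq (j : ℕ) j = true := by simp
      rw [this]
    · rw [if_neg hjk]
      have : Nat.beq (k : ℕ) j = false := by
        rw [← Bool.not_eq_true, Nat.beq_eq]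
        exact fun h => hjk (Fin.ext h.symm)
      rw [this]
  have hpos : ∀ ρ : A.Ray, (∀ j, ρ ≠ f j) →
      0 < 1 - (c.U.map fun u => dot u (List.ofFn (A.vertex ρ))).sum := by
    intro ρ hρ
    have h := h2 (c.U.map fun u => dot u (List.ofFn (A.vertex ρ)), (ρ : ℕ))
      (by rw [hw]; exact List.mem_map.mpr ⟨ρ, List.mem_finRange ρ, rfl⟩)
    rw [Bool.or_eq_true, posB_iff, lany_iff] at h
    rcases h with h | ⟨i, hi, hi'⟩
    · rw [lsum_eq] at h; exact h
    · rw [hcS, hf, List.mem_ofFn] at hi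
      obtain ⟨j, rfl⟩ := hi
      exact absurd (Fin.ext (Nat.eq_of_beq_eq_true hi')) (hρ j)
  refine ⟨⟨f, fun k i => (c.U.getD k []).getD i 0, hdual, fun ρ hρ => ?_⟩, ⟨hf, fun ρ hρ => ?_⟩⟩
  · have := hpos ρ hρ
    rw [sum_eq_sum_getD _ (n := 4) (by simpa using hU)] at this
    simp_rw [hval] at this
    omega
  · refine ⟨c.U.map fun u => dot u (List.ofFn (A.vertex ρ)), by simpa using hU, ?_, fun k => hval k ρ⟩
    have hout : c.out = c.w.filter fun p => posB (Int.sub 1 (lsum p.1)) := by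
      rw [← lfilter_eq]; rfl
    rw [hout, List.mem_filter, hw]
    refine ⟨List.mem_map.mpr ⟨ρ, List.mem_finRange ρ, rfl⟩, ?_⟩
    rw [posB_iff, lsum_eq]
    refine hpos ρ fun j hj => hρ ?_
    rw [Facet.mem_rays]
    exact ⟨j, hj.symm⟩

theorem getD_lift {L : List ℤ} {x : A.Pic} (h : Represents L x) (ρ : A.Ray) :
    (0 :: 0 :: 0 :: 0 :: L).getD ρ 0 = A.lift x ρ := by
  induction ρ using Fin.addCases with
  | left i => rw [lift_castAdd]; fin_cases i <;> rfl
  | right r =>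
    rw [lift_natAdd, ← h.2 r, Fin.val_natAdd, Nat.add_comm]
    rfl

theorem Describes.test {c : ConeData} {F : A.Facet} (hc : Describes c F) {f : ℤ → Bool} {L : List ℤ}
    {x : A.Pic} (hx : Represents L x) (h : c.test f L = true) (ρ : A.Ray) (hρ : ρ ∉ F.rays) :
    f (F.coeff x ρ) = true := by
  obtain ⟨l, hlen, hmem, hl⟩ := hc.w_eq ρ hρ
  simp only [ConeData.test, lall_iff] at h
  have h' := h _ hmem
  rw [lget_eq, getD_lift hx, lmap_eq, dot_eq_sum (n := 4) _ _ hlen] at h'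
  rw [Facet.coeff]
  convert h' using 2
  change A.lift x ρ - _ = A.lift x ρ - _
  congr 1
  refine Finset.sum_congr rfl fun k _ => ?_
  rw [hl k, hc.S_eq, List.map_ofFn, getD_ofFn, Function.comp_apply, lget_eq, getD_lift hx]

/-- The set of rays with indices in a list. -/
def raySet (A : ToricSpace) (T : List ℕ) : Finset A.Ray :=
  Finset.univ.filter fun ρ => (ρ : ℕ) ∈ T

theorem mem_raySet {T : List ℕ} {ρ : A.Ray} : ρ ∈ A.raySet T ↔ (ρ : ℕ) ∈ T := by simp [raySet]

/-- The list of the indices of a set of rays. -/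
def indexList (T : Finset A.Ray) : List ℕ :=
  ((List.finRange _).filter fun ρ => decide (ρ ∈ T)).map fun ρ : A.Ray => (ρ : ℕ)

theorem mem_indexList {T : Finset A.Ray} {i : ℕ} : i ∈ indexList T ↔ ∃ ρ ∈ T, (ρ : ℕ) = i := by
  simp [indexList, eq_comm]

theorem indexList_sublist (T : Finset A.Ray) : (indexList T).Sublist (List.range (4 + A.h)) := by
  rw [← List.map_coe_finRange_eq_range]
  exact List.Sublist.map _ List.filter_sublist

theorem length_indexList (T : Finset A.Ray) : (indexList T).length = T.card := by
  rw [indexList, List.length_map, ← List.toFinset_card_of_nodup ((List.nodup_finRange _).filter _)]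
  congr 1
  ext ρ
  simp

theorem Describes.rays_eq {c : ConeData} {F : A.Facet} (hc : Describes c F) :
    F.rays = A.raySet c.S := by
  ext ρ
  rw [mem_raySet, Facet.mem_rays, hc.S_eq, List.mem_ofFn]
  exact exists_congr fun k => Fin.ext_iff

/-- The fan obtained from relations that pass the check. -/
def fanOfCheck (A : ToricSpace) (ls : List (List ℤ)) (h : (fanData A.rows ls).check ls = true) :
    A.Fan where
  facets := {F | ∃ c ∈ (fanData A.rows ls).cones, Describes c F}
  nonfaces := {P | ∃ l ∈ ls, P = (A.posRays l).toFinset}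
  not_subset := by
    rintro _ ⟨l, hl, rfl⟩ S hS hsub
    simp only [FanData.check, Bool.and_eq_true, lall_iff] at h
    have h1 := h.1 l hl
    have e : (fanData A.rows ls).ds = divisorList A.rows := rfl
    rw [posB_iff, lsum_eq, lmap_eq, e, divisorList_rows, List.map_ofFn, List.sum_ofFn] at h1
    simp only [Function.comp_apply, dot_divisor] at h1
    obtain ⟨ρ, h2, h3⟩ := hS.not_posSupport_subset _ h1
    exact h3 (hsub (by simpa [mem_posRays] using h2))
  complete := by
    intro T hT hP
    have hmem : indexList T ∈ faces ((ls.map (posSupport (divisorList A.rows))).map mask) 4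
        (List.range (4 + A.h)) := by
      refine mem_faces _ (indexList_sublist T) (by rw [length_indexList, hT]) ?_
      rintro _ hPm hsub
      obtain ⟨l, hl, rfl⟩ := List.mem_map.mp hPm
      refine hP _ ⟨l, hl, rfl⟩ fun ρ hρ => ?_
      rw [posSupport_divisorList] at hsub
      have := hsub (List.mem_map.mpr ⟨ρ, List.mem_toFinset.mp hρ, rfl⟩)
      obtain ⟨σ, hσ, hσρ⟩ := mem_indexList.mp this
      rwa [← Fin.ext hσρ]
    have hcone : coneData (vertexList A.rows) (indexList T) ∈ (fanData A.rows ls).cones := by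
      simp only [fanData, lmap_eq, upTo_eq, length_rows]
      exact List.mem_map.mpr ⟨_, hmem, rfl⟩
    simp only [FanData.check, Bool.and_eq_true, lall_iff] at h
    obtain ⟨F, hF⟩ := exists_facet_of_check (indexList_sublist T) (by rw [length_indexList, hT])
      (h.2 _ hcone)
    refine ⟨F, ⟨_, hcone, hF⟩, ?_⟩
    rw [hF.rays_eq]
    ext ρ
    rw [mem_raySet]
    change (ρ : ℕ) ∈ indexList T ↔ _
    rw [mem_indexList]
    simp [Fin.val_inj]

section

variable {ls : List (List ℤ)}

theorem exists_facet_of_mem_cones (h : (fanData A.rows ls).check ls = true)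
    {c : ConeData} (hc : c ∈ (fanData A.rows ls).cones) :
    ∃ F ∈ (fanOfCheck A ls h).facets, Describes c F := by
  have hc' := hc
  simp only [fanData, lmap_eq, upTo_eq, length_rows] at hc'
  obtain ⟨S, hS, rfl⟩ := List.mem_map.mp hc'
  obtain ⟨h1, h2, -⟩ := faces_spec (ls.map (posSupport (divisorList A.rows))) hS
  simp only [FanData.check, Bool.and_eq_true, lall_iff] at h
  obtain ⟨F, hF⟩ := exists_facet_of_check h1 h2 (h.2 _ hc)
  exact ⟨F, ⟨_, hc, hF⟩, hF⟩

theorem not_posRays_subset (h : (fanData A.rows ls).check ls = true)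
    {F : A.Facet} {l : List ℤ} (hl : l ∈ ls) : ∃ ρ, 0 < A.relation (A.functional l) ρ ∧ ρ ∉ F.rays := by
  have := (fanOfCheck A ls h).not_subset _ ⟨l, hl, rfl⟩ _ F.isMaxCone.1
  rw [Finset.not_subset] at this
  obtain ⟨ρ, h1, h2⟩ := this
  exact ⟨ρ, A.mem_posRays.mp (List.mem_toFinset.mp h1), h2⟩

theorem exists_facet_of_moriCheck (h : (fanData A.rows ls).check ls = true)
    {l : List ℤ} (hl : (fanData A.rows ls).moriCheck l = true) :
    ∃ F ∈ (fanOfCheck A ls h).facets, ∀ ρ ∉ F.rays, 0 ≤ A.relation (A.functional l) ρ := by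
  simp only [FanData.moriCheck, lany_iff] at hl
  obtain ⟨M, hM, hsub⟩ := hl
  have e : (fanData A.rows ls).coneMasks = (fanData A.rows ls).cones.map fun c => mask c.S := by
    simp only [fanData, lmap_eq, List.map_map]
    rfl
  rw [e] at hM
  obtain ⟨c, hc, rfl⟩ := List.mem_map.mp hM
  rw [subB_mask] at hsub
  obtain ⟨F, hF, hd⟩ := exists_facet_of_mem_cones h hc
  refine ⟨F, hF, fun ρ hρ => ?_⟩
  by_contra hneg
  push Not at hneg
  rw [hd.rays_eq, mem_raySet] at hρ
  exact hρ (hsub (A.mem_negSupport.mpr hneg))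

theorem nef_of_test (h : (fanData A.rows ls).check ls = true)
    {L : List ℤ} {x : A.Pic} (hx : Represents L x)
    (hL : ∀ c ∈ (fanData A.rows ls).cones, c.test nonnegB L = true) : A.IsNef (A.toReal x) := by
  refine (fanOfCheck A ls h).isNef x ?_
  rintro F ⟨c, hc, hd⟩ ρ hρ
  simpa using hd.test hx (hL c hc) ρ hρ

theorem kahler_of_test (h : (fanData A.rows ls).check ls = true)
    {L : List ℤ} {x : A.Pic} (hx : Represents L x)
    (hL : ∀ c ∈ (fanData A.rows ls).cones, c.test posB L = true) : A.IsKahler (A.toReal x) := by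
  refine (fanOfCheck A ls h).isKahler x ?_
  rintro F ⟨c, hc, hd⟩ ρ hρ
  simpa using hd.test hx (hL c hc) ρ hρ

theorem nef_functional_nonneg (h : (fanData A.rows ls).check ls = true)
    {l : List ℤ} (hl : (fanData A.rows ls).moriCheck l = true)
    {L : Fin A.h → ℝ} (hL : A.IsNef L) : 0 ≤ ∑ r, (A.functional l r : ℝ) * L r := by
  obtain ⟨F, -, hF⟩ := exists_facet_of_moriCheck h hl
  exact hL.relation_nonneg _ F.isMaxCone hF

/-- Strictness comes from the positive support of the relation: it is not contained in the facet, so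
some ray outside has a positive coefficient, and there the support function is strictly convex. -/
theorem kahler_functional_pos (h : (fanData A.rows ls).check ls = true)
    {l : List ℤ} (hmem : l ∈ ls)
    (hl : (fanData A.rows ls).moriCheck l = true)
    {L : Fin A.h → ℝ} (hL : A.IsKahler L) : 0 < ∑ r, (A.functional l r : ℝ) * L r := by
  obtain ⟨F, -, hF⟩ := exists_facet_of_moriCheck h hl
  obtain ⟨σ, h1, h2⟩ := not_posRays_subset h (F := F) hmem
  exact hL.relation_pos _ F.isMaxCone hF h2 h1

end

end ToricSpace

end ToricMonad

namespace ToricMonad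

namespace ToricSpace

variable {A : ToricSpace} {ls : List (List ℤ)}

/-! ### Soundness of the checks: the intersection form -/

theorem pure_of_check (h : (fanData A.rows ls).check ls = true)
    (hT : ∀ k ∈ List.range 4, ∀ T ∈ faces (fanData A.rows ls).masks k (List.range (4 + A.h)),
      ∃ M ∈ (fanData A.rows ls).coneMasks, subB (mask T) M = true) :
    (fanOfCheck A ls h).Pure := by
  intro T hcard hP
  rcases hcard.lt_or_eq with hlt | heq
  · have hmem : indexList T ∈ faces ((ls.map (posSupport (divisorList A.rows))).map mask) T.card
        (List.range (4 + A.h)) := by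
      refine mem_faces _ (indexList_sublist T) (length_indexList T) ?_
      rintro _ hPm hsub
      obtain ⟨l, hl, rfl⟩ := List.mem_map.mp hPm
      refine hP _ ⟨l, hl, rfl⟩ fun ρ hρ => ?_
      rw [posSupport_divisorList] at hsub
      have := hsub (List.mem_map.mpr ⟨ρ, List.mem_toFinset.mp hρ, rfl⟩)
      obtain ⟨σ, hσ, hσρ⟩ := mem_indexList.mp this
      rwa [← Fin.ext hσρ]
    have e1 : (fanData A.rows ls).masks = (ls.map (posSupport (divisorList A.rows))).map mask := by
      simp only [fanData, lmap_eq]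
    obtain ⟨M, hM, hsub⟩ := hT _ (List.mem_range.mpr hlt) _ (e1 ▸ hmem)
    have e : (fanData A.rows ls).coneMasks = (fanData A.rows ls).cones.map fun c => mask c.S := by
      simp only [fanData, lmap_eq, List.map_map]
      rfl
    rw [e] at hM
    obtain ⟨c, hc, rfl⟩ := List.mem_map.mp hM
    rw [subB_mask] at hsub
    obtain ⟨F, hF, hd⟩ := exists_facet_of_mem_cones h hc
    refine ⟨F, hF, fun ρ hρ => ?_⟩
    rw [hd.rays_eq, mem_raySet]
    exact hsub (mem_indexList.mpr ⟨ρ, hρ, rfl⟩)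
  · obtain ⟨F, hF, rfl⟩ := (fanOfCheck A ls h).complete T heq hP
    exact ⟨F, hF, subset_rfl⟩

theorem lget_divisorList (ρ : A.Ray) :
    lget [] (divisorList A.rows) ρ = List.ofFn (A.divisor ρ) := by
  rw [lget_eq, divisorList_rows, getD_ofFn]

theorem forall₂_divisors (T : List A.Ray) :
    List.Forall₂ Represents (lmap (lget [] (divisorList A.rows)) (T.map fun ρ : A.Ray => (ρ : ℕ)))
      (T.map A.divisor) := by
  rw [lmap_eq, List.map_map]
  induction T with
  | nil => exact List.Forall₂.nil
  | cons ρ T ih =>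
    refine List.Forall₂.cons ?_ ih
    rw [Function.comp_apply, lget_divisorList]
    exact represents_ofFn _

theorem list_sum_finset_sum {α ι : Type*} (s : Finset ι) (f : List α) (g : α → ι → ℤ) :
    (f.map fun p => ∑ i ∈ s, g p i).sum = ∑ i ∈ s, (f.map fun p => g p i).sum := by
  induction f with
  | nil => simp
  | cons p f ih => simp [ih, Finset.sum_add_distrib]

theorem sum_prod_eq_zero {k : ℕ} {f : LocalForms} (hv : vanishes k A.h f = true)
    (y : Fin k → A.Pic) : (f.map fun p => p.1 * ∏ i, A.linForm p.2 (y i)).sum = 0 := by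
  have e : (fun p : ℤ × List ℤ => p.1 * ∏ i, A.linForm p.2 (y i)) = fun p =>
      ∑ r : Fin k → Fin A.h, (∏ i, y i (r i)) * (p.1 * ∏ i, p.2.getD (r i) 0) := by
    ext p
    simp_rw [linForm_apply, Finset.prod_univ_sum, Fintype.piFinset_univ, Finset.mul_sum]
    refine Finset.sum_congr rfl fun r _ => ?_
    rw [Finset.prod_mul_distrib]
    ring
  rw [e, list_sum_finset_sum]
  refine Finset.sum_eq_zero fun r _ => ?_
  have := sum_eq_zero_of_vanishes A.h le_rfl hv r fun i => (r i).2
  rw [List.sum_map_mul_left, this, mul_zero]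

/-- If all elements of `T` occur among four factors, one occurrence of each can be split off,
leaving `4 - k` arbitrary factors. It reduces vanishing on products containing a nonface to the
vanishing of a form of degree `4 - k`. -/
theorem exists_complement {α : Type*} [DecidableEq α] {T : Finset α} {ρ : Fin 4 → α} {k : ℕ}
    (hk : T.card = k) (hT : T ⊆ Finset.univ.image ρ) :
    k ≤ 4 ∧ ∃ e : Fin (4 - k) → Fin 4, ∀ g : α → ℤ,
      ∏ i, g (ρ i) = (∏ σ ∈ T, g σ) * ∏ j, g (ρ (e j)) := by
  have hcard : k ≤ 4 := hk ▸ (Finset.card_le_card hT).trans (Finset.card_image_le.trans (by simp))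
  refine ⟨hcard, ?_⟩
  obtain ⟨Q, -, hQ, hinj⟩ : ∃ Q : Finset (Fin 4), Q ⊆ Finset.univ ∧ Q.image ρ = T ∧
      Set.InjOn ρ Q := by
    obtain ⟨Q, hQ1, hQ2, hQ3⟩ := Finset.exists_subset_injOn_image_eq_of_surjOn (f := ρ) Set.univ T
      (fun σ hσ => by
        obtain ⟨a, -, ha⟩ := Finset.mem_image.mp (hT hσ)
        exact ⟨a, trivial, ha⟩)
    exact ⟨Q, Finset.subset_univ _, hQ3, hQ2⟩
  have hQcard : Qᶜ.card = 4 - k := by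
    rw [Finset.card_compl, Fintype.card_fin, ← hk, ← hQ, Finset.card_image_of_injOn hinj]
  refine ⟨fun j => (Qᶜ.equivFinOfCardEq hQcard).symm j, fun g => ?_⟩
  have hprod : ∏ σ ∈ T, g σ = ∏ i ∈ Q, g (ρ i) := by rw [← hQ, Finset.prod_image hinj]
  rw [← Finset.prod_mul_prod_compl Q, hprod,
    ← Finset.prod_coe_sort Qᶜ, ← Equiv.prod_comp (Qᶜ.equivFinOfCardEq hQcard).symm]

/-- The localization formula for the intersection form, up to the common denominator. -/
theorem exists_intersectionForm_of_check (h : (fanData A.rows ls).check ls = true)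
    (hI : (fanData A.rows ls).intersectionCheck A.h = true) :
    (∃! κ, A.IsIntersectionForm κ) ∧ ∀ x, commonDenom * A.intersectionForm x =
      A.powerForm (localForms A.h (fanData A.rows ls)) x := by
  simp only [FanData.intersectionCheck, Bool.and_eq_true, lall_iff, lany_iff, upTo_eq] at hI
  obtain ⟨⟨hface, hnon⟩, hpure⟩ := hI
  have hP := pure_of_check h hpure
  have hds : (fanData A.rows ls).ds = divisorList A.rows := rfl
  have hPs : (fanData A.rows ls).Ps = ls.map (posSupport (divisorList A.rows)) := by
    simp only [fanData, lmap_eq]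
  have hW : commonDenom ≠ 0 := by decide
  -- The sum of fourth powers qualifies as `commonDenom` times the intersection form by its values
  -- alone. On a nonface the product over its rays is absorbed into the coefficients, and the
  -- remaining form of lower degree vanishes identically.
  obtain ⟨κ, hκ, hval⟩ := Fan.exists_isIntersectionForm (W := commonDenom)
    (φ := A.powerForm (localForms A.h (fanData A.rows ls))) hP hW (powerForm_symm _) (by
      rintro F ⟨c, hc, hd⟩
      have := hface c hc
      have e : (List.ofFn fun k => (F.S k : ℕ)) = (List.ofFn F.S).map fun ρ : A.Ray => (ρ : ℕ) := by
        rw [List.map_ofFn]; rfl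
      rw [eqB_iff, coeffSum_eq, hd.S_eq, e, hds,
        sum_mulForms (forall₂_divisors (List.ofFn F.S)) _ fun _ => 1] at this
      rw [← this, powerForm_apply]
      congr 1
      refine List.map_congr_left fun p _ => ?_
      rw [List.map_ofFn, List.map_ofFn, List.prod_ofFn, mul_one]
      rfl) (by
      rintro ρ ⟨_, ⟨l, hl, rfl⟩, hsub⟩
      have hnd : (A.posRays l).Nodup := (List.nodup_finRange _).filter _
      obtain ⟨hcard, e, he⟩ := exists_complement (List.toFinset_card_of_nodup hnd) hsub
      have := hnon _ (by rw [hPs]; exact List.mem_map.mpr ⟨l, hl, rfl⟩)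
      rw [posSupport_divisorList, List.length_map, hds, Bool.or_eq_true] at this
      rcases this with h4 | hv
      · rw [Nat.blt_eq] at h4; omega
      have hv' := sum_prod_eq_zero (k := 4 - (A.posRays l).length) hv fun j => A.divisor (ρ (e j))
      rw [sum_mulForms (forall₂_divisors (A.posRays l)) _
        fun q => ∏ j, A.linForm q (A.divisor (ρ (e j)))] at hv'
      rw [powerForm_apply, ← hv']
      congr 1
      refine List.map_congr_left fun p _ => ?_
      rw [he fun σ => A.linForm p.2 (A.divisor σ), List.prod_toFinset _ hnd, List.map_map]
      rfl)
  have huniq : ∀ κ', A.IsIntersectionForm κ' → κ' = κ := fun κ' h' =>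
    Fan.isIntersectionForm_unique hP h' hκ
  refine ⟨⟨κ, hκ, huniq⟩, ?_⟩
  rw [huniq _ (intersectionForm_spec ⟨κ, hκ⟩)]
  exact hval

/-! ### Soundness of the checks: simple spaces -/

/-- The Kähler cone is generated by a basis of the Picard group. -/
structure KahlerBasis (A : ToricSpace) where
  J : Fin A.h → A.Pic
  M : Fin A.h → A.Pic
  dual : ∀ i j, ∑ r, M i r * J j r = if i = j then 1 else 0
  nef_iff : ∀ L : Fin A.h → ℝ, A.IsNef L ↔ ∀ i, 0 ≤ ∑ r, (M i r : ℝ) * L r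
  kahler_iff : ∀ L : Fin A.h → ℝ, A.IsKahler L ↔ ∀ i, 0 < ∑ r, (M i r : ℝ) * L r

/-- A one-sided inverse of a square matrix is two-sided. -/
theorem dual_comm {h : ℕ} {J M : Fin h → Fin h → ℤ}
    (dual : ∀ i j, ∑ r, M i r * J j r = if i = j then 1 else 0) (r s : Fin h) :
    ∑ i, J i r * M i s = if r = s then 1 else 0 := by
  have h1 : Matrix.of M * (Matrix.of J).transpose = 1 := by
    ext i j
    simp [Matrix.mul_apply, dual, Matrix.one_apply]
  have h2 := congrArg (fun N : Matrix (Fin h) (Fin h) ℤ => N r s) (mul_eq_one_comm.mp h1)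
  simpa [Matrix.mul_apply, Matrix.one_apply] using h2

/-- The coordinates in the basis `J` with dual basis `M`. -/
def coordEquiv (R : Type*) [CommRing R] {h : ℕ} {J M : Fin h → Fin h → ℤ}
    (dual : ∀ i j, ∑ r, M i r * J j r = if i = j then 1 else 0) :
    (Fin h → R) ≃ₗ[R] (Fin h → R) where
  toFun L i := ∑ r, (M i r : R) * L r
  map_add' x y := by ext i; simp [mul_add, Finset.sum_add_distrib]
  map_smul' c x := by ext i; simp [Finset.mul_sum, mul_left_comm]
  invFun t := ∑ i, t i • fun r => (J i r : R)
  left_inv L := by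
    have h1 : ∀ r s, ∑ i, (J i r : R) * (M i s : R) = if r = s then 1 else 0 := fun r s => by
      have := congrArg (Int.cast : ℤ → R) (dual_comm dual r s)
      push_cast at this
      exact this
    ext s
    simp only [Finset.sum_apply, Pi.smul_apply, smul_eq_mul, Finset.sum_mul]
    rw [Finset.sum_comm]
    have : ∀ r, ∑ i, (M i r : R) * L r * (J i s : R) = (if s = r then 1 else 0) * L r := by
      intro r
      rw [← h1 s r, Finset.sum_mul]
      exact Finset.sum_congr rfl fun i _ => by ring
    simp [this]
  right_inv t := by
    have h1 : ∀ i j, ∑ r, (M i r : R) * (J j r : R) = if i = j then 1 else 0 := fun i j => by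
      have := congrArg (Int.cast : ℤ → R) (dual i j)
      push_cast at this
      exact this
    ext i
    simp only [Finset.sum_apply, Pi.smul_apply, smul_eq_mul, Finset.mul_sum]
    rw [Finset.sum_comm]
    have : ∀ j, ∑ r, (M i r : R) * (t j * (J j r : R)) = t j * if i = j then 1 else 0 := by
      intro j
      rw [← h1 i j, Finset.mul_sum]
      exact Finset.sum_congr rfl fun i _ => by ring
    simp [this]

theorem eq_sum_real {h : ℕ} {J M : Fin h → Fin h → ℤ}
    (dual : ∀ i j, ∑ r, M i r * J j r = if i = j then 1 else 0) (L : Fin h → ℝ) :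
    L = ∑ i, (∑ r, (M i r : ℝ) * L r) • fun r => (J i r : ℝ) :=
  ((coordEquiv ℝ dual).symm_apply_apply L).symm

theorem represents_functional {l : List ℤ} (hl : l.length = A.h) :
    Represents l (A.functional l) := ⟨hl, fun _ => rfl⟩

theorem functional_vecSum {J : List (List ℤ)} (hJ : J.length = A.h) :
    A.functional (vecSum A.h J) = ∑ j : Fin A.h, A.functional (J.getD j []) := by
  ext r
  have e : ∀ l : List (List ℤ), (l.map fun x => x.getD r 0).sum =
      ∑ j : Fin l.length, (l.getD j []).getD r 0 := by
    intro l
    induction l with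
    | nil => simp
    | cons a l ih => rw [List.map_cons, List.sum_cons, ih]; simp [Fin.sum_univ_succ]
  rw [functional, vecSum, lmap_eq, upTo_eq, getD_map_range 0 r.2, Finset.sum_apply, lsum_eq, lmap_eq]
  simp only [lget_eq]
  rw [e, ← Fin.sum_congr' _ hJ.symm]
  rfl

/-- The basis of the Kähler cone of a space that passes the check. -/
def kahlerBasisOfCheck {J : List (List ℤ)} (hJ : ∀ x ∈ J, x.length = A.h)
    (hc : simpleCheck A.rows ls J = true) : KahlerBasis A :=
  have hlen : J.length = A.h := by
    simp only [simpleCheck, Bool.and_eq_true, Nat.beq_eq, length_rows] at hc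
    exact hc.1.1.1.1.1
  have hrep : ∀ j : Fin A.h, Represents (J.getD j []) (A.functional (J.getD j [])) := fun j => by
    refine represents_functional (hJ _ ?_)
    rw [List.getD_eq_getElem _ _ (by rw [hlen]; exact j.2)]
    exact List.getElem_mem _
  have hdual : ∀ i j : Fin A.h, ∑ r, A.functional ((ls.take A.h).getD i []) r *
      A.functional (J.getD j []) r = if i = j then 1 else 0 := by
    intro i j
    simp only [simpleCheck, Bool.and_eq_true, length_rows, isIdentity, unitMatrixB, lall_iff, upTo_eq,
      List.mem_range, eqB_iff, lget_eq, lmap_eq] at hc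
    have h1 := hc.1.1.1.2 i i.2 j j.2
    by_cases hi : (i : ℕ) < (ls.take A.h).length
    · rw [getD_map_of_lt [] [] hi, getD_map_of_lt 0 [] (by rw [hlen]; exact j.2),
        (hrep j).dot_eq] at h1
      refine Eq.trans h1 ?_
      by_cases hij : i = j
      · subst hij
        have : Nat.beq (i : ℕ) i = true := by simp
        rw [this, if_pos rfl]
      · have : Nat.beq (j : ℕ) i = false := by
          rw [← Bool.not_eq_true, Nat.beq_eq]
          exact fun h => hij (Fin.ext h.symm)
        rw [this, if_neg hij]
    -- Too short a list of relations would yield the default entry `0` on the diagonal of the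
    -- identity matrix.
    · push Not at hi
      have h2 := hc.1.1.1.2 i i.2 i i.2
      have h3 : ((ls.take A.h).map fun l => J.map fun x => dot l x).getD i [] = [] :=
        List.getD_eq_default _ _ (by rw [List.length_map]; exact hi)
      rw [h3] at h2
      have h4 : Nat.beq (i : ℕ) i = true := by simp
      rw [h4] at h2
      simp at h2
  have hF : (fanData A.rows ls).check ls = true := by
    simp only [simpleCheck, Bool.and_eq_true] at hc
    exact hc.1.1.1.1.2
  have hM : ∀ i : Fin A.h, (ls.take A.h).getD i [] ∈ ls.take A.h := by
    intro i
    by_cases hi : (i : ℕ) < (ls.take A.h).length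
    · rw [List.getD_eq_getElem _ _ hi]
      exact List.getElem_mem _
    · push Not at hi
      have h2 := hdual i i
      rw [List.getD_eq_default _ _ hi] at h2
      simp [functional] at h2
  have hmori : ∀ i : Fin A.h,
      (fanData A.rows ls).moriCheck ((ls.take A.h).getD i []) = true := by
    intro i
    simp only [simpleCheck, Bool.and_eq_true, lall_iff, length_rows] at hc
    exact hc.1.1.2 _ (hM i)
  have hnef : ∀ j : Fin A.h, A.IsNef (A.toReal (A.functional (J.getD j []))) := by
    intro j
    simp only [simpleCheck, Bool.and_eq_true, lall_iff] at hc
    refine nef_of_test hF (hrep j) fun c hcm => (hc.1.2 c hcm).1 _ ?_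
    rw [List.getD_eq_getElem _ _ (by rw [hlen]; exact j.2)]
    exact List.getElem_mem _
  have hkahler : A.IsKahler (A.toReal (A.functional (vecSum A.h J))) := by
    simp only [simpleCheck, Bool.and_eq_true, lall_iff, length_rows] at hc
    refine kahler_of_test hF (represents_functional ?_) fun c hcm => (hc.1.2 c hcm).2
    rw [vecSum, lmap_eq, upTo_eq, List.length_map, List.length_range]
  have hgen : ∀ t : Fin A.h → ℝ, (∀ i, 0 ≤ t i) →
      A.IsNef (∑ i, t i • A.toReal (A.functional (J.getD i []))) := fun t ht =>
    IsNef.sum _ fun i _ => (hnef i).smul (ht i)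
  { J := fun j => A.functional (J.getD j [])
    M := fun i => A.functional ((ls.take A.h).getD i [])
    dual := hdual
    nef_iff := fun L => by
      refine ⟨fun hL i => nef_functional_nonneg hF (hmori i) hL, fun hL => ?_⟩
      rw [eq_sum_real hdual L]
      exact hgen _ hL
    kahler_iff := fun L => by
      refine ⟨fun hL i => kahler_functional_pos hF (List.mem_of_mem_take (hM i)) (hmori i) hL,
        fun hL => ?_⟩
      -- With `ε` at most every coordinate of `L`, the class `L` is `ε` times the Kähler class `∑ J`
      -- plus a nef class, hence Kähler.
      obtain ⟨ε, hε, hle⟩ : ∃ ε : ℝ, 0 < ε ∧ ∀ i : Fin A.h,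
          ε ≤ ∑ r, (A.functional ((ls.take A.h).getD i []) r : ℝ) * L r := by
        rcases isEmpty_or_nonempty (Fin A.h) with he | hne
        · exact ⟨1, one_pos, fun i => he.elim i⟩
        · obtain ⟨i, hi⟩ := Finite.exists_min fun i : Fin A.h =>
            ∑ r, (A.functional ((ls.take A.h).getD i []) r : ℝ) * L r
          exact ⟨_, hL i, hi⟩
      have e : L = ε • A.toReal (A.functional (vecSum A.h J)) +
          ∑ i : Fin A.h, ((∑ r, (A.functional ((ls.take A.h).getD i []) r : ℝ) * L r) - ε) •
            A.toReal (A.functional (J.getD i [])) := by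
        simp_rw [sub_smul, Finset.sum_sub_distrib, ← Finset.smul_sum]
        rw [functional_vecSum hlen]
        have e1 : A.toReal (∑ j : Fin A.h, A.functional (J.getD j [])) =
            ∑ j : Fin A.h, A.toReal (A.functional (J.getD j [])) := by
          ext r
          simp [toReal]
        rw [e1, add_sub_cancel]
        exact eq_sum_real hdual L
      rw [e]
      exact (hkahler.smul hε).add_isNef (hgen _ fun i => sub_nonneg.mpr (hle i)) }

end ToricSpace

end ToricMonad

/-! ### Coordinates in the Kähler cone; tests for spaces that are not simple or not products. -/

namespace ToricMonad

namespace ToricSpace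

variable {A : ToricSpace} {ls : List (List ℤ)}

namespace KahlerBasis

variable (K : KahlerBasis A)

/-- The coordinates of a class in the basis of the Kähler cone. -/
def coord : A.Pic ≃ₗ[ℤ] (Fin A.h → ℤ) := coordEquiv ℤ K.dual

theorem coord_apply (x : A.Pic) (i : Fin A.h) : K.coord x i = ∑ r, K.M i r * x r := by
  simp [coord, coordEquiv]

theorem coord_symm_apply (t : Fin A.h → ℤ) : K.coord.symm t = ∑ i, t i • K.J i := by
  simp only [coord, coordEquiv, LinearEquiv.coe_symm_mk, Int.cast_id]

theorem eq_sum (x : A.Pic) : x = ∑ i, K.coord x i • K.J i := by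
  rw [← coord_symm_apply, LinearEquiv.symm_apply_apply]

@[simp] theorem coord_J (i j : Fin A.h) : K.coord (K.J j) i = if i = j then 1 else 0 := by
  rw [coord_apply, K.dual]

theorem coord_cast (x : A.Pic) (i : Fin A.h) :
    ∑ r, (K.M i r : ℝ) * A.toReal x r = K.coord x i := by
  rw [coord_apply]
  simp [toReal]

theorem isNef_iff (x : A.Pic) : A.IsNef (A.toReal x) ↔ ∀ i, 0 ≤ K.coord x i := by
  simp_rw [K.nef_iff, coord_cast]
  exact forall_congr' fun i => by norm_cast

theorem isKahler_iff (x : A.Pic) : A.IsKahler (A.toReal x) ↔ ∀ i, 0 < K.coord x i := by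
  simp_rw [K.kahler_iff, coord_cast]
  exact forall_congr' fun i => by norm_cast

theorem isNef_iff_exists (L : Fin A.h → ℝ) : A.IsNef L ↔
    ∃ t : Fin A.h → ℝ, (∀ r, 0 ≤ t r) ∧ L = ∑ r, t r • A.toReal (K.J r) := by
  rw [K.nef_iff]
  refine ⟨fun hL => ⟨_, hL, eq_sum_real K.dual L⟩, ?_⟩
  rintro ⟨t, ht, rfl⟩ i
  exact (ht i).trans_eq (congrFun ((coordEquiv ℝ K.dual).apply_symm_apply t) i).symm

theorem isSimple (K : KahlerBasis A) : A.IsSimple := by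
  refine ⟨Module.Basis.ofEquivFun (coordEquiv ℝ K.dual), fun L => ?_⟩
  have : ∀ r, Module.Basis.ofEquivFun (coordEquiv ℝ K.dual) r = A.toReal (K.J r) := by
    intro r
    rw [Module.Basis.coe_ofEquivFun]
    change ∑ i, (Pi.single r 1 : Fin A.h → ℝ) i • (fun s => (K.J i s : ℝ)) = _
    rw [Finset.sum_eq_single r (fun i _ hi => by rw [Pi.single_eq_of_ne hi, zero_smul])
      (fun hr => absurd (Finset.mem_univ r) hr), Pi.single_eq_same, one_smul]
    rfl
  simp_rw [this]
  exact K.isNef_iff_exists L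

theorem exists_isKahlerBasis :
    ∃ J : Module.Basis (Fin A.h) ℤ A.Pic, A.IsKahlerBasis J ∧ ∀ r, J r = K.J r := by
  refine ⟨Module.Basis.ofEquivFun K.coord, ?_, ?_⟩
  swap
  · intro r
    rw [Module.Basis.coe_ofEquivFun]
    refine (K.coord_symm_apply _).trans ?_
    rw [Finset.sum_eq_single r (fun i _ hi => by rw [Pi.single_eq_of_ne hi, zero_smul])
      (fun hr => absurd (Finset.mem_univ r) hr), Pi.single_eq_same, one_smul]
  · intro L
    have : ∀ r, Module.Basis.ofEquivFun K.coord r = K.J r := by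
      intro r
      rw [Module.Basis.coe_ofEquivFun]
      refine (K.coord_symm_apply _).trans ?_
      rw [Finset.sum_eq_single r (fun i _ hi => by rw [Pi.single_eq_of_ne hi, zero_smul])
        (fun hr => absurd (Finset.mem_univ r) hr), Pi.single_eq_same, one_smul]
    simp_rw [this]
    exact K.isNef_iff_exists L

end KahlerBasis

/-! ### Spaces that are not simple -/

/-- The value of a functional with integer coefficients. -/
def realEval (l : List ℤ) : (ℕ → ℝ) → ℝ :=
  List.rec (fun _ => 0) (fun a _ ih x => a * x 0 + ih fun i => x (i + 1)) l

@[simp] theorem realEval_nil (x : ℕ → ℝ) : realEval [] x = 0 := rfl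

@[simp] theorem realEval_cons (a : ℤ) (l : List ℤ) (x : ℕ → ℝ) :
    realEval (a :: l) x = a * x 0 + realEval l fun i => x (i + 1) := rfl

theorem realEval_eq_sum {n : ℕ} (l : List ℤ) (hl : l.length ≤ n) (x : ℕ → ℝ) :
    realEval l x = ∑ i : Fin n, (l.getD i 0 : ℝ) * x i := by
  induction l generalizing n x with
  | nil => simp
  | cons a l ih => cases n with
    | zero => simp at hl
    | succ n =>
      rw [Fin.sum_univ_succ, realEval_cons, ih (by simpa using hl)]
      simp

/-- `p l - a k`, entry by entry. -/
def combine (p a : ℤ) (k l : List ℤ) : List ℤ :=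
  List.zipWith (fun x y => p * x - a * y) k l

theorem realEval_combine (p a : ℤ) (k l : List ℤ) (hkl : k.length = l.length) (x : ℕ → ℝ) :
    realEval (combine p a k l) x = p * realEval k x - a * realEval l x := by
  induction k generalizing l x with
  | nil =>
    obtain rfl : l = [] := List.length_eq_zero_iff.mp hkl.symm
    simp [combine]
  | cons b k ih => cases l with
    | nil => simp at hkl
    | cons c l =>
      have := ih l (by simpa using hkl) fun i => x (i + 1)
      simp only [combine] at this
      simp only [combine, List.zipWith_cons_cons, realEval_cons, this]
      push_cast
      ring

/-- Whether the common kernel of functionals on an `n`-dimensional space is zero, by Gaussian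
elimination. -/
def trivialKernel : ℕ → List (List ℤ) → Bool
  | 0, _ => true
  | n + 1, ls => match ls.filter fun l => !zeroB (l.headD 0) with
    | [] => false
    | p :: _ => lall (fun l => Nat.beq l.length (n + 1)) ls && trivialKernel n
        (ls.map fun l => combine (p.headD 0) (l.headD 0) l.tail p.tail)

theorem eq_zero_of_trivialKernel {n : ℕ} {ls : List (List ℤ)} (hn : trivialKernel n ls = true)
    {x : ℕ → ℝ} (hx : ∀ l ∈ ls, realEval l x = 0) : ∀ i < n, x i = 0 := by
  induction n generalizing ls x with
  | zero => simp
  | succ n ih =>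
    rw [trivialKernel] at hn
    split at hn
    · simp at hn
    rename_i p k hp
    have hmem : p ∈ ls.filter fun l => !zeroB (l.headD 0) := by rw [hp]; simp
    rw [List.mem_filter] at hmem
    simp only [Bool.and_eq_true, lall_iff, Nat.beq_eq] at hn
    have hcons : ∀ l ∈ ls, l = l.headD 0 :: l.tail := fun l hl => by
      have := hn.1 l hl
      cases l with
      | nil => simp at this
      | cons a l => rfl
    have hlen : ∀ l ∈ ls, l.tail.length = n := fun l hl => by rw [List.length_tail, hn.1 l hl]; rfl
    have hval : ∀ l ∈ ls, (l.headD 0 : ℝ) * x 0 + realEval l.tail (fun i => x (i + 1)) = 0 :=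
      fun l hl => by
        have := hx l hl
        rw [hcons l hl] at this
        exact this
    have htail : ∀ i < n, x (i + 1) = 0 := by
      refine ih hn.2 ?_
      intro l' hl'
      obtain ⟨l, hl, rfl⟩ := List.mem_map.mp hl'
      rw [realEval_combine _ _ _ _ ((hlen l hl).trans (hlen p hmem.1).symm)]
      linear_combination (p.headD 0 : ℝ) * hval l hl - (l.headD 0 : ℝ) * hval p hmem.1
    intro i hi
    cases i with
    | succ i => exact htail i (by omega)
    | zero =>
      have h0 := hval p hmem.1
      rw [realEval_eq_sum _ (hlen p hmem.1).le, Finset.sum_eq_zero fun i _ => by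
        rw [htail i i.2, mul_zero], add_zero] at h0
      have : p.headD 0 ≠ 0 := by
        intro h
        have h1 := hmem.2
        rw [(zeroB_iff _).mpr h] at h1
        simp at h1
      exact (mul_eq_zero.mp h0).resolve_left (by exact_mod_cast this)

/-- The decomposition property fails for the nef cone: `a` is bounded by the sum of the classes `c`,
but there are no nonzero nef classes bounded by `a` and one of the classes `c`. -/
def nonsimpleCheck (X ls : List (List ℤ)) : List (List ℤ) → Bool
  | [] => false
  | a :: cs =>
    let F := fanData X ls
    let h := X.length
    let M := ls.filter F.moriCheck
    F.check ls && lall (fun l => Nat.beq l.length h) ls && lany (fun r => not (zeroB (lget 0 a r))) (upTo h) &&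
    lall (fun c => lall (c.test nonnegB) (a :: vecSum h (a.map Int.neg :: cs) :: cs)) F.cones &&
    lall (fun c => trivialKernel h (M.filter fun l => zeroB (dot l a) || zeroB (dot l c))) cs

/-- In a simplicial cone the order is coordinatewise. A coordinate that is positive on `a` is
positive on some `c i`, and the corresponding generator, scaled by the smaller of the two values,
lies below both. -/
theorem IsSimple.exists_nef_le (hA : A.IsSimple) {a : Fin A.h → ℝ} (ha : A.IsNef a) (ha0 : a ≠ 0)
    {ι : Type*} {s : Finset ι} {c : ι → Fin A.h → ℝ} (hc : ∀ i ∈ s, A.IsNef (c i))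
    (hsum : A.IsNef (∑ i ∈ s, c i - a)) :
    ∃ i ∈ s, ∃ x, x ≠ 0 ∧ A.IsNef x ∧ A.IsNef (a - x) ∧ A.IsNef (c i - x) := by
  obtain ⟨J, hJ⟩ := hA
  have hnef : ∀ L, A.IsNef L ↔ ∀ r, 0 ≤ J.repr L r := by
    intro L
    rw [hJ]
    constructor
    · rintro ⟨t, ht, rfl⟩ r
      rw [J.repr_sum_self]
      exact ht r
    · exact fun h => ⟨_, h, (J.sum_repr L).symm⟩
  rw [hnef] at ha hsum
  have hc' : ∀ i ∈ s, ∀ r, 0 ≤ J.repr (c i) r := fun i hi => (hnef _).mp (hc i hi)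
  obtain ⟨r, hr⟩ : ∃ r, 0 < J.repr a r := by
    by_contra! hcon
    apply ha0
    apply J.repr.injective
    ext r
    rw [map_zero]
    exact le_antisymm (hcon r) (ha r)
  obtain ⟨i, hi, hir⟩ : ∃ i ∈ s, 0 < J.repr (c i) r := by
    by_contra! hcon
    have h1 := hsum r
    simp only [map_sub, map_sum, Finsupp.coe_sub, Pi.sub_apply, Finsupp.coe_finsetSum,
      Finset.sum_apply] at h1
    have h2 := Finset.sum_nonpos hcon
    linarith
  set t := min (J.repr a r) (J.repr (c i) r) with ht
  have ht0 : 0 < t := lt_min hr hir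
  have hrepr : ∀ q, J.repr (t • J r) q = if r = q then t else 0 := by
    intro q
    simp [Finsupp.single_apply]
  refine ⟨i, hi, t • J r, smul_ne_zero ht0.ne' (J.ne_zero r), ?_, ?_, ?_⟩
  · rw [hnef]
    intro q
    rw [hrepr]
    split_ifs <;> simp [ht0.le]
  · rw [hnef]
    intro q
    rw [map_sub, Finsupp.sub_apply, hrepr, sub_nonneg]
    split_ifs with h
    · exact h ▸ min_le_left _ _
    · exact ha q
  · rw [hnef]
    intro q
    rw [map_sub, Finsupp.sub_apply, hrepr, sub_nonneg]
    split_ifs with h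
    · exact h ▸ min_le_right _ _
    · exact hc' i hi q

theorem realEval_functional {l : List ℤ} (hl : l.length = A.h) (L : Fin A.h → ℝ) :
    realEval l (fun i => if h : i < A.h then L ⟨i, h⟩ else 0) =
      ∑ r, (A.functional l r : ℝ) * L r := by
  rw [realEval_eq_sum l hl.le]
  refine Finset.sum_congr rfl fun r _ => ?_
  simp [functional]

theorem dot_eq_sum_real {l x : List ℤ} (hx : x.length = A.h) :
    (dot l x : ℝ) = ∑ r, (A.functional l r : ℝ) * A.toReal (A.functional x) r := by
  rw [(represents_functional hx).dot_eq, linForm_apply]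
  simp [toReal, functional]

/-- If `x` and `a - x` are nef, each functional that is nonnegative on the nef cone and zero on `a`
is zero on `x`; likewise for a class `c`. By the check the functionals of these two kinds have no
common zero except `0`, so the decomposition property of simplicial cones fails. -/
theorem not_isSimple_of_check {cs : List (List ℤ)} (hcs : ∀ c ∈ cs, c.length = A.h)
    (hc : nonsimpleCheck A.rows ls cs = true) : ¬ A.IsSimple := by
  intro hA
  cases cs with
  | nil => simp [nonsimpleCheck] at hc
  | cons a cs =>
  simp only [nonsimpleCheck, Bool.and_eq_true, lall_iff, lany_iff, length_rows, Nat.beq_eq] at hc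
  obtain ⟨⟨⟨⟨hF, hlen⟩, r, hr, har⟩, htest⟩, hker⟩ := hc
  have hnef : ∀ x ∈ a :: vecSum A.h (a.map Int.neg :: cs) :: cs, x.length = A.h →
      A.IsNef (A.toReal (A.functional x)) := fun x hx hxl =>
    nef_of_test hF (represents_functional hxl) fun c hcm => htest c hcm x hx
  have ha0 : A.toReal (A.functional a) ≠ 0 := by
    intro h
    rw [upTo_eq, List.mem_range] at hr
    have := congrFun h ⟨r, hr⟩
    simp only [toReal, functional, Pi.zero_apply, Int.cast_eq_zero] at this
    rw [lget_eq, (zeroB_iff _).mpr this] at har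
    simp at har
  have hsum : A.IsNef (∑ i : Fin cs.length, A.toReal (A.functional cs[i]) -
      A.toReal (A.functional a)) := by
    have := hnef (vecSum A.h (a.map Int.neg :: cs)) (by simp) (by simp [vecSum])
    convert this using 1
    ext r
    simp only [toReal, functional, Pi.sub_apply, Finset.sum_apply, vecSum, lmap_eq, upTo_eq, lsum_eq,
      lget_eq]
    rw [getD_map_range 0 r.2, List.map_cons, List.sum_cons,
      getD_map_of_lt 0 0 (by rw [hcs a (by simp)]; exact r.2), ← Fin.sum_univ_fun_getElem]
    push_cast
    rw [sub_eq_neg_add]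
    congr 1
    change _ = ((-(a.getD r 0) : ℤ) : ℝ)
    push_cast
    rfl
  obtain ⟨i, -, x, hx0, hx, hax, hcx⟩ := hA.exists_nef_le (s := Finset.univ)
    (hnef a (by simp) (hcs a (by simp))) ha0
    (fun i _ => hnef cs[i] (by simp) (hcs _ (by simp))) hsum
  apply hx0
  have hzero : ∀ y : List ℤ, y.length = A.h → A.IsNef (A.toReal (A.functional y) - x) →
      ∀ l ∈ ls, (fanData A.rows ls).moriCheck l = true → dot l y = 0 →
        ∑ r, (A.functional l r : ℝ) * x r = 0 := by
    intro y hy hyx l hl hm h0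
    have h1 := nef_functional_nonneg hF hm hx
    have h2 := nef_functional_nonneg hF hm hyx
    simp only [Pi.sub_apply, mul_sub, Finset.sum_sub_distrib] at h2
    rw [← dot_eq_sum_real hy, h0] at h2
    push_cast at h2
    linarith
  have := eq_zero_of_trivialKernel (hker cs[i] (by simp))
    (x := fun i => if h : i < A.h then x ⟨i, h⟩ else 0) (by
      intro l hl
      simp only [List.mem_filter, Bool.or_eq_true, zeroB_iff] at hl
      rw [realEval_functional (hlen l hl.1.1)]
      rcases hl.2 with h0 | h0
      · exact hzero a (hcs a (by simp)) hax l hl.1.1 hl.1.2 h0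
      · exact hzero cs[i] (hcs _ (by simp)) hcx l hl.1.1 hl.1.2 h0)
  ext r
  simpa using this r r.2

/-! ### Products of projective spaces -/

theorem IsProjectiveProduct.sum_vertex (hA : A.IsProjectiveProduct) : ∑ ρ, A.vertex ρ = 0 := by
  obtain ⟨q, -, hq⟩ := hA
  rw [← Finset.sum_fiberwise Finset.univ q]
  exact Finset.sum_eq_zero fun r _ => hq r

/-- Standard unit vectors alone never add up to zero, so each of the `h` blocks contains one of the
`h` further vertices, hence exactly one. That vertex is minus the sum of the unit vectors in its
block. -/
theorem IsProjectiveProduct.extra_nonpos (hA : A.IsProjectiveProduct) (r : Fin A.h) (i : Fin 4) :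
    A.extra r i ≤ 0 := by
  obtain ⟨q, hsurj, hq⟩ := hA
  have hsplit : ∀ s j, (∑ k : Fin 4, if q (Fin.castAdd A.h k) = s then (Pi.single k 1 : Fin 4 → ℤ) j
      else 0) + ∑ t : Fin A.h, (if q (Fin.natAdd 4 t) = s then A.extra t j else 0) = 0 := by
    intro s j
    have := congrFun (hq s) j
    rw [Finset.sum_filter, Fin.sum_univ_add] at this
    simp only [vertex_castAdd, vertex_natAdd, Pi.add_apply, Finset.sum_apply, Pi.zero_apply] at this
    refine Eq.trans ?_ this
    congr 1 <;> exact Finset.sum_congr rfl fun t _ => by split_ifs <;> rfl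
  have hcoord : ∀ s j, (∑ k : Fin 4, if q (Fin.castAdd A.h k) = s then (Pi.single k 1 : Fin 4 → ℤ) j
      else 0) = if q (Fin.castAdd A.h j) = s then 1 else 0 := by
    intro s j
    rw [Finset.sum_eq_single j]
    · simp
    · intro k _ hk
      simp [hk.symm]
    · simp
  simp_rw [hcoord] at hsplit
  have hsurj' : Function.Surjective fun t : Fin A.h => q (Fin.natAdd 4 t) := by
    intro s
    by_contra! hcon
    obtain ⟨ρ, hρ⟩ := hsurj s
    induction ρ using Fin.addCases with
    | left j =>
      have := hsplit s j
      rw [if_pos hρ, Finset.sum_eq_zero fun t _ => if_neg (hcon t)] at this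
      simp at this
    | right t => exact hcon t hρ
  have hinj := Finite.injective_iff_surjective.mpr hsurj'
  have := hsplit (q (Fin.natAdd 4 r)) i
  rw [Finset.sum_eq_single r (fun t _ ht => if_neg fun h => ht (hinj h)) (by simp),
    if_pos rfl] at this
  split_ifs at this <;> omega

/-- The vertices are not those of a product of projective spaces. -/
def nonproductCheck (X : List (List ℤ)) : Bool :=
  lany (fun v => lany posB v) X ||
    lany (fun i => not (zeroB (lsum (lmap (fun v => lget 0 v i) (vertexList X))))) (upTo 4)

theorem not_isProjectiveProduct_of_check (hc : nonproductCheck A.rows = true) :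
    ¬ A.IsProjectiveProduct := by
  intro hA
  simp only [nonproductCheck, Bool.or_eq_true, lany_iff, upTo_eq] at hc
  rcases hc with ⟨v, hv, a, ha, hpos⟩ | ⟨i, hi, hne⟩
  · rw [rows, List.mem_ofFn] at hv
    obtain ⟨r, rfl⟩ := hv
    rw [List.mem_ofFn] at ha
    obtain ⟨i, rfl⟩ := ha
    rw [posB_iff] at hpos
    exact absurd (hA.extra_nonpos r i) (not_le.mpr hpos)
  · rw [List.mem_range] at hi
    have h0 : lsum (lmap (fun v => lget 0 v i) (vertexList A.rows)) = 0 := by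
      have h1 := congrFun hA.sum_vertex ⟨i, hi⟩
      rw [Finset.sum_apply, Pi.zero_apply] at h1
      rw [vertexList_rows, lmap_eq, List.map_ofFn, lsum_eq, List.sum_ofFn]
      refine Eq.trans ?_ h1
      refine Finset.sum_congr rfl fun ρ _ => ?_
      rw [Function.comp_apply, lget_eq]
      exact getD_ofFn (A.vertex ρ) 0 ⟨i, hi⟩
    rw [(zeroB_iff _).mpr h0] at hne
    simp at hne

end ToricSpace

end ToricMonad

/-! ### Chern numbers of the anticanonical hypersurface and the candidate criterion. -/

namespace ToricMonad

/-! ### Elementary symmetric functions -/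

/-- The second elementary symmetric function. -/
def esymm2 (l : List ℤ) : ℤ := List.rec 0 (fun a k ih => Int.add ih (Int.mul a (lsum k))) l

/-- The third elementary symmetric function. -/
def esymm3 (l : List ℤ) : ℤ := List.rec 0 (fun a k ih => Int.add ih (Int.mul a (esymm2 k))) l

theorem esymm2_cons (a : ℤ) (l : List ℤ) : esymm2 (a :: l) = esymm2 l + a * l.sum := by
  rw [← lsum_eq]
  rfl

theorem esymm3_cons (a : ℤ) (l : List ℤ) : esymm3 (a :: l) = esymm3 l + a * esymm2 l := rfl

theorem esymm2_ofFn {n : ℕ} (f : Fin n → ℤ) :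
    esymm2 (List.ofFn f) = ∑ i, ∑ j ∈ Finset.Ioi i, f i * f j := by
  induction n with
  | zero => simp [esymm2]
  | succ n ih =>
    rw [List.ofFn_succ, esymm2_cons, ih, Fin.sum_univ_succ]
    simp_rw [Fin.sum_Ioi_succ, Fin.sum_Ioi_zero, List.sum_ofFn, Finset.mul_sum]
    ring

theorem esymm3_ofFn {n : ℕ} (f : Fin n → ℤ) : esymm3 (List.ofFn f) =
    ∑ i, ∑ j ∈ Finset.Ioi i, ∑ k ∈ Finset.Ioi j, f i * f j * f k := by
  induction n with
  | zero => simp [esymm3]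
  | succ n ih =>
    rw [List.ofFn_succ, esymm3_cons, ih, Fin.sum_univ_succ, esymm2_ofFn]
    simp_rw [Fin.sum_Ioi_succ, Fin.sum_Ioi_zero, Fin.sum_Ioi_succ, Finset.mul_sum, mul_assoc]
    ring

/-- The localization formula restricted to products with a class on `X`, in the coordinates given by
the classes `J`. The function `w` gives the value of the class at a fixed point, in terms of the values
of the toric divisors. -/
def pointForms (h : ℕ) (F : FanData) (J : List (List ℤ)) (w : List ℤ → ℤ) : LocalForms :=
  lmap (fun p => (Int.mul p.1 (w (lmap (dot p.2) F.ds)), lmap (dot p.2) J)) (localForms h F)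

/-- The value of the normal bundle. -/
def weightX (l : List ℤ) : ℤ := lsum l

/-- The value of `c₂(X)` times the normal bundle. -/
def weightChern2 (l : List ℤ) : ℤ := Int.mul (lsum l) (esymm2 l)

/-- The value of `c₃(X)` times the normal bundle. -/
def weightChern3 (l : List ℤ) : ℤ :=
  Int.mul (lsum l) (Int.sub (esymm3 l) (Int.mul (lsum l) (esymm2 l)))

def tripleSum (f : LocalForms) (r s t : ℕ) : ℤ := coeffSum (mulCoord t (mulCoord s (mulCoord r f)))

namespace ToricSpace

variable {A : ToricSpace} {ls : List (List ℤ)}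

/-! ### Intersection numbers of the anticanonical hypersurface -/

theorem triple_add_left (a a' b c : A.Pic) : A.triple (a + a') b c = A.triple a b c + A.triple a' b c :=
  congrArg (fun f => f ![b, c, A.normalBundle]) (A.intersectionForm.curryLeft.map_add a a')

theorem triple_smul_left (n : ℤ) (a b c : A.Pic) : A.triple (n • a) b c = n • A.triple a b c :=
  congrArg (fun f => f ![b, c, A.normalBundle]) (A.intersectionForm.curryLeft.map_smul n a)

theorem triple_add_mid (a b b' c : A.Pic) : A.triple a (b + b') c = A.triple a b c + A.triple a b' c :=
  congrArg (fun f => f ![c, A.normalBundle])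
    ((A.intersectionForm.curryLeft a).curryLeft.map_add b b')

theorem triple_smul_mid (n : ℤ) (a b c : A.Pic) : A.triple a (n • b) c = n • A.triple a b c :=
  congrArg (fun f => f ![c, A.normalBundle])
    ((A.intersectionForm.curryLeft a).curryLeft.map_smul n b)

theorem triple_add_right (a b c c' : A.Pic) :
    A.triple a b (c + c') = A.triple a b c + A.triple a b c' :=
  congrArg (fun f => f ![A.normalBundle])
    (((A.intersectionForm.curryLeft a).curryLeft b).curryLeft.map_add c c')

theorem triple_smul_right (n : ℤ) (a b c : A.Pic) : A.triple a b (n • c) = n • A.triple a b c :=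
  congrArg (fun f => f ![A.normalBundle])
    (((A.intersectionForm.curryLeft a).curryLeft b).curryLeft.map_smul n c)

variable (A) in
/-- The triple intersection form as a trilinear map. -/
noncomputable def tripleHom : A.Pic →ₗ[ℤ] A.Pic →ₗ[ℤ] A.Pic →ₗ[ℤ] ℤ :=
  LinearMap.mk₂ ℤ
    (fun a b => { toFun := A.triple a b
                  map_add' := triple_add_right a b
                  map_smul' := fun n => triple_smul_right n a b })
    (fun a a' b => LinearMap.ext fun c => triple_add_left a a' b c)
    (fun n a b => LinearMap.ext fun c => triple_smul_left n a b c)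
    (fun a b b' => LinearMap.ext fun c => triple_add_mid a b b' c)
    (fun n a b => LinearMap.ext fun c => triple_smul_mid n a b c)

theorem tripleHom_apply (a b c : A.Pic) : A.tripleHom a b c = A.triple a b c := rfl

variable (A) in
/-- The pairing with the second Chern class as a linear map. -/
noncomputable def chern2Hom : A.Pic →ₗ[ℤ] ℤ :=
  ∑ ρ, ∑ σ ∈ Finset.Ioi ρ, A.tripleHom (A.divisor ρ) (A.divisor σ)

theorem chern2Hom_apply (L : A.Pic) : A.chern2Hom L = A.chern2 L := by
  simp [chern2Hom, chern2, tripleHom_apply]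

/-- The localization formula. -/
def Localizes (A : ToricSpace) (f : LocalForms) : Prop :=
  ∀ x, commonDenom * A.intersectionForm x = A.powerForm f x

theorem Localizes.triple {f : LocalForms} (hf : A.Localizes f) (x y z : A.Pic) :
    commonDenom * A.triple x y z = (f.map fun p => p.1 *
      (A.linForm p.2 A.normalBundle * (A.linForm p.2 x * A.linForm p.2 y * A.linForm p.2 z))).sum := by
  rw [ToricSpace.triple, hf, powerForm_apply]
  congr 1
  refine List.map_congr_left fun p _ => ?_
  rw [Fin.prod_univ_four]
  simp only [Matrix.cons_val]
  ring

theorem linForm_normalBundle (l : List ℤ) :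
    A.linForm l A.normalBundle = ∑ ρ, A.linForm l (A.divisor ρ) := by
  rw [normalBundle, map_sum]

theorem Localizes.chern2 {f : LocalForms} (hf : A.Localizes f) (L : A.Pic) :
    commonDenom * A.chern2 L = (f.map fun p => p.1 * (A.linForm p.2 A.normalBundle *
      ((∑ ρ, ∑ σ ∈ Finset.Ioi ρ, A.linForm p.2 (A.divisor ρ) * A.linForm p.2 (A.divisor σ)) *
        A.linForm p.2 L))).sum := by
  simp_rw [ToricSpace.chern2, Finset.mul_sum, hf.triple, Finset.sum_mul, Finset.mul_sum]
  rw [list_sum_finset_sum]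
  simp_rw [list_sum_finset_sum]

theorem Localizes.eulerNumber {f : LocalForms} (hf : A.Localizes f) :
    commonDenom * A.eulerNumber = (f.map fun p => p.1 * (A.linForm p.2 A.normalBundle *
      ((∑ ρ, ∑ σ ∈ Finset.Ioi ρ, ∑ τ ∈ Finset.Ioi σ, A.linForm p.2 (A.divisor ρ) *
        A.linForm p.2 (A.divisor σ) * A.linForm p.2 (A.divisor τ)) -
      A.linForm p.2 A.normalBundle * (∑ ρ, ∑ σ ∈ Finset.Ioi ρ, A.linForm p.2 (A.divisor ρ) *
        A.linForm p.2 (A.divisor σ))))).sum := by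
  rw [ToricSpace.eulerNumber, mul_sub, hf.chern2]
  have e : commonDenom * (∑ ρ, ∑ σ ∈ Finset.Ioi ρ, ∑ τ ∈ Finset.Ioi σ,
      A.triple (A.divisor ρ) (A.divisor σ) (A.divisor τ)) =
      (f.map fun p => p.1 * (A.linForm p.2 A.normalBundle * (∑ ρ, ∑ σ ∈ Finset.Ioi ρ,
        ∑ τ ∈ Finset.Ioi σ, A.linForm p.2 (A.divisor ρ) * A.linForm p.2 (A.divisor σ) *
          A.linForm p.2 (A.divisor τ)))).sum := by
    simp_rw [Finset.mul_sum, hf.triple]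
    rw [list_sum_finset_sum]
    simp_rw [list_sum_finset_sum]
  rw [e, sub_eq_iff_eq_add, ← List.sum_map_add]
  congr 1
  refine List.map_congr_left fun p _ => ?_
  ring

theorem map_dot_divisorList (l : List ℤ) :
    (divisorList A.rows).map (dot l) = List.ofFn fun ρ => A.linForm l (A.divisor ρ) := by
  rw [divisorList_rows, List.map_ofFn]
  congr 1
  ext ρ
  exact (represents_ofFn _).dot_eq l

theorem weightX_eq (l : List ℤ) :
    weightX ((divisorList A.rows).map (dot l)) = A.linForm l A.normalBundle := by
  rw [weightX, lsum_eq, map_dot_divisorList, List.sum_ofFn, linForm_normalBundle]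

theorem weightChern2_eq (l : List ℤ) : weightChern2 ((divisorList A.rows).map (dot l)) =
    A.linForm l A.normalBundle * ∑ ρ, ∑ σ ∈ Finset.Ioi ρ,
      A.linForm l (A.divisor ρ) * A.linForm l (A.divisor σ) := by
  rw [← weightX_eq, map_dot_divisorList, ← esymm2_ofFn]
  rfl

theorem weightChern3_eq (l : List ℤ) : weightChern3 ((divisorList A.rows).map (dot l)) =
    A.linForm l A.normalBundle * ((∑ ρ, ∑ σ ∈ Finset.Ioi ρ, ∑ τ ∈ Finset.Ioi σ,
      A.linForm l (A.divisor ρ) * A.linForm l (A.divisor σ) * A.linForm l (A.divisor τ)) -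
      A.linForm l A.normalBundle * ∑ ρ, ∑ σ ∈ Finset.Ioi ρ,
        A.linForm l (A.divisor ρ) * A.linForm l (A.divisor σ)) := by
  rw [← weightX_eq, map_dot_divisorList, ← esymm2_ofFn, ← esymm3_ofFn]
  rfl

theorem sum_pointForms {J : List (List ℤ)} {x : Fin A.h → A.Pic} (hlen : J.length = A.h)
    (hx : ∀ j : Fin A.h, Represents (J.getD j []) (x j)) (w : List ℤ → ℤ) (c : (Fin A.h → ℤ) → ℤ) :
    ((pointForms A.h (fanData A.rows ls) J w).map fun p => p.1 * c fun j => p.2.getD j 0).sum =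
      ((localForms A.h (fanData A.rows ls)).map fun p => p.1 *
        (w ((divisorList A.rows).map (dot p.2)) * c fun j => A.linForm p.2 (x j))).sum := by
  rw [pointForms, lmap_eq, List.map_map]
  congr 1
  refine List.map_congr_left fun p _ => ?_
  simp only [Function.comp_apply, lmap_eq]
  rw [← mul_assoc]
  have : (fun j : Fin A.h => (J.map (dot p.2)).getD j 0) = fun j => A.linForm p.2 (x j) := by
    ext j
    rw [getD_map_of_lt 0 [] (by rw [hlen]; exact j.2)]
    exact (hx j).dot_eq p.2
  rw [this]
  rfl

theorem tripleSum_eq {J : List (List ℤ)} {x : Fin A.h → A.Pic} (hlen : J.length = A.h)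
    (hx : ∀ j : Fin A.h, Represents (J.getD j []) (x j))
    (hf : A.Localizes (localForms A.h (fanData A.rows ls))) (r s t : Fin A.h) :
    tripleSum (pointForms A.h (fanData A.rows ls) J weightX) r s t =
      commonDenom * A.triple (x r) (x s) (x t) := by
  rw [tripleSum, coeffSum_eq, sum_mulCoord (t : ℕ) _ fun _ => 1,
    sum_mulCoord (s : ℕ) _ fun l => l.getD t 0 * 1,
    sum_mulCoord (r : ℕ) _ fun l => l.getD s 0 * (l.getD t 0 * 1),
    sum_pointForms hlen hx weightX fun l => l r * (l s * (l t * 1)), hf.triple]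
  congr 1
  refine List.map_congr_left fun p _ => ?_
  rw [weightX_eq]
  ring

theorem chern2Sum_eq {J : List (List ℤ)} {x : Fin A.h → A.Pic} (hlen : J.length = A.h)
    (hx : ∀ j : Fin A.h, Represents (J.getD j []) (x j))
    (hf : A.Localizes (localForms A.h (fanData A.rows ls))) (r : Fin A.h) :
    coeffSum (mulCoord r (pointForms A.h (fanData A.rows ls) J weightChern2)) =
      commonDenom * A.chern2 (x r) := by
  rw [coeffSum_eq, sum_mulCoord (r : ℕ) _ fun _ => 1,
    sum_pointForms hlen hx weightChern2 fun l => l r * 1, hf.chern2]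
  congr 1
  refine List.map_congr_left fun p _ => ?_
  rw [weightChern2_eq]
  ring

theorem eulerSum_eq {J : List (List ℤ)} {x : Fin A.h → A.Pic} (hlen : J.length = A.h)
    (hx : ∀ j : Fin A.h, Represents (J.getD j []) (x j))
    (hf : A.Localizes (localForms A.h (fanData A.rows ls))) :
    coeffSum (pointForms A.h (fanData A.rows ls) J weightChern3) =
      commonDenom * A.eulerNumber := by
  rw [coeffSum_eq, sum_pointForms hlen hx weightChern3 fun _ => 1, hf.eulerNumber]
  congr 1
  refine List.map_congr_left fun p _ => ?_
  rw [weightChern3_eq]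
  ring

theorem Localizes.triple_swap {f : LocalForms} (hf : A.Localizes f) (x y z : A.Pic) :
    A.triple x y z = A.triple y x z := by
  have hW : commonDenom ≠ 0 := by decide
  apply mul_left_cancel₀ hW
  rw [hf.triple, hf.triple]
  congr 1
  refine List.map_congr_left fun p _ => ?_
  ring

theorem Localizes.triple_rotate {f : LocalForms} (hf : A.Localizes f) (x y z : A.Pic) :
    A.triple x y z = A.triple y z x := by
  have hW : commonDenom ≠ 0 := by decide
  apply mul_left_cancel₀ hW
  rw [hf.triple, hf.triple]
  congr 1
  refine List.map_congr_left fun p _ => ?_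
  ring

/-! ### Candidates -/

/-- The definition of a Kähler basis provides nonnegative real coefficients; they agree with the
integral coordinates. -/
theorem IsKahlerBasis.repr_nonneg {J : Module.Basis (Fin A.h) ℤ A.Pic} (hJ : A.IsKahlerBasis J)
    {x : A.Pic} (hx : A.IsNef (A.toReal x)) (i : Fin A.h) : 0 ≤ J.repr x i := by
  obtain ⟨t, ht, hxt⟩ := (hJ _).mp hx
  -- The coordinate functional is given by integers, and so it extends to real classes and can be
  -- applied to the real combination.
  have hM : ∀ y : A.Pic, J.repr y i = ∑ r, J.repr (Pi.single r 1) i * y r := by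
    intro y
    have e : y = ∑ r, y r • (Pi.single r 1 : A.Pic) := by
      ext s
      simp [Pi.single_apply]
    conv_lhs => rw [e]
    simp only [map_sum, map_smul, Finsupp.coe_finsetSum, Finset.sum_apply, Finsupp.smul_apply,
      smul_eq_mul]
    exact Finset.sum_congr rfl fun r _ => mul_comm _ _
  have h1 : ∀ y : A.Pic, (J.repr y i : ℝ) = ∑ r, (J.repr (Pi.single r 1) i : ℝ) * A.toReal y r := by
    intro y
    rw [hM]
    simp [toReal]
  have h2 : (J.repr x i : ℝ) = t i := by
    rw [h1, hxt]
    simp only [Finset.sum_apply, Pi.smul_apply, smul_eq_mul, Finset.mul_sum]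
    rw [Finset.sum_comm]
    have : ∀ s, ∑ r, (J.repr (Pi.single r 1) i : ℝ) * (t s * A.toReal (J s) r) =
        t s * if i = s then 1 else 0 := by
      intro s
      have h3 := h1 (J s)
      rw [J.repr_self, Finsupp.single_apply] at h3
      have h4 : (if i = s then (1 : ℝ) else 0) = ((if s = i then 1 else 0 : ℤ) : ℝ) := by
        simp [eq_comm]
      rw [h4, h3, Finset.mul_sum]
      exact Finset.sum_congr rfl fun r _ => by ring
    simp [this]
  exact_mod_cast h2 ▸ ht i

namespace KahlerBasis

variable (K : KahlerBasis A)

theorem triple_eq_sum (z x y : A.Pic) : A.triple z x y =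
    ∑ s, ∑ t, K.coord x s * K.coord y t * A.triple z (K.J s) (K.J t) := by
  conv_lhs => rw [K.eq_sum x, K.eq_sum y]
  simp only [← tripleHom_apply, map_sum, map_smul, LinearMap.sum_apply, LinearMap.smul_apply,
    smul_eq_mul, Finset.mul_sum]
  rw [Finset.sum_comm]
  exact Finset.sum_congr rfl fun s _ => Finset.sum_congr rfl fun t _ => by ring

theorem isNef_J (i : Fin A.h) : A.IsNef (A.toReal (K.J i)) := by
  rw [K.isNef_iff]
  intro j
  rw [coord_J]
  split_ifs <;> simp

/-- With nonnegative intersection numbers the left side of the bound grows with each `b s` and the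
right side shrinks as `N` grows, so `N = 3` and `b = 1` is the weakest case. An arbitrary Kähler
basis is compared with `K.J` by nonnegativity of the coordinates, without showing that the two
differ by a permutation. -/
theorem isCandidate_iff (hnn : ∀ r s t, 0 ≤ A.triple (K.J r) (K.J s) (K.J t)) : A.IsCandidate ↔
    ∀ r, 3 * ∑ s, ∑ t, A.triple (K.J r) (K.J s) (K.J t) ≤ 2 * A.chern2 (K.J r) := by
  constructor
  · rintro ⟨J', hJ', N, hN, b, hb, hle⟩ r
    have hN3 : 3 ≤ N := by
      simp only [Finset.mem_insert, Finset.mem_singleton] at hN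
      omega
    set B := ∑ s, b s • J' s with hB
    set u := ∑ t, J' t with hu
    have h1 : ∀ q, (N : ℤ) * A.triple (J' q) B u ≤ 2 * A.chern2 (J' q) := by
      intro q
      have hN0 : (0 : ℚ) < N := by exact_mod_cast (by omega : 0 < N)
      have e : (A.triple (J' q) B u : ℚ) =
          ∑ s, (∑ t, (A.triple (J' q) (J' s) (J' t) : ℚ)) * (b s : ℚ) := by
        rw [hB, hu]
        simp only [← tripleHom_apply, map_sum, map_smul, LinearMap.sum_apply, LinearMap.smul_apply,
          smul_eq_mul]
        push_cast
        rw [Finset.sum_comm]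
        refine Finset.sum_congr rfl fun s _ => ?_
        rw [Finset.sum_mul]
        exact Finset.sum_congr rfl fun t _ => by ring
      have h2 := hle q
      rw [← e] at h2
      have h3 : (N : ℚ) * A.triple (J' q) B u ≤ 2 * A.chern2 (J' q) := by
        calc (N : ℚ) * A.triple (J' q) B u ≤ N * (2 / N * A.chern2 (J' q)) :=
              mul_le_mul_of_nonneg_left h2 hN0.le
          _ = 2 * A.chern2 (J' q) := by field_simp
      exact_mod_cast h3
    have hnef' : ∀ q, A.IsNef (A.toReal (J' q)) := by
      intro q
      rw [hJ']
      refine ⟨Pi.single q 1, fun s => ?_, ?_⟩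
      · by_cases h : s = q
        · subst h; simp
        · simp [h]
      · rw [Finset.sum_eq_single q (fun i _ hi => by rw [Pi.single_eq_of_ne hi, zero_smul])
          (fun hr => absurd (Finset.mem_univ q) hr), Pi.single_eq_same, one_smul]
    have hcoord : ∀ q i, 0 ≤ K.coord (J' q) i := fun q => (K.isNef_iff _).mp (hnef' q)
    -- The coordinates of all `J' q` are nonnegative; if their sum had a zero coordinate, all of
    -- them would lie in a hyperplane and could not span.
    have hu1 : ∀ i, 1 ≤ K.coord u i := by
      intro i
      by_contra! hcon
      have h2 : ∀ q, K.coord (J' q) i = 0 := by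
        have h3 : ∑ q, K.coord (J' q) i ≤ 0 := by
          rw [hu, map_sum, Finset.sum_apply] at hcon
          omega
        intro q
        exact (Finset.sum_eq_zero_iff_of_nonneg fun q _ => hcoord q i).mp
          (le_antisymm h3 (Finset.sum_nonneg fun q _ => hcoord q i)) q (Finset.mem_univ q)
      have h3 := K.coord_J i i
      rw [← J'.sum_repr (K.J i)] at h3
      simp only [map_sum, map_smul, Finset.sum_apply, Pi.smul_apply, h2, smul_zero,
        Finset.sum_const_zero, if_true] at h3
      exact zero_ne_one h3
    have hB1 : ∀ i, 1 ≤ K.coord B i := by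
      intro i
      refine (hu1 i).trans ?_
      rw [hu, hB]
      simp only [map_sum, map_smul, Finset.sum_apply, Pi.smul_apply, smul_eq_mul]
      exact Finset.sum_le_sum fun q _ => by nlinarith [hcoord q i, hb q]
    -- The inequalities for the classes `J' q` are combined with the nonnegative coefficients of
    -- `K.J r` in the basis `J'`.
    have h2 : (N : ℤ) * A.triple (K.J r) B u ≤ 2 * A.chern2 (K.J r) := by
      have e : K.J r = ∑ q, J'.repr (K.J r) q • J' q := (J'.sum_repr _).symm
      rw [← chern2Hom_apply, ← tripleHom_apply, e]
      simp only [map_sum, map_smul, LinearMap.sum_apply, LinearMap.smul_apply, smul_eq_mul,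
        Finset.mul_sum]
      refine Finset.sum_le_sum fun q _ => ?_
      have h3 := mul_le_mul_of_nonneg_left (h1 q) (hJ'.repr_nonneg (K.isNef_J r) q)
      rw [tripleHom_apply, chern2Hom_apply]
      linarith
    have h3 : ∑ s, ∑ t, A.triple (K.J r) (K.J s) (K.J t) ≤ A.triple (K.J r) B u := by
      rw [K.triple_eq_sum]
      refine Finset.sum_le_sum fun s _ => Finset.sum_le_sum fun t _ => ?_
      refine le_mul_of_one_le_left (hnn r s t) ?_
      nlinarith [hB1 s, hu1 t]
    have h4 : 0 ≤ ∑ s, ∑ t, A.triple (K.J r) (K.J s) (K.J t) :=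
      Finset.sum_nonneg fun s _ => Finset.sum_nonneg fun t _ => hnn r s t
    have hN3' : (3 : ℤ) ≤ N := by exact_mod_cast hN3
    nlinarith
  · intro hle
    obtain ⟨J, hJ, hJK⟩ := K.exists_isKahlerBasis
    refine ⟨J, hJ, 3, by simp, fun _ => 1, fun _ => le_rfl, fun r => ?_⟩
    simp_rw [hJK]
    have h1 : (3 * ∑ s, ∑ t, (A.triple (K.J r) (K.J s) (K.J t) : ℚ)) ≤ 2 * A.chern2 (K.J r) := by
      exact_mod_cast hle r
    push_cast
    simp only [mul_one]
    linarith

end KahlerBasis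

end ToricSpace

end ToricMonad

/-! ### Intersection numbers of the candidates, and the complete check of a space. -/

namespace ToricMonad

/-- The intersection numbers `d_{rst}`, the numbers `c_{2r}` and the Euler number of a Calabi-Yau
threefold. -/
structure FormData where
  t : List (List (List ℕ))
  c2 : List ℕ
  euler : ℤ

/-- The intersection numbers of the candidates, in the basis `nefClasses`. -/
def formData : ℕ → FormData
  | 1 => ⟨[[[5]]], [50], -200⟩
  | 2 => ⟨[[[2,4],[4,0]],[[4,0],[0,0]]], [44,24], -168⟩
  | 3 => ⟨[[[2,5],[5,5]],[[5,5],[5,5]]], [44,50], -176⟩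
  | 4 => ⟨[[[0,3],[3,5]],[[3,5],[5,5]]], [36,50], -168⟩
  | 5 => ⟨[[[0,3],[3,7]],[[3,7],[7,11]]], [36,62], -168⟩
  | 6 => ⟨[[[5,4],[4,0]],[[4,0],[0,0]]], [50,24], -168⟩
  | 7 => ⟨[[[0,3],[3,3]],[[3,3],[3,0]]], [36,36], -162⟩
  | 8 => ⟨[[[2,6],[6,12]],[[6,12],[12,24]]], [44,84], -200⟩
  | 9 => ⟨[[[0,3],[3,7]],[[3,7],[7,14]]], [36,68], -186⟩
  | 12 => ⟨[[[0,0,0],[0,4,3],[0,3,0]],[[0,4,3],[4,2,2],[3,2,0]],[[0,3,0],[3,2,0],[0,0,0]]], [24,44,24], -144⟩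
  | 17 => ⟨[[[0,0,0],[0,2,3],[0,3,0]],[[0,2,3],[2,0,3],[3,3,3]],[[0,3,0],[3,3,3],[0,3,0]]], [24,36,36], -144⟩
  | 22 => ⟨[[[0,0,0],[0,0,3],[0,3,4]],[[0,0,3],[0,0,0],[3,0,4]],[[0,3,4],[3,0,4],[4,4,5]]], [24,24,50], -138⟩
  | 24 => ⟨[[[0,0,0],[0,0,3],[0,3,4]],[[0,0,3],[0,0,3],[3,3,5]],[[0,3,4],[3,3,5],[4,5,5]]], [24,36,50], -150⟩
  | 25 => ⟨[[[0,0,0],[0,0,3],[0,3,4]],[[0,0,3],[0,0,0],[3,0,4]],[[0,3,4],[3,0,4],[4,4,8]]], [24,24,56], -156⟩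
  | 26 => ⟨[[[0,2,2],[2,0,3],[2,3,0]],[[2,0,3],[0,0,0],[3,0,0]],[[2,3,0],[3,0,0],[0,0,0]]], [36,24,24], -144⟩
  | 27 => ⟨[[[0,2,2],[2,2,4],[2,4,0]],[[2,2,4],[2,2,4],[4,4,0]],[[2,4,0],[4,4,0],[0,0,0]]], [36,44,24], -148⟩
  | 40 => ⟨[[[0,0,0,0],[0,0,2,2],[0,2,0,2],[0,2,2,0]],[[0,0,2,2],[0,0,0,0],[2,0,0,2],[2,0,2,0]],[[0,2,0,2],[2,0,0,2],[0,0,0,0],[2,2,0,0]],[[0,2,2,0],[2,0,2,0],[2,2,0,0],[0,0,0,0]]], [24,24,24,24], -128⟩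
  | 78 => ⟨[[[0,0,0,0],[0,0,2,2],[0,2,0,2],[0,2,2,0]],[[0,0,2,2],[0,0,2,2],[2,2,0,3],[2,2,3,0]],[[0,2,0,2],[2,2,0,3],[0,0,0,0],[2,3,0,0]],[[0,2,2,0],[2,2,3,0],[2,3,0,0],[0,0,0,0]]], [24,36,24,24], -128⟩
  | _ => ⟨[], [], 0⟩

/-- The numbers of the candidates. -/
def candidateNumbers : List ℕ := [1, 2, 3, 4, 5, 6, 7, 8, 9, 12, 17, 22, 24, 25, 26, 27, 40, 78]

/-- The numbers of the products of projective spaces. -/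
def productNumbers : List ℕ := [1, 2, 7, 26, 40]

/-- The number `d_{rst}`. -/
def FormData.d (D : FormData) (r s t : ℕ) : ℕ := lget 0 (lget [] (lget [] D.t r) s) t

/-- The intersection numbers are as given. -/
def formDataCheck (X ls J : List (List ℤ)) (D : FormData) : Bool :=
  let F := fanData X ls
  let h := X.length
  let f := pointForms h F J weightX
  let f2 := pointForms h F J weightChern2
  Nat.beq D.t.length h && Nat.beq D.c2.length h &&
  lall (fun r => lall (fun s => lall (fun t =>
    eqB (tripleSum f r s t) (Int.mul commonDenom (Int.ofNat (D.d r s t)))) (upTo h)) (upTo h)) (upTo h) &&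
  lall (fun r => eqB (coeffSum (mulCoord r f2)) (Int.mul commonDenom (Int.ofNat (lget 0 D.c2 r)))) (upTo h) &&
  eqB (coeffSum (pointForms h F J weightChern3)) (Int.mul commonDenom D.euler)

/-- The intersection numbers are nonnegative, and the bounds on `b_max` have no solution. -/
def noncandidateCheck (X ls J : List (List ℤ)) : Bool :=
  let F := fanData X ls
  let h := X.length
  let f := pointForms h F J weightX
  let f2 := pointForms h F J weightChern2
  -- Only index triples with `t ≤ s ≤ r` are tested; the others follow by symmetry.
  lall (fun r => lall (fun s => lall (fun t =>
    nonnegB (tripleSum f r s t)) (upTo (Nat.succ s))) (upTo (Nat.succ r))) (upTo h) &&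
  lany (fun r => posB (Int.sub
    (Int.mul 3 (lsum (lmap (fun s => lsum (lmap (fun t => tripleSum f r s t) (upTo h))) (upTo h))))
    (Int.mul 2 (coeffSum (mulCoord r f2))))) (upTo h)

/-- The check for the space number `n`. -/
def spaceCheck (n : ℕ) : Bool :=
  let X := (space n).rows
  let ls := relations n
  let J := nefClasses n
  if n ∈ nonsimpleNumbers then ToricSpace.nonsimpleCheck X ls J else
    simpleCheck X ls J && (if n ∈ productNumbers then true else ToricSpace.nonproductCheck X) &&
      if n ∈ candidateNumbers then formDataCheck X ls J (formData n) else noncandidateCheck X ls J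

end ToricMonad

namespace ToricMonad

/-! ### The search for monads -/

section Primitives

variable {α β : Type}

def dotN (x : List ℕ) : List ℕ → ℕ :=
  List.rec (fun _ => 0)
    (fun a _ ih y => List.rec 0 (fun b y' _ => Nat.add (Nat.mul a b) (ih y')) y) x

/-- Entrywise comparison. -/
def leB (x : List ℕ) : List ℕ → Bool :=
  List.rec (fun _ => true)
    (fun a _ ih y => List.rec false (fun b y' _ => Bool.rec false (ih y') (Nat.ble a b)) y) x

def addL (x : List ℕ) : List ℕ → List ℕ :=
  List.rec (fun _ => [])
    (fun a _ ih y => List.rec [] (fun b y' _ => Nat.add a b :: ih y') y) x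

def subL (x : List ℕ) : List ℕ → List ℕ :=
  List.rec (fun _ => [])
    (fun a _ ih y => List.rec [] (fun b y' _ => Nat.sub a b :: ih y') y) x

def smulL (n : ℕ) (x : List ℕ) : List ℕ := lmap (Nat.mul n) x

def predL (x : List ℕ) : List ℕ := lmap Nat.pred x

def constL (a n : ℕ) : List ℕ := Nat.rec [] (fun _ ih => a :: ih) n

def sumL (n : ℕ) (l : List (List ℕ)) : List ℕ := List.rec (constL 0 n) (fun x _ ih => addL x ih) l

def sumN (l : List ℕ) : ℕ := List.rec 0 (fun a _ ih => Nat.add a ih) l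

def lenN (l : List α) : ℕ := List.rec 0 (fun _ _ ih => Nat.succ ih) l

def lbind (f : α → List β) (l : List α) : List β := List.rec [] (fun a _ ih => lappend (f a) ih) l

def nodupB (l : List ℕ) : Bool :=
  List.rec true (fun a k ih => Bool.rec ih false (lany (Nat.beq a) k)) l

/-- The number with given digits. -/
def digits (x : List ℕ) : ℕ := List.rec 0 (fun a _ ih => Nat.add a (Nat.mul 32 ih)) x

/-- The list `[n, …, 0]`. -/
def downFrom (n : ℕ) : List ℕ := Nat.rec [0] (fun k ih => Nat.succ k :: ih) n

/-- The vectors that are at most `w`, in descending lexicographic order. -/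
def box (w : List ℕ) : List (List ℕ) :=
  List.rec [[]] (fun a _ ih => lbind (fun i => lmap (i :: ·) ih) (downFrom a)) w

end Primitives

/-- A vector to be used in a decomposition, and what it stands for. -/
abbrev Part (α : Type) : Type := List ℕ × α

section Search

variable {α : Type}

/-- Sorting parts by the number of leading zeros, which are dropped. -/
def groups (k : ℕ) : List (Part α) → List (List (Part α)) :=
  Nat.rec (fun _ => [])
    (fun _ ih P => lfilter (fun p => Nat.blt 0 (p.1.headD 0)) P ::
      ih (lmap (fun p => (p.1.tail, p.2)) (lfilter (fun p => Nat.beq (p.1.headD 0) 0) P))) k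

/-- All ways to subtract parts from the group `g` until the first entry of `S` is zero, each continued
by `next`. -/
def reduceHead (next : List ℕ → List α → List (List α)) (g : List (Part α)) :
    ℕ → List ℕ → List α → List (List α) :=
  List.rec (fun _ S acc => Bool.rec [] (next S.tail acc) (Nat.beq (S.headD 0) 0))
    -- The number `n` is fuel, initially the first entry of `S`. Using `p` lowers that entry, since
    -- first entries of parts in a group are positive, and keeps `p` available for repetition;
    -- skipping `p` is permanent, so multisets are produced in a single order.
    (fun p _ ih n => Nat.rec
      (fun S acc => Bool.rec (ih 0 S acc) (next S.tail acc) (Nat.beq (S.headD 0) 0))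
      (fun n' ih' S acc => Bool.rec
        (lappend (Bool.rec [] (ih' (subL S p.1) (p.2 :: acc)) (leB p.1 S)) (ih (Nat.succ n') S acc))
        (next S.tail acc) (Nat.beq (S.headD 0) 0)) n) g

/-- All ways to write the first entries of `S` as a sum of parts, where the remaining entries of `S` are
upper bounds. -/
def decompositions (gs : List (List (Part α))) : List ℕ → List α → List (List α) :=
  List.rec (fun _ acc => [acc])
    (fun g _ ih S acc => reduceHead ih g (S.headD 0) S acc) gs

end Search

/-- `∑ s t, d_{rst} x_s y_t`, for all `r`. -/
def quad (t : List (List (List ℕ))) (x y : List ℕ) : List ℕ :=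
  lmap (fun A => dotN x (lmap (fun row => dotN row y) A)) t

/-- The multidegrees of `B` and `C`. -/
abbrev Pair : Type := List (List ℕ) × List (List ℕ)

namespace FormData

variable (D : FormData) (h N : ℕ)

/-- The right side `2 c₂ - N e u` of the anomaly bound in terms of distances from `u`, with `e` the
sum of the Kähler generators. The truncated subtraction does no harm, because the left side is
nonnegative. -/
def slack (u : List ℕ) : List ℕ :=
  subL (smulL 2 D.c2) (smulL N (quad D.t (constL 1 h) u))

/-- The summands of `B` and `C` other than the supremum `u` of `B`, with their distance from `u` and their
contribution to the anomaly. -/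
def parts (u : List ℕ) : List (Part (Bool × List ℕ)) :=
  lbind (fun v => lappend
      (let c := addL u v
       let s := quad D.t (predL c) v
       Bool.rec [] [(lappend v s, (true, c))] (leB s (D.slack h N u)))
      (Bool.rec [] (let b := subL u v
        let s := quad D.t (predL b) v
        Bool.rec [] [(lappend v s, (false, b))] (leB s (D.slack h N u))) (leB v (predL u))))
    (lfilter (fun v => not (Nat.beq (sumN v) 0)) (box (smulL N u)))

/-- The pair with the given summands other than `u`. -/
def complete (u : List ℕ) (o : List (Bool × List ℕ)) : Pair :=
  let B := lmap Prod.snd (lfilter (fun p => not p.1) o)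
  let C := lmap Prod.snd (lfilter (fun p => p.1) o)
  let nB := lenN B
  let nC := Nat.add (lenN C) N
  -- The class `u` cannot occur in both `B` and `C`, so the rank condition forces its
  -- multiplicities; truncated subtraction puts the missing copies on the correct side.
  (lappend (Nat.rec [] (fun _ ih => u :: ih) (Nat.sub nC nB)) B,
   lappend (Nat.rec [] (fun _ ih => u :: ih) (Nat.sub nB nC)) C)

def eqL (x y : List ℕ) : Bool := leB x y && leB y x

/-- `u` is the supremum of `B`. -/
def isSup (u : List ℕ) (B : List (List ℕ)) : Bool :=
  lall (fun b => leB b u) B &&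
  lall (fun i => lany (fun b => Nat.beq (lget 0 b i) (lget 0 u i)) B) (upTo h)

/-- The conditions on a positive monad. -/
def isMonad (u : List ℕ) (V : Pair) : Bool :=
  lall (fun b => Nat.beq b.length h && leB (constL 1 h) b && leB b u) V.1 &&
  lall (fun c => Nat.beq c.length h && leB u c) V.2 &&
  not (lany (eqL u) V.1 && lany (eqL u) V.2) &&
  Nat.beq (lenN V.1) (Nat.add (lenN V.2) N) &&
  eqL (sumL h V.1) (sumL h V.2) &&
  leB (sumL h (lmap (fun c => quad D.t c c) V.2))
    (addL (sumL h (lmap (fun b => quad D.t b b) V.1)) (smulL 2 D.c2))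

def permL (σ x : List ℕ) : List ℕ := lmap (lget 0 x) σ

/-- A number assigned to a pair that does not depend on the order of the summands. -/
def hash (V : Pair) : ℕ :=
  let f := fun x => let e := Nat.add 3 (digits x)
    Nat.mod (Nat.mul e (Nat.mul e e)) 1000003
  Nat.add (sumN (lmap f V.1)) (Nat.mul 1009 (sumN (lmap f V.2)))

def permPair (σ : List ℕ) (V : Pair) : Pair := (lmap (permL σ) V.1, lmap (permL σ) V.2)

/-- The pair is distinguished among those obtained by permutations of the coordinates. -/
def isCanonical (G : List (List ℕ)) (u : List ℕ) (V : Pair) : Bool :=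
  lall (fun σ => not (Nat.beq (digits (permL σ u)) (digits u)) ||
    Nat.ble (hash V) (hash (permPair σ V))) G

/-- The possible suprema of `B`, with entries at most `k + 1`. -/
def suprema (G : List (List ℕ)) (k : ℕ) : List (List ℕ) :=
  lfilter (fun u => leB (smulL N (quad D.t (constL 1 h) u)) (smulL 2 D.c2) &&
      lall (fun σ => Nat.ble (digits u) (digits (permL σ u))) G)
    (lmap (lmap Nat.succ) (box (constL k h)))

/-- Each result of the search is tested again for all conditions, so soundness does not depend on
the search; only its completeness has to be proved. -/
def monadsWithSup (G : List (List ℕ)) (u : List ℕ) : List Pair :=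
  lfilter (fun V => isSup h u V.1 && isCanonical G u V && D.isMonad h N u V)
    (lmap (complete N u) (decompositions (groups h (D.parts h N u))
      (lappend (smulL N u) (D.slack h N u)) []))

/-- The distinguished monads. -/
def monads (G : List (List ℕ)) (k : ℕ) : List Pair :=
  lbind (D.monadsWithSup h N G) (D.suprema h N G k)

/-- No entry of the supremum of `B` exceeds `k + 1`. -/
def boundCheck (k : ℕ) : Bool :=
  lall (fun s => lany (fun r => Nat.blt (lget 0 D.c2 r * 2) (N * (lget 0 (quad D.t (constL 1 h)
    (constL 1 h)) r + sumN (lmap (fun q => D.d r q s) (upTo h)) * (k + 1)))) (upTo h)) (upTo h)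

def cubic (l : List (List ℕ)) : ℕ := sumN (lmap (fun x => dotN x (quad D.t x x)) l)

/-- The index is one sixth of the difference of the cubic sums, hence equals `3 k` if and only if
that difference is `18 k`. Here `m` is its absolute value, as a sum of two truncated differences of
which one is zero. -/
def isThreeFamily (V : Pair) : Bool :=
  let m := Nat.add (Nat.sub (D.cubic V.1) (D.cubic V.2)) (Nat.sub (D.cubic V.2) (D.cubic V.1))
  Nat.blt 0 m && Nat.beq (Nat.mod m 18) 0 && Nat.beq (Nat.mod D.euler.natAbs (Nat.div m 18)) 0

/-- The numbers of the distinguished monads, and of those with the three-family constraint. -/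
def monadCheck (G : List (List ℕ)) (k m m3 : ℕ) : Bool :=
  let Vs := D.monads h N G k
  -- Distinct hashes certify that the listed pairs are pairwise different up to order; a collision
  -- could only make the check fail.
  D.boundCheck h N k && Nat.beq (lenN Vs) m && nodupB (lmap hash Vs) &&
    Nat.beq (lenN (lfilter D.isThreeFamily Vs)) m3

end FormData

/-- The permutations of the coordinates given by exchanges of projective space factors. -/
def exchanges : ℕ → List (List ℕ)
  | 7 => [[0, 1], [1, 0]]
  | 26 => [[0, 1, 2], [0, 2, 1]]
  | 40 => [[0, 1, 2, 3], [0, 1, 3, 2], [0, 2, 1, 3], [0, 2, 3, 1], [0, 3, 1, 2], [0, 3, 2, 1],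
      [1, 0, 2, 3], [1, 0, 3, 2], [1, 2, 0, 3], [1, 2, 3, 0], [1, 3, 0, 2], [1, 3, 2, 0],
      [2, 0, 1, 3], [2, 0, 3, 1], [2, 1, 0, 3], [2, 1, 3, 0], [2, 3, 0, 1], [2, 3, 1, 0],
      [3, 0, 1, 2], [3, 0, 2, 1], [3, 1, 0, 2], [3, 1, 2, 0], [3, 2, 0, 1], [3, 2, 1, 0]]
  | n => [List.range (space n).h]

end ToricMonad

/-! ### Correctness of the vector operations used by the search. -/

namespace ToricMonad

section Primitives

variable {α β : Type} {n : ℕ}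

theorem forall_list_of_ofFn {P : List α → Prop} {n : ℕ} (h : ∀ f : Fin n → α, P (List.ofFn f))
    (l : List α) (hl : l.length = n) : P l := by
  subst hl
  rw [← List.ofFn_get l]
  exact h _

theorem dotN_nil (l : List ℕ) : dotN l [] = 0 := by cases l <;> rfl

theorem dotN_cons_cons (a b : ℕ) (x y : List ℕ) : dotN (a :: x) (b :: y) = a * b + dotN x y := rfl

theorem dotN_ofFn_left (f : Fin n → ℕ) (y : List ℕ) :
    dotN (List.ofFn f) y = ∑ i, f i * y.getD i 0 := by
  induction n generalizing y with
  | zero => simp [dotN]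
  | succ n ih =>
    rw [List.ofFn_succ, Fin.sum_univ_succ]
    cases y with
    | nil => rw [dotN_nil]; simp
    | cons b y => rw [dotN_cons_cons, ih]; simp

theorem dotN_ofFn_right (x : List ℕ) (f : Fin n → ℕ) :
    dotN x (List.ofFn f) = ∑ i : Fin n, x.getD i 0 * f i := by
  induction n generalizing x with
  | zero => simp [dotN_nil]
  | succ n ih =>
    rw [List.ofFn_succ, Fin.sum_univ_succ]
    cases x with
    | nil => simp [dotN]
    | cons b y => rw [dotN_cons_cons, ih]; simp

theorem leB_cons_cons (a b : ℕ) (x y : List ℕ) :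
    leB (a :: x) (b :: y) = Bool.rec false (leB x y) (Nat.ble a b) := rfl

theorem leB_iff {x y : List ℕ} : leB x y = true ↔
    x.length ≤ y.length ∧ ∀ i < x.length, x.getD i 0 ≤ y.getD i 0 := by
  induction x generalizing y with
  | nil => simp [leB]
  | cons a x ih =>
    cases y with
    | nil => simp [leB]
    | cons b y =>
      rw [leB_cons_cons]
      by_cases h : a ≤ b
      · rw [Nat.ble_eq_true_of_le h, ih]
        simp only [List.length_cons, Nat.add_le_add_iff_right]
        refine and_congr_right fun _ => ⟨fun h' i hi => ?_, fun h' i hi => ?_⟩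
        · cases i with
          | zero => exact h
          | succ i => exact h' i (by omega)
        · exact h' (i + 1) (by omega)
      · have h' : Nat.ble a b = false := by rw [← Bool.not_eq_true, Nat.ble_eq]; exact h
        rw [h']
        refine iff_of_false (by simp) fun hcon => h (hcon.2 0 (by simp))

theorem leB_ofFn (f g : Fin n → ℕ) :
    leB (List.ofFn f) (List.ofFn g) = true ↔ ∀ i, f i ≤ g i := by
  rw [leB_iff]
  simp only [List.length_ofFn, le_refl, true_and]
  refine ⟨fun h i => ?_, fun h i hi => ?_⟩
  · have := h i i.2
    rwa [getD_ofFn, getD_ofFn] at this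
  · have := h ⟨i, hi⟩
    rwa [← getD_ofFn f 0, ← getD_ofFn g 0] at this

theorem addL_ofFn (f g : Fin n → ℕ) :
    addL (List.ofFn f) (List.ofFn g) = List.ofFn fun i => f i + g i := by
  induction n with
  | zero => simp [addL]
  | succ n ih =>
    simp only [List.ofFn_succ]
    exact congrArg _ (ih _ _)

theorem subL_ofFn (f g : Fin n → ℕ) :
    subL (List.ofFn f) (List.ofFn g) = List.ofFn fun i => f i - g i := by
  induction n with
  | zero => simp [subL]
  | succ n ih =>
    simp only [List.ofFn_succ]
    exact congrArg _ (ih _ _)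

theorem smulL_ofFn (k : ℕ) (f : Fin n → ℕ) :
    smulL k (List.ofFn f) = List.ofFn fun i => k * f i := by
  rw [smulL, lmap_eq, List.map_ofFn]
  rfl

theorem predL_ofFn (f : Fin n → ℕ) : predL (List.ofFn f) = List.ofFn fun i => f i - 1 := by
  rw [predL, lmap_eq, List.map_ofFn]
  rfl

theorem constL_eq_ofFn (a n : ℕ) : constL a n = List.ofFn fun _ : Fin n => a := by
  induction n with
  | zero => simp [constL]
  | succ n ih =>
    rw [List.ofFn_succ, ← ih]
    rfl

@[simp] theorem sumN_eq (l : List ℕ) : sumN l = l.sum := by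
  induction l with
  | nil => rfl
  | cons a l ih => exact congrArg (a + ·) ih

@[simp] theorem lenN_eq (l : List α) : lenN l = l.length := by
  induction l with
  | nil => rfl
  | cons a l ih => exact congrArg Nat.succ ih

@[simp] theorem lbind_eq (f : α → List β) (l : List α) : lbind f l = l.flatMap f := by
  induction l with
  | nil => rfl
  | cons a l ih =>
    rw [List.flatMap_cons, ← ih, ← lappend_eq]
    rfl

theorem nodup_of_nodupB {l : List ℕ} (h : nodupB l = true) : l.Nodup := by
  induction l with
  | nil => simp
  | cons a l ih =>
    have e : nodupB (a :: l) = Bool.rec (nodupB l) false (lany (Nat.beq a) l) := rfl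
    rw [e] at h
    cases h' : lany (Nat.beq a) l with
    | true => rw [h'] at h; simp at h
    | false =>
      rw [h'] at h
      refine List.nodup_cons.mpr ⟨fun hmem => ?_, ih h⟩
      rw [← Bool.not_eq_true, lany_iff] at h'
      exact h' ⟨a, hmem, by simp⟩

theorem sumL_ofFn (l : List (Fin n → ℕ)) :
    sumL n (l.map List.ofFn) = List.ofFn fun i => (l.map fun x => x i).sum := by
  induction l with
  | nil => exact constL_eq_ofFn 0 n
  | cons x l ih =>
    have e : sumL n ((x :: l).map List.ofFn) = addL (List.ofFn x) (sumL n (l.map List.ofFn)) := rfl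
    rw [e, ih, addL_ofFn]
    simp

theorem downFrom_succ (n : ℕ) : downFrom (n + 1) = (n + 1) :: downFrom n := rfl

theorem mem_downFrom {i n : ℕ} : i ∈ downFrom n ↔ i ≤ n := by
  induction n with
  | zero => simp [downFrom]
  | succ n ih => rw [downFrom_succ, List.mem_cons, ih]; omega

theorem box_cons (a : ℕ) (w : List ℕ) :
    box (a :: w) = (downFrom a).flatMap fun i => (box w).map (i :: ·) := by
  rw [← lbind_eq]
  simp only [← lmap_eq]
  rfl

theorem mem_box_ofFn {f g : Fin n → ℕ} (h : ∀ i, f i ≤ g i) :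
    List.ofFn f ∈ box (List.ofFn g) := by
  induction n with
  | zero => simp [box]
  | succ n ih =>
    rw [List.ofFn_succ, List.ofFn_succ, box_cons, List.mem_flatMap]
    exact ⟨f 0, mem_downFrom.mpr (h 0), List.mem_map.mpr ⟨_, ih fun i => h i.succ, rfl⟩⟩

end Primitives

/-! ### Completeness of the decomposition search. -/

section Search

variable {α : Type}

theorem length_subL {x y : List ℕ} (h : x.length = y.length) : (subL x y).length = x.length := by
  induction x generalizing y with
  | nil => simp [subL]
  | cons a x ih => cases y with
    | nil => simp at h
    | cons b y =>
      exact congrArg Nat.succ (ih (by simpa using h))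

theorem getD_subL {x y : List ℕ} (h : x.length = y.length) (i : ℕ) :
    (subL x y).getD i 0 = x.getD i 0 - y.getD i 0 := by
  induction x generalizing y i with
  | nil => cases y with
    | nil => simp [subL]
    | cons b y => simp at h
  | cons a x ih => cases y with
    | nil => simp at h
    | cons b y => cases i with
      | zero => rfl
      | succ i => exact ih (by simpa using h) i

theorem headD_eq_getD (l : List ℕ) : l.headD 0 = l.getD 0 0 := by cases l <;> rfl

theorem getD_tail (l : List ℕ) (i : ℕ) : l.tail.getD i 0 = l.getD (i + 1) 0 := by cases l <;> rfl

/-- Given a multiset `m` of parts of the group that exhausts the first entry of `S`, the search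
follows `m`: it uses a part as long as one remains and skips it afterwards. At the end it calls
`next` on the remaining entries of `S` with all of `m` collected. The predicate `R` transports what
is known about the later stages. -/
theorem exists_mem_reduceHead {next : List ℕ → List α → List (List α)} {R : List α → Prop} {L : ℕ}
    {g : List (Part α)} {m : Multiset (Part α)} {n : ℕ} {S : List ℕ} {acc : List α}
    (hm : ∀ p ∈ m, p ∈ g) (hlen : ∀ p ∈ m, p.1.length = L + 1) (hpos : ∀ p ∈ m, 0 < p.1.getD 0 0)
    (hS : S.length = L + 1) (hn : S.getD 0 0 ≤ n)
    (hsum : (m.map fun p => p.1.getD 0 0).sum = S.getD 0 0)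
    (hle : ∀ i, (m.map fun p => p.1.getD i 0).sum ≤ S.getD i 0)
    (hnext : ∀ S' : List ℕ, ∀ acc' : List α, S'.length = L →
      (∀ i, S'.getD i 0 + (m.map fun p => p.1.getD (i + 1) 0).sum = S.getD (i + 1) 0) →
      (acc' : Multiset α) = acc + m.map Prod.snd → ∃ o ∈ next S' acc', R o) :
    ∃ o ∈ reduceHead next g n S acc, R o := by
  -- Since every part has a positive first entry, a vanishing first entry of `S` means that no part
  -- is left.
  have hdone : S.getD 0 0 = 0 → Nat.beq (S.headD 0) 0 = true ∧ ∃ o ∈ next S.tail acc, R o := by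
    intro h0
    have hm0 : m = 0 := by
      by_contra hne
      obtain ⟨p, hp⟩ := Multiset.exists_mem_of_ne_zero hne
      have h1 := Multiset.single_le_sum (fun _ _ => Nat.zero_le _) _
        (Multiset.mem_map_of_mem (fun p : Part α => p.1.getD 0 0) hp)
      rw [hsum, h0] at h1
      exact absurd (hpos p hp) (by omega)
    refine ⟨by rw [headD_eq_getD, h0]; rfl, hnext _ _ (by simp [hS]) (fun i => ?_) ?_⟩
    · rw [hm0, getD_tail]; simp
    · rw [hm0]; simp
  have hnot : S.getD 0 0 ≠ 0 → Nat.beq (S.headD 0) 0 = false := fun h0 => by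
    rw [headD_eq_getD, ← Bool.not_eq_true, Nat.beq_eq]; exact h0
  induction g generalizing m n S acc with
  | nil =>
    by_cases h0 : S.getD 0 0 = 0
    · have e : reduceHead next [] n S acc = Bool.rec [] (next S.tail acc) (Nat.beq (S.headD 0) 0) :=
        rfl
      rw [e, (hdone h0).1]
      exact (hdone h0).2
    · exfalso
      apply h0
      have hm0 : m = 0 := Multiset.eq_zero_of_forall_notMem fun p hp => by simpa using hm p hp
      rw [← hsum, hm0]
      simp
  | cons p g ih =>
    induction n generalizing m S acc with
    | zero =>
      have h0 : S.getD 0 0 = 0 := by omega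
      have e : reduceHead next (p :: g) 0 S acc =
        Bool.rec (reduceHead next g 0 S acc) (next S.tail acc) (Nat.beq (S.headD 0) 0) := rfl
      rw [e, (hdone h0).1]
      exact (hdone h0).2
    | succ n ihn =>
      have e : reduceHead next (p :: g) (n + 1) S acc = Bool.rec
        (lappend (Bool.rec [] (reduceHead next (p :: g) n (subL S p.1) (p.2 :: acc)) (leB p.1 S))
          (reduceHead next g (n + 1) S acc))
        (next S.tail acc) (Nat.beq (S.headD 0) 0) := rfl
      rw [e]
      by_cases h0 : S.getD 0 0 = 0
      · rw [(hdone h0).1]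
        exact (hdone h0).2
      rw [hnot h0]
      simp only [lappend_eq, List.mem_append]
      by_cases hp : p ∈ m
      -- One copy of `p` is subtracted from `S` and from `m`; the fuel decreases, but `p` stays in
      -- the group for its further copies.
      · obtain ⟨m', rfl⟩ := Multiset.exists_cons_of_mem hp
        simp only [Multiset.map_cons, Multiset.sum_cons] at hsum hle
        have hpl : S.length = p.1.length := by rw [hS, hlen p hp]
        have hleB : leB p.1 S = true := leB_iff.mpr ⟨hpl.ge, fun i _ => by have := hle i; omega⟩
        have hp0 := hpos p hp
        obtain ⟨o, ho, hR⟩ := ihn (m := m') (S := subL S p.1) (acc := p.2 :: acc)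
          (fun q hq => hm q (Multiset.mem_cons_of_mem hq))
          (fun q hq => hlen q (Multiset.mem_cons_of_mem hq))
          (fun q hq => hpos q (Multiset.mem_cons_of_mem hq))
          (by rw [length_subL hpl, hS]) (by rw [getD_subL hpl]; omega)
          (by rw [getD_subL hpl]; omega) (fun i => by rw [getD_subL hpl]; have := hle i; omega)
          (fun S' acc' hS' hsum' hacc => hnext S' acc' hS' (fun i => by
              have h1 := hsum' i
              have h2 := hle (i + 1)
              rw [getD_subL hpl] at h1
              rw [Multiset.map_cons, Multiset.sum_cons]
              omega) (by
              rw [hacc, Multiset.map_cons, ← Multiset.cons_coe, Multiset.cons_add,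
                Multiset.add_cons]))
          (by
            intro h0'
            have hm0 : m' = 0 := by
              by_contra hne
              obtain ⟨q, hq⟩ := Multiset.exists_mem_of_ne_zero hne
              have h1 := Multiset.single_le_sum (fun _ _ => Nat.zero_le _) _
                (Multiset.mem_map_of_mem (fun p : Part α => p.1.getD 0 0) hq)
              rw [getD_subL hpl] at h0'
              have := hpos q (Multiset.mem_cons_of_mem hq)
              omega
            subst hm0
            refine ⟨by rw [headD_eq_getD, h0']; rfl, hnext _ _ (by
              rw [List.length_tail, length_subL hpl, hS]; rfl) (fun i => ?_) ?_⟩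
            · rw [getD_tail, getD_subL hpl]
              have := hle (i + 1)
              simp at this ⊢
              omega
            · simp
              rw [add_comm]
              rfl)
          (fun h0 => by rw [headD_eq_getD, ← Bool.not_eq_true, Nat.beq_eq]; exact h0)
        rw [hleB]
        exact ⟨o, Or.inl ho, hR⟩
      · obtain ⟨o, ho, hR⟩ := ih (m := m) (n := n + 1) (S := S) (acc := acc)
          (fun q hq => by
            rcases List.mem_cons.mp (hm q hq) with rfl | h
            · exact absurd hq hp
            · exact h) hlen hpos hS hn hsum hle hnext hdone hnot
        exact ⟨o, Or.inr ho, hR⟩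

theorem groups_succ (k : ℕ) (P : List (Part α)) : groups (k + 1) P =
    P.filter (fun p => Nat.blt 0 (p.1.headD 0)) ::
      groups k ((P.filter fun p => Nat.beq (p.1.headD 0) 0).map fun p => (p.1.tail, p.2)) := by
  rw [← lfilter_eq, ← lfilter_eq, ← lmap_eq]
  rfl

/-- Parts are consumed according to their first nonzero coordinate. Once those with a nonzero entry
in the first coordinate have been used, that coordinate is finished, and the others are treated with
it deleted. Entries beyond the first `k` are only upper bounds. -/
theorem exists_mem_decompositions {k L : ℕ} {P : List (Part α)} {m : Multiset (Part α)}
    {S : List ℕ} {acc : List α} (hm : ∀ p ∈ m, p ∈ P) (hlen : ∀ p ∈ m, p.1.length = L)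
    (hS : S.length = L) (hk : k ≤ L) (hne : ∀ p ∈ m, ∃ i < k, p.1.getD i 0 ≠ 0)
    (hsum : ∀ i < k, (m.map fun p => p.1.getD i 0).sum = S.getD i 0)
    (hle : ∀ i, (m.map fun p => p.1.getD i 0).sum ≤ S.getD i 0) :
    ∃ o ∈ decompositions (groups k P) S acc, (o : Multiset α) = acc + m.map Prod.snd := by
  induction k generalizing L P m S acc with
  | zero =>
    have hm0 : m = 0 := Multiset.eq_zero_of_forall_notMem fun p hp => by
      obtain ⟨i, hi, -⟩ := hne p hp
      omega
    exact ⟨acc, by simp [decompositions, groups], by simp [hm0]⟩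
  | succ k ih =>
    obtain ⟨L, rfl⟩ : ∃ L', L = L' + 1 := ⟨L - 1, by omega⟩
    rw [groups_succ]
    set P' := (P.filter fun p => Nat.beq (p.1.headD 0) 0).map fun p => (p.1.tail, p.2) with hP'
    have e : ∀ G : List (Part α), decompositions (G :: groups k P') S acc =
      reduceHead (decompositions (groups k P')) G (S.headD 0) S acc := fun _ => rfl
    rw [e]
    -- The multiset splits into the parts for the present coordinate and those with leading entry
    -- zero, which go to the recursive call.
    have hsplit : ∀ f : Part α → ℕ, ((m.filter fun p => 0 < p.1.getD 0 0).map f).sum +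
        ((m.filter fun p => ¬ 0 < p.1.getD 0 0).map f).sum = (m.map f).sum := fun f => by
      rw [← Multiset.sum_add, ← Multiset.map_add, Multiset.filter_add_not]
    have hzero : ((m.filter fun p => ¬ 0 < p.1.getD 0 0).map fun p => p.1.getD 0 0).sum = 0 := by
      refine Multiset.sum_eq_zero fun x hx => ?_
      obtain ⟨p, hp, rfl⟩ := Multiset.mem_map.mp hx
      have := (Multiset.mem_filter.mp hp).2
      omega
    refine exists_mem_reduceHead (L := L) (m := m.filter fun p => 0 < p.1.getD 0 0)
      (fun p hp => ?_) (fun p hp => hlen p (Multiset.mem_filter.mp hp).1)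
      (fun p hp => (Multiset.mem_filter.mp hp).2) hS (by rw [headD_eq_getD]) ?_ (fun i => ?_) ?_
    · rw [Multiset.mem_filter] at hp
      rw [List.mem_filter, Nat.blt_eq, headD_eq_getD]
      exact ⟨hm p hp.1, hp.2⟩
    · have := hsplit fun p => p.1.getD 0 0
      rw [hsum 0 (by omega), hzero] at this
      simpa using this
    · have := hsplit fun p => p.1.getD i 0
      have := hle i
      omega
    · intro S' acc' hS' hsum' hacc
      have hmap : ∀ i, ((((m.filter fun p => ¬ 0 < p.1.getD 0 0).map fun p : Part α =>
          ((p.1.tail, p.2) : Part α)).map fun p => p.1.getD i 0).sum) =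
          ((m.filter fun p => ¬ 0 < p.1.getD 0 0).map fun p => p.1.getD (i + 1) 0).sum := by
        intro i
        rw [Multiset.map_map]
        simp only [Function.comp_apply, getD_tail]
      obtain ⟨o, ho, hR⟩ := ih (L := L) (P := P') (S := S') (acc := acc')
        (m := (m.filter fun p => ¬ 0 < p.1.getD 0 0).map fun p => (p.1.tail, p.2))
        (by
          intro q hq
          obtain ⟨p, hp, rfl⟩ := Multiset.mem_map.mp hq
          rw [Multiset.mem_filter] at hp
          refine List.mem_map.mpr ⟨p, List.mem_filter.mpr ⟨hm p hp.1, ?_⟩, rfl⟩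
          rw [Nat.beq_eq, headD_eq_getD]
          omega)
        (by
          intro q hq
          obtain ⟨p, hp, rfl⟩ := Multiset.mem_map.mp hq
          rw [List.length_tail, hlen p (Multiset.mem_filter.mp hp).1]
          rfl)
        hS' (by omega)
        (by
          intro q hq
          obtain ⟨p, hp, rfl⟩ := Multiset.mem_map.mp hq
          rw [Multiset.mem_filter] at hp
          obtain ⟨i, hi, h⟩ := hne p hp.1
          cases i with
          | zero => omega
          | succ i => exact ⟨i, by omega, by rw [getD_tail]; exact h⟩)
        (by
          intro i hi
          have h1 := hsplit fun p => p.1.getD (i + 1) 0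
          have h2 := hsum (i + 1) (by omega)
          have h3 := hsum' i
          rw [hmap]
          omega)
        (by
          intro i
          have h1 := hsplit fun p => p.1.getD (i + 1) 0
          have h2 := hle (i + 1)
          have h3 := hsum' i
          rw [hmap]
          omega)
      refine ⟨o, ho, ?_⟩
      rw [hR, hacc, Multiset.map_map, add_assoc]
      congr 1
      have : (Prod.snd ∘ fun p : Part α => ((p.1.tail, p.2) : Part α)) = Prod.snd := rfl
      rw [this, ← Multiset.map_add, Multiset.filter_add_not]

end Search

end ToricMonad

/-! ### Monads in Kähler coordinates. -/

namespace ToricMonad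

namespace ToricSpace

variable {A : ToricSpace}

namespace KahlerBasis

/-- The intersection numbers in the basis of the Kähler cone are as given. -/
structure HasForm (K : KahlerBasis A) (D : FormData) : Prop where
  t_length : D.t.length = A.h
  c2_length : D.c2.length = A.h
  -- The first index of `d` is the argument that `quad` leaves open.
  triple_J : ∀ r s t, A.triple (K.J s) (K.J t) (K.J r) = D.d r s t
  chern2_J : ∀ r : Fin A.h, A.chern2 (K.J r) = D.c2.getD r 0
  euler : A.eulerNumber = D.euler

variable (K : KahlerBasis A) {D : FormData}

/-! ### Classes as lists of coordinates -/

/-- The list of the coordinates of a class in the Kähler cone. -/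
def code (x : A.Pic) : List ℕ := List.ofFn fun i => (K.coord x i).toNat

def decode (l : List ℕ) : A.Pic := K.coord.symm fun i => (l.getD i 0 : ℤ)

/-- The class lies in the closed Kähler cone. -/
def Nonneg (x : A.Pic) : Prop := ∀ i, 0 ≤ K.coord x i

/-- The sum of the generators of the Kähler cone. -/
def ones : A.Pic := K.coord.symm fun _ => 1

variable {K} {x y : A.Pic}

@[simp] theorem coord_ones (i : Fin A.h) : K.coord K.ones i = 1 := by
  rw [ones, LinearEquiv.apply_symm_apply]

@[simp] theorem coord_decode (l : List ℕ) (i : Fin A.h) : K.coord (K.decode l) i = l.getD i 0 := by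
  rw [decode, LinearEquiv.apply_symm_apply]

theorem coord_ext (h : ∀ i, K.coord x i = K.coord y i) : x = y := K.coord.injective (funext h)

theorem nonneg_ones : K.Nonneg K.ones := fun i => by simp

theorem nonneg_decode (l : List ℕ) : K.Nonneg (K.decode l) := fun i => by simp

theorem Nonneg.add (hx : K.Nonneg x) (hy : K.Nonneg y) : K.Nonneg (x + y) := fun i => by
  rw [map_add]
  exact add_nonneg (hx i) (hy i)

@[simp] theorem length_code : (K.code x).length = A.h := List.length_ofFn

theorem decode_code (hx : K.Nonneg x) : K.decode (K.code x) = x := by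
  refine coord_ext (K := K) fun i => ?_
  rw [coord_decode, code, getD_ofFn, Int.toNat_of_nonneg (hx i)]

theorem code_decode {l : List ℕ} (hl : l.length = A.h) : K.code (K.decode l) = l := by
  revert hl
  refine forall_list_of_ofFn (P := fun l => K.code (K.decode l) = l) (fun f => ?_) l
  rw [code]
  congr 1
  ext i
  rw [coord_decode, getD_ofFn, Int.toNat_natCast]

theorem addL_code (hx : K.Nonneg x) (hy : K.Nonneg y) :
    addL (K.code x) (K.code y) = K.code (x + y) := by
  rw [code, code, addL_ofFn, code]
  congr 1
  ext i
  rw [map_add, Pi.add_apply, Int.toNat_add (hx i) (hy i)]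

theorem subL_code (hy : K.Nonneg y) : subL (K.code x) (K.code y) = K.code (x - y) := by
  rw [code, code, subL_ofFn, code]
  congr 1
  ext i
  have := hy i
  rw [map_sub, Pi.sub_apply]
  omega

theorem predL_code : predL (K.code x) = K.code (x - K.ones) := by
  rw [code, predL_ofFn, code]
  congr 1
  ext i
  rw [map_sub, Pi.sub_apply, coord_ones]
  omega

theorem smulL_code (hx : K.Nonneg x) (n : ℕ) : smulL n (K.code x) = K.code (n • x) := by
  rw [code, smulL_ofFn, code]
  congr 1
  ext i
  rw [map_nsmul, Pi.smul_apply, nsmul_eq_mul, Int.toNat_mul (by positivity) (hx i), Int.toNat_natCast]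

theorem constL_eq_code : constL 1 A.h = K.code K.ones := by
  rw [constL_eq_ofFn, code]
  simp

theorem leB_code (hx : K.Nonneg x) (hy : K.Nonneg y) :
    leB (K.code x) (K.code y) = true ↔ ∀ i, K.coord x i ≤ K.coord y i := by
  rw [code, code, leB_ofFn]
  exact forall_congr' fun i => by have := hx i; have := hy i; omega

theorem nonneg_sum {l : List A.Pic} (hl : ∀ x ∈ l, K.Nonneg x) : K.Nonneg l.sum := by
  induction l with
  | nil => intro i; simp
  | cons x l ih =>
    rw [List.sum_cons]
    exact (hl x (by simp)).add (ih fun y hy => hl y (by simp [hy]))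

theorem sumL_code {l : List A.Pic} (hl : ∀ x ∈ l, K.Nonneg x) :
    sumL A.h (l.map K.code) = K.code l.sum := by
  have e : l.map K.code = (l.map fun x i => (K.coord x i).toNat).map List.ofFn := by
    rw [List.map_map]
    rfl
  rw [e, sumL_ofFn, code]
  congr 1
  ext i
  rw [List.map_map]
  induction l with
  | nil => simp
  | cons x l ih =>
    have hl' : ∀ y ∈ l, K.Nonneg y := fun y hy => hl y (by simp [hy])
    rw [List.map_cons, List.sum_cons, ih hl' (by rw [List.map_map]; rfl), List.sum_cons, map_add, Pi.add_apply,
      Int.toNat_add (hl x (by simp) i) (nonneg_sum hl' i)]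
    rfl

variable (K) in
/-- The curve class dual to the product of two divisor classes. -/
noncomputable def formCode (x y : A.Pic) : List ℕ := List.ofFn fun r => (A.triple x y (K.J r)).toNat

theorem triple_eq_sum_left (x y z : A.Pic) : A.triple x y z =
    ∑ s, ∑ t, K.coord x s * K.coord y t * A.triple (K.J s) (K.J t) z := by
  conv_lhs => rw [K.eq_sum x, K.eq_sum y]
  simp only [← tripleHom_apply, map_sum, map_smul, LinearMap.sum_apply, LinearMap.smul_apply,
    smul_eq_mul, Finset.mul_sum]
  rw [Finset.sum_comm]
  exact Finset.sum_congr rfl fun s _ => Finset.sum_congr rfl fun t _ => by ring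

theorem HasForm.triple_J_nonneg (hD : K.HasForm D) (r s t : Fin A.h) :
    0 ≤ A.triple (K.J r) (K.J s) (K.J t) := by
  rw [hD.triple_J]
  positivity

theorem triple_nonneg (hnn : ∀ r s t, 0 ≤ A.triple (K.J r) (K.J s) (K.J t)) (hx : K.Nonneg x)
    (hy : K.Nonneg y) (r : Fin A.h) : 0 ≤ A.triple x y (K.J r) := by
  rw [K.triple_eq_sum_left]
  exact Finset.sum_nonneg fun s _ => Finset.sum_nonneg fun t _ =>
    mul_nonneg (mul_nonneg (hx s) (hy t)) (hnn s t r)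

theorem HasForm.quad_code (hD : K.HasForm D) (hx : K.Nonneg x) (hy : K.Nonneg y) :
    quad D.t (K.code x) (K.code y) = K.formCode x y := by
  have e : D.t = List.ofFn fun r : Fin A.h => D.t.getD r [] := by
    have := hD.t_length
    refine List.ext_getElem (by simp [this]) fun i h1 h2 => ?_
    rw [List.getElem_ofFn, List.getD_eq_getElem _ _ h1]
  rw [quad, lmap_eq, e, List.map_ofFn, formCode]
  congr 1
  ext r
  have h1 : (A.triple x y (K.J r)).toNat = ∑ s, ∑ t, (K.coord x s).toNat * (K.coord y t).toNat *
      D.d r s t := by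
    have h2 : A.triple x y (K.J r) = ((∑ s, ∑ t, (K.coord x s).toNat * (K.coord y t).toNat *
        D.d r s t : ℕ) : ℤ) := by
      push_cast
      rw [K.triple_eq_sum_left]
      refine Finset.sum_congr rfl fun s _ => Finset.sum_congr rfl fun t _ => ?_
      rw [hD.triple_J, Int.toNat_of_nonneg (hx s), Int.toNat_of_nonneg (hy t)]
    rw [h2, Int.toNat_natCast]
  rw [h1, Function.comp_apply, code, dotN_ofFn_left]
  refine Finset.sum_congr rfl fun s _ => ?_
  rw [lmap_eq, code]
  have h3 : ∀ row : List ℕ, dotN row (List.ofFn fun i => (K.coord y i).toNat) =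
      ∑ t : Fin A.h, row.getD t 0 * (K.coord y t).toNat := fun row => dotN_ofFn_right _ _
  have h4 : ∀ M : List (List ℕ), (M.map fun row => dotN row (List.ofFn fun i =>
      (K.coord y i).toNat)).getD s 0 = ∑ t : Fin A.h, (M.getD s []).getD t 0 * (K.coord y t).toNat := by
    intro M
    by_cases hs : (s : ℕ) < M.length
    · rw [getD_map_of_lt 0 [] hs, h3]
    · rw [List.getD_eq_default _ _ (by simpa using hs), List.getD_eq_default _ _ (by simpa using hs)]
      simp
  rw [h4, Finset.mul_sum]
  refine Finset.sum_congr rfl fun t _ => ?_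
  simp only [FormData.d, lget_eq]
  ring

/-! ### Positivity in coordinates -/

theorem sum_tripleHom (m : Multiset A.Pic) (L : A.Pic) :
    (m.map fun c => A.triple c c L).sum = (m.map fun c => A.tripleHom c c).sum L := by
  induction m using Multiset.induction_on with
  | empty => simp
  | cons a m ih => simp [ih, tripleHom_apply]

/-- The Kähler cone is the open positive orthant of the coordinates, so integral Kähler classes have
coordinates at least `1`. The anomaly condition is linear in the nef class `L` and need only be
imposed on the generators. -/
theorem isPositiveMonad_iff {V : A.MonadData} {N : ℕ} : V.IsPositiveMonad N ↔
    Multiset.card V.B = Multiset.card V.C + N ∧ (∀ b ∈ V.B, ∀ i, 1 ≤ K.coord b i) ∧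
    (∀ c ∈ V.C, ∀ i, 1 ≤ K.coord c i) ∧ (∀ b ∈ V.B, ∀ c ∈ V.C, ∀ i, K.coord b i ≤ K.coord c i) ∧
    (∀ b ∈ V.B, ∀ c ∈ V.C, b ≠ c) ∧ V.B.sum = V.C.sum ∧
    ∀ r, (V.C.map fun c => A.triple c c (K.J r)).sum ≤
      (V.B.map fun b => A.triple b b (K.J r)).sum + 2 * A.chern2 (K.J r) := by
  have hle : ∀ L, V.chern2 L ≤ (A.chern2 L : ℚ) ↔ (V.C.map fun c => A.triple c c L).sum ≤
      (V.B.map fun b => A.triple b b L).sum + 2 * A.chern2 L := by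
    intro L
    rw [MonadData.chern2, div_le_iff₀ (by norm_num)]
    norm_cast
    omega
  constructor
  · intro h
    refine ⟨h.rank_eq, fun b hb => (K.isKahler_iff b).mp (h.pos_B b hb),
      fun c hc => (K.isKahler_iff c).mp (h.pos_C c hc), fun b hb c hc i => ?_, h.nontrivial,
      h.chern1_eq_zero, fun r => (hle _).mp (h.anomaly _ (K.isNef_J r))⟩
    have := (K.isNef_iff _).mp (h.bundle b hb c hc) i
    rw [map_sub, Pi.sub_apply] at this
    omega
  · rintro ⟨h1, h2, h3, h4, h5, h6, h7⟩
    refine ⟨h1, fun b hb => (K.isKahler_iff b).mpr (h2 b hb),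
      fun c hc => (K.isKahler_iff c).mpr (h3 c hc), fun b hb c hc => ?_, h5, h6, fun L hL => ?_⟩
    · rw [K.isNef_iff]
      intro i
      rw [map_sub, Pi.sub_apply]
      exact sub_nonneg.mpr (h4 b hb c hc i)
    · rw [hle]
      rw [K.isNef_iff] at hL
      rw [sum_tripleHom, sum_tripleHom, ← chern2Hom_apply, K.eq_sum L]
      simp only [map_sum, map_smul, smul_eq_mul, Finset.mul_sum]
      rw [← Finset.sum_add_distrib]
      refine Finset.sum_le_sum fun r _ => ?_
      have := mul_le_mul_of_nonneg_left (h7 r) (hL r)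
      rw [sum_tripleHom, sum_tripleHom, ← chern2Hom_apply] at this
      linarith

end KahlerBasis

end ToricSpace

end ToricMonad

/-! ### Distances from the supremum of `B` and completeness of the search for monads. -/

namespace ToricMonad

theorem cast_sum_toNat {α : Type*} {m : Multiset α} {f : α → ℤ} (hf : ∀ x ∈ m, 0 ≤ f x) :
    (((m.map fun x => (f x).toNat).sum : ℕ) : ℤ) = (m.map f).sum := by
  induction m using Multiset.induction_on with
  | empty => simp
  | cons a m ih =>
    have h1 := ih fun x hx => hf x (Multiset.mem_cons_of_mem hx)
    have h2 := Int.toNat_of_nonneg (hf a (Multiset.mem_cons_self a m))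
    rw [Multiset.map_cons, Multiset.sum_cons, Multiset.map_cons, Multiset.sum_cons, Nat.cast_add, h1, h2]

theorem sum_filter_ne {α : Type*} [DecidableEq α] {m : Multiset α} {u : α} {f : α → ℤ}
    (hf : f u = 0) : ((m.filter (· ≠ u)).map f).sum = (m.map f).sum := by
  induction m using Multiset.induction_on with
  | empty => simp
  | cons a m ih =>
    by_cases h : a = u
    · subst h
      simp [hf, ih]
    · simp [h, ih]

namespace ToricSpace

variable {A : ToricSpace}

namespace KahlerBasis

variable {K : KahlerBasis A} {D : FormData}

/-! ### Completeness of the search -/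

section Excess

variable {B C : Multiset A.Pic} {N : ℕ}

/-- The sums of `B` and `C` cancel, and `u` is counted `card B - card C = N` times. -/
theorem sum_sub_add_sum_sub (hcard : Multiset.card B = Multiset.card C + N) (hsum : B.sum = C.sum)
    (g : A.Pic →ₗ[ℤ] ℤ) (u : A.Pic) :
    (B.map fun b => g (u - b)).sum + (C.map fun c => g (c - u)).sum = N * g u := by
  have h1 : (B.map g).sum = (C.map g).sum := by
    rw [← map_multiset_sum, ← map_multiset_sum, hsum]
  simp only [map_sub, Multiset.sum_map_sub, Multiset.map_const', Multiset.sum_replicate, hcard,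
    nsmul_eq_mul]
  rw [show (B.map fun b => g b) = B.map g from rfl, show (C.map fun b => g b) = C.map g from rfl, h1]
  push_cast
  ring

/-- Expanding the products, the terms linear in `b` and `c` cancel since `B` and `C` have the same
sum, and the constant term `- e u` occurs `N` times. For `e ≤ b ≤ u ≤ c` the left side is a sum of
nonnegative terms, and so the anomaly bound can prune summand by summand. -/
theorem sum_excess (hcard : Multiset.card B = Multiset.card C + N) (hsum : B.sum = C.sum)
    (e u z : A.Pic) : (B.map fun b => A.triple (b - e) (u - b) z).sum +
      (C.map fun c => A.triple (c - e) (c - u) z).sum = (C.map fun c => A.triple c c z).sum -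
      (B.map fun b => A.triple b b z).sum - N * A.triple e u z := by
  set g1 : A.Pic →ₗ[ℤ] ℤ := (A.tripleHom.flip u).flip z
  set g2 : A.Pic →ₗ[ℤ] ℤ := (A.tripleHom e).flip z
  have hb : ∀ b, A.triple (b - e) (u - b) z = g1 b - A.triple b b z - g2 (u - b) := fun b => by
    simp only [g1, g2, LinearMap.flip_apply, ← tripleHom_apply, map_sub, LinearMap.sub_apply]
    ring
  have hc : ∀ c, A.triple (c - e) (c - u) z = A.triple c c z - g1 c - g2 (c - u) := fun c => by
    simp only [g1, g2, LinearMap.flip_apply, ← tripleHom_apply, map_sub, LinearMap.sub_apply]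
    ring
  have h1 : (B.map fun b => g1 b).sum = (C.map fun c => g1 c).sum := by
    rw [← map_multiset_sum, ← map_multiset_sum, hsum]
  have h2 := sum_sub_add_sum_sub hcard hsum g2 u
  have h3 : g2 u = A.triple e u z := rfl
  simp only [hb, hc, Multiset.sum_map_sub]
  rw [h1, ← h3]
  linarith

end Excess

theorem Nonneg.sub (h : ∀ i, K.coord y i ≤ K.coord x i) : K.Nonneg (x - y) := fun i => by
  rw [map_sub, Pi.sub_apply]
  exact sub_nonneg.mpr (h i)

theorem nonneg_of_one_le (h : ∀ i, 1 ≤ K.coord x i) : K.Nonneg x := fun i => by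
  have := h i
  omega

theorem sum_code_ne_zero (hx : K.Nonneg x) (h0 : x ≠ 0) : (K.code x).sum ≠ 0 := by
  intro h
  apply h0
  rw [code, List.sum_ofFn, Finset.sum_eq_zero_iff] at h
  refine coord_ext (K := K) fun i => ?_
  have h1 := h i (Finset.mem_univ i)
  have h2 := hx i
  rw [map_zero, Pi.zero_apply]
  omega

theorem mem_box_code (h : ∀ i, K.coord x i ≤ K.coord y i) : K.code x ∈ box (K.code y) :=
  mem_box_ofFn fun i => Int.toNat_le_toNat (h i)

variable {N : ℕ} {u : A.Pic}

theorem HasForm.c2_eq (hD : K.HasForm D) : D.c2 = List.ofFn fun r : Fin A.h => D.c2.getD r 0 := by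
  have := hD.c2_length
  refine List.ext_getElem (by simp [this]) fun i h1 h2 => ?_
  rw [List.getElem_ofFn, List.getD_eq_getElem _ _ h1]

theorem HasForm.slack_code (hD : K.HasForm D) (hu : K.Nonneg u) : D.slack A.h N (K.code u) =
    List.ofFn fun r : Fin A.h => 2 * D.c2.getD r 0 - N * (A.triple K.ones u (K.J r)).toNat := by
  rw [FormData.slack, constL_eq_code, hD.quad_code nonneg_ones hu, formCode, smulL_ofFn]
  conv_lhs => rw [hD.c2_eq]
  rw [smulL_ofFn, subL_ofFn]

variable (K) in
/-- The part for a summand `b` of `B`. -/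
noncomputable def partB (u b : A.Pic) : Part (Bool × List ℕ) :=
  (K.code (u - b) ++ K.formCode (b - K.ones) (u - b), (false, K.code b))

variable (K) in
/-- The part for a summand `c` of `C`. -/
noncomputable def partC (u c : A.Pic) : Part (Bool × List ℕ) :=
  (K.code (c - u) ++ K.formCode (c - K.ones) (c - u), (true, K.code c))

theorem HasForm.partB_mem (hD : K.HasForm D) (hN : 1 ≤ N) {b : A.Pic} (hb : ∀ i, 1 ≤ K.coord b i)
    (hbu : ∀ i, K.coord b i ≤ K.coord u i) (hne : b ≠ u)
    (hs : ∀ r : Fin A.h, (A.triple (b - K.ones) (u - b) (K.J r)).toNat ≤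
      2 * D.c2.getD r 0 - N * (A.triple K.ones u (K.J r)).toNat) :
    K.partB u b ∈ D.parts A.h N (K.code u) := by
  have hu : K.Nonneg u := fun i => by have := hb i; have := hbu i; omega
  have hb0 := nonneg_of_one_le hb
  have hv : K.Nonneg (u - b) := .sub hbu
  have hb1 : K.Nonneg (b - K.ones) := .sub fun i => by rw [coord_ones]; exact hb i
  have e1 : subL (K.code u) (K.code (u - b)) = K.code b := by
    rw [subL_code hv, sub_sub_cancel]
  have hle : leB (K.code (u - b)) (predL (K.code u)) = true := by
    rw [predL_code, leB_code hv (.sub fun i => by rw [coord_ones]; have := hb i; have := hbu i; omega)]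
    intro i
    have := hb i
    simp only [map_sub, Pi.sub_apply, coord_ones]
    omega
  have hslack : leB (K.formCode (b - K.ones) (u - b)) (D.slack A.h N (K.code u)) = true := by
    rw [hD.slack_code hu, formCode, leB_ofFn]
    exact hs
  rw [FormData.parts, lbind_eq, List.mem_flatMap]
  refine ⟨K.code (u - b), ?_, ?_⟩
  · rw [lfilter_eq, List.mem_filter, smulL_code hu]
    refine ⟨mem_box_code fun i => ?_, ?_⟩
    · have := hb i
      have := hu i
      have hN' : (1 : ℤ) ≤ N := by exact_mod_cast hN
      rw [map_sub, Pi.sub_apply, map_nsmul, Pi.smul_apply, nsmul_eq_mul]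
      nlinarith
    · rw [sumN_eq, Bool.not_eq_true', ← Bool.not_eq_true, Nat.beq_eq]
      exact sum_code_ne_zero hv (sub_ne_zero.mpr hne.symm)
  · rw [lappend_eq, List.mem_append]
    right
    rw [hle]
    simp only
    rw [e1, predL_code, hD.quad_code hb1 hv, hslack, lappend_eq]
    exact List.mem_singleton.mpr rfl

theorem HasForm.partC_mem (hD : K.HasForm D) {c : A.Pic} (hu : ∀ i, 1 ≤ K.coord u i)
    (huc : ∀ i, K.coord u i ≤ K.coord c i) (hne : c ≠ u)
    (hN : ∀ i, K.coord (c - u) i ≤ N * K.coord u i)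
    (hs : ∀ r : Fin A.h, (A.triple (c - K.ones) (c - u) (K.J r)).toNat ≤
      2 * D.c2.getD r 0 - N * (A.triple K.ones u (K.J r)).toNat) :
    K.partC u c ∈ D.parts A.h N (K.code u) := by
  have hu0 := nonneg_of_one_le hu
  have hv : K.Nonneg (c - u) := .sub huc
  have hc1 : K.Nonneg (c - K.ones) := .sub fun i => by
    rw [coord_ones]; have := hu i; have := huc i; omega
  have e1 : addL (K.code u) (K.code (c - u)) = K.code c := by
    rw [addL_code hu0 hv, add_sub_cancel]
  have hslack : leB (K.formCode (c - K.ones) (c - u)) (D.slack A.h N (K.code u)) = true := by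
    rw [hD.slack_code hu0, formCode, leB_ofFn]
    exact hs
  rw [FormData.parts, lbind_eq, List.mem_flatMap]
  refine ⟨K.code (c - u), ?_, ?_⟩
  · rw [lfilter_eq, List.mem_filter, smulL_code hu0]
    refine ⟨mem_box_code fun i => ?_, ?_⟩
    · rw [map_nsmul, Pi.smul_apply, nsmul_eq_mul]
      exact hN i
    · rw [sumN_eq, Bool.not_eq_true', ← Bool.not_eq_true, Nat.beq_eq]
      exact sum_code_ne_zero hv (sub_ne_zero.mpr hne)
  · rw [lappend_eq, List.mem_append]
    left
    simp only
    rw [e1, predL_code, hD.quad_code hc1 hv, hslack, lappend_eq]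
    exact List.mem_singleton.mpr rfl

/-- `u` is the supremum of the classes `B`. -/
def IsSup (K : KahlerBasis A) (u : A.Pic) (B : Multiset A.Pic) : Prop :=
  (∀ b ∈ B, ∀ i, K.coord b i ≤ K.coord u i) ∧ ∀ i, ∃ b ∈ B, K.coord b i = K.coord u i

theorem le_sum_map {α : Type*} {m : Multiset α} {f : α → ℤ} (hf : ∀ x ∈ m, 0 ≤ f x) {a : α} (ha : a ∈ m) :
    f a ≤ (m.map f).sum :=
  Multiset.single_le_sum (fun x hx => by
    obtain ⟨y, hy, rfl⟩ := Multiset.mem_map.mp hx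
    exact hf y hy) _ (Multiset.mem_map_of_mem f ha)

theorem sum_map_nonneg {α : Type*} {m : Multiset α} {f : α → ℤ} (hf : ∀ x ∈ m, 0 ≤ f x) :
    0 ≤ (m.map f).sum :=
  Multiset.sum_nonneg fun x hx => by
    obtain ⟨y, hy, rfl⟩ := Multiset.mem_map.mp hx
    exact hf y hy

/-- The inequality satisfied by the supremum of `B`. -/
theorem excess_le {V : A.MonadData} (hV : V.IsPositiveMonad N)
    (r : Fin A.h) : (V.B.map fun b => A.triple (b - K.ones) (u - b) (K.J r)).sum +
      (V.C.map fun c => A.triple (c - K.ones) (c - u) (K.J r)).sum ≤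
        2 * A.chern2 (K.J r) - N * A.triple K.ones u (K.J r) := by
  obtain ⟨h1, h2, h3, h4, h5, h6, h7⟩ := (isPositiveMonad_iff (K := K)).mp hV
  rw [sum_excess h1 h6]
  have := h7 r
  linarith

theorem IsSup.le_C {V : A.MonadData} (hV : V.IsPositiveMonad N) (hu : K.IsSup u V.B) {c : A.Pic}
    (hc : c ∈ V.C) (i : Fin A.h) : K.coord u i ≤ K.coord c i := by
  obtain ⟨b, hb, h⟩ := hu.2 i
  rw [← h]
  exact ((isPositiveMonad_iff (K := K)).mp hV).2.2.2.1 b hb c hc i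

theorem IsSup.one_le {V : A.MonadData} (hV : V.IsPositiveMonad N) (hu : K.IsSup u V.B)
    (i : Fin A.h) : 1 ≤ K.coord u i := by
  obtain ⟨b, hb, h⟩ := hu.2 i
  rw [← h]
  exact ((isPositiveMonad_iff (K := K)).mp hV).2.1 b hb i

open Classical in
-- The distances of the summands from `u`, extended by their contributions to the anomaly, form a
-- multiset of admissible parts: the first half of the entries adds up to `N u`, the second half
-- stays within the slack. Summands equal to `u` have distance zero and are left out.
theorem HasForm.exists_decomposition (hD : K.HasForm D) {V : A.MonadData} (hN : 1 ≤ N)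
    (hV : V.IsPositiveMonad N) (hu : K.IsSup u V.B) :
    ∃ o ∈ decompositions (groups A.h (D.parts A.h N (K.code u)))
        (lappend (smulL N (K.code u)) (D.slack A.h N (K.code u))) [],
      (o : Multiset (Bool × List ℕ)) =
        (V.B.filter (· ≠ u)).map (fun b => (false, K.code b)) +
          (V.C.filter (· ≠ u)).map fun c => (true, K.code c) := by
  have hex := excess_le (K := K) (u := u) hV
  simp only [hD.chern2_J] at hex
  obtain ⟨h1, h2, h3, h4, h5, h6, h7⟩ := (isPositiveMonad_iff (K := K)).mp hV
  have hu1 := hu.one_le hV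
  have hu0 := nonneg_of_one_le hu1
  have huc := fun c hc => hu.le_C hV (c := c) hc
  have hnB : ∀ r, ∀ b ∈ V.B, 0 ≤ A.triple (b - K.ones) (u - b) (K.J r) := fun r b hb =>
    triple_nonneg hD.triple_J_nonneg (.sub fun i => by rw [coord_ones]; exact h2 b hb i) (.sub (hu.1 b hb)) r
  have hnC : ∀ r, ∀ c ∈ V.C, 0 ≤ A.triple (c - K.ones) (c - u) (K.J r) := fun r c hc =>
    triple_nonneg hD.triple_J_nonneg (.sub fun i => by rw [coord_ones]; exact h3 c hc i) (.sub (huc c hc)) r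
  have hcB : ∀ i, ∀ b ∈ V.B, 0 ≤ K.coord (u - b) i := fun i b hb => Nonneg.sub (hu.1 b hb) i
  have hcC : ∀ i, ∀ c ∈ V.C, 0 ≤ K.coord (c - u) i := fun i c hc => Nonneg.sub (huc c hc) i
  have hcoord : ∀ i, (V.B.map fun b => K.coord (u - b) i).sum +
      (V.C.map fun c => K.coord (c - u) i).sum = N * K.coord u i := fun i =>
    sum_sub_add_sum_sub h1 h6 (LinearMap.proj i ∘ₗ K.coord.toLinearMap) u
  have hTu : ∀ r, 0 ≤ A.triple K.ones u (K.J r) := triple_nonneg hD.triple_J_nonneg nonneg_ones hu0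
  -- Passage to truncated subtraction: if the integral bound is negative, so is `t`, and its
  -- truncation is zero.
  have hslack : ∀ (r : Fin A.h) (t : ℤ), t ≤ 2 * D.c2.getD r 0 - N * A.triple K.ones u (K.J r) →
      t.toNat ≤ 2 * D.c2.getD r 0 - N * (A.triple K.ones u (K.J r)).toNat := by
    intro r t ht
    obtain ⟨k, hk⟩ := Int.eq_ofNat_of_zero_le (hTu r)
    rw [hk] at ht ⊢
    rw [Int.toNat_natCast]
    have e : (N : ℤ) * (k : ℤ) = ((N * k : ℕ) : ℤ) := by push_cast; rfl
    rw [e] at ht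
    omega
  set m : Multiset (Part (Bool × List ℕ)) := (V.B.filter (· ≠ u)).map (K.partB u) +
    (V.C.filter (· ≠ u)).map (K.partC u) with hm
  have hsum : ∀ f : Part (Bool × List ℕ) → ℕ, (m.map f).sum =
      ((V.B.filter (· ≠ u)).map fun b => f (K.partB u b)).sum +
        ((V.C.filter (· ≠ u)).map fun c => f (K.partC u c)).sum := fun f => by
    rw [hm, Multiset.map_add, Multiset.sum_add, Multiset.map_map, Multiset.map_map]
    rfl
  have hleft : ∀ i : Fin A.h, (m.map fun p => p.1.getD i 0).sum =
      (lappend (smulL N (K.code u)) (D.slack A.h N (K.code u))).getD i 0 := by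
    intro i
    have e1 : ∀ (x : A.Pic) (l : List ℕ), (K.code x ++ l).getD i 0 = (K.coord x i).toNat := fun x l => by
      rw [List.getD_append _ _ _ _ (by simp), code, getD_ofFn]
    rw [lappend_eq, smulL_code hu0, e1, hsum]
    simp only [partB, partC, e1]
    -- All terms are nonnegative, so the truncated sums are sums of integers. Summands equal to `u`
    -- contribute zero, so the filters can be dropped and the identity for the full sums applies.
    rw [← Nat.cast_inj (R := ℤ), Nat.cast_add,
      cast_sum_toNat fun b hb => hcB i b (Multiset.mem_filter.mp hb).1,
      cast_sum_toNat fun c hc => hcC i c (Multiset.mem_filter.mp hc).1,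
      sum_filter_ne (f := fun b => K.coord (u - b) i) (by simp),
      sum_filter_ne (f := fun b => K.coord (b - u) i) (by simp), hcoord, map_nsmul, Pi.smul_apply,
      nsmul_eq_mul, Int.toNat_of_nonneg (mul_nonneg (by positivity) (hu0 i))]
  have hright : ∀ i, (m.map fun p => p.1.getD (A.h + i) 0).sum ≤
      (lappend (smulL N (K.code u)) (D.slack A.h N (K.code u))).getD (A.h + i) 0 := by
    intro i
    have e1 : ∀ (x : A.Pic) (l : List ℕ), (K.code x ++ l).getD (A.h + i) 0 = l.getD i 0 := fun x l => by
      rw [List.getD_append_right _ _ _ _ (by simp), length_code, Nat.add_sub_cancel_left]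
    rw [lappend_eq, smulL_code hu0, e1, hsum]
    simp only [partB, partC, e1]
    by_cases hi : i < A.h
    · obtain ⟨r, rfl⟩ : ∃ r : Fin A.h, i = r := ⟨⟨i, hi⟩, rfl⟩
      rw [hD.slack_code hu0, getD_ofFn]
      simp only [formCode, getD_ofFn]
      refine le_trans (le_of_eq ?_) (hslack r _ (hex r))
      rw [← Nat.cast_inj (R := ℤ), Nat.cast_add,
        cast_sum_toNat fun b hb => hnB r b (Multiset.mem_filter.mp hb).1,
        cast_sum_toNat fun c hc => hnC r c (Multiset.mem_filter.mp hc).1,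
        sum_filter_ne (f := fun b => A.triple (b - K.ones) (u - b) (K.J r))
          (by rw [sub_self, ← tripleHom_apply]; simp),
        sum_filter_ne (f := fun c => A.triple (c - K.ones) (c - u) (K.J r))
          (by rw [sub_self, ← tripleHom_apply]; simp),
        Int.toNat_of_nonneg (add_nonneg (sum_map_nonneg (hnB r)) (sum_map_nonneg (hnC r)))]
    · have e2 : ∀ x y : A.Pic, (K.formCode x y).getD i 0 = 0 := fun x y =>
        List.getD_eq_default _ _ (by rw [formCode, List.length_ofFn]; omega)
      simp only [e2, Multiset.map_const', Multiset.sum_replicate, smul_zero, add_zero, Nat.zero_le]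
  obtain ⟨o, ho, hmo⟩ := exists_mem_decompositions (k := A.h) (L := A.h + A.h)
    (P := D.parts A.h N (K.code u)) (m := m)
    (S := lappend (smulL N (K.code u)) (D.slack A.h N (K.code u))) (acc := [])
    (by
      intro p hp
      rw [hm, Multiset.mem_add, Multiset.mem_map, Multiset.mem_map] at hp
      rcases hp with ⟨b, hb, rfl⟩ | ⟨c, hc, rfl⟩
      · rw [Multiset.mem_filter] at hb
        refine hD.partB_mem hN (h2 b hb.1) (hu.1 b hb.1) hb.2 fun r => hslack r _ ?_
        have := le_sum_map (hnB r) hb.1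
        have := sum_map_nonneg (hnC r)
        have := hex r
        linarith
      · rw [Multiset.mem_filter] at hc
        refine hD.partC_mem hu1 (huc c hc.1) hc.2 (fun i => ?_) fun r => hslack r _ ?_
        · have := le_sum_map (hcC i) hc.1
          have := sum_map_nonneg (hcB i)
          have := hcoord i
          linarith
        · have := le_sum_map (hnC r) hc.1
          have := sum_map_nonneg (hnB r)
          have := hex r
          linarith)
    (by
      intro p hp
      rw [hm, Multiset.mem_add, Multiset.mem_map, Multiset.mem_map] at hp
      rcases hp with ⟨b, hb, rfl⟩ | ⟨c, hc, rfl⟩ <;> simp [partB, partC, formCode])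
    (by rw [lappend_eq, List.length_append, smulL_code hu0, hD.slack_code hu0]; simp)
    (by omega)
    (by
      have hne : ∀ (x : A.Pic) (l : List ℕ), K.Nonneg x → x ≠ 0 →
          ∃ i < A.h, (K.code x ++ l).getD i 0 ≠ 0 := by
        intro x l hx h0
        by_contra! hcon
        apply h0
        refine coord_ext (K := K) fun i => ?_
        have := hcon i i.2
        rw [List.getD_append _ _ _ _ (by simp), code, getD_ofFn] at this
        have := hx i
        rw [map_zero, Pi.zero_apply]
        omega
      intro p hp
      rw [hm, Multiset.mem_add, Multiset.mem_map, Multiset.mem_map] at hp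
      rcases hp with ⟨b, hb, rfl⟩ | ⟨c, hc, rfl⟩
      · rw [Multiset.mem_filter] at hb
        exact hne _ _ (.sub (hu.1 b hb.1)) (sub_ne_zero.mpr hb.2.symm)
      · rw [Multiset.mem_filter] at hc
        exact hne _ _ (.sub (huc c hc.1)) (sub_ne_zero.mpr hc.2))
    (fun i hi => hleft ⟨i, hi⟩)
    (fun i => by
      by_cases hi : i < A.h
      · exact (hleft ⟨i, hi⟩).le
      · obtain ⟨j, rfl⟩ : ∃ j, i = A.h + j := ⟨i - A.h, by omega⟩
        exact hright j)
  refine ⟨o, ho, ?_⟩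
  rw [hmo, hm, Multiset.map_add, Multiset.map_map, Multiset.map_map]
  simp only [Multiset.coe_nil, zero_add]
  rfl

end KahlerBasis

end ToricSpace

end ToricMonad

namespace ToricMonad

namespace ToricSpace

variable {A : ToricSpace}

namespace KahlerBasis

variable {K : KahlerBasis A} {D : FormData} {N : ℕ} {u v : A.Pic}

/-! ### Suprema -/

theorem IsSup.unique {B : Multiset A.Pic} (hu : K.IsSup u B) (hv : K.IsSup v B) : u = v := by
  refine coord_ext (K := K) fun i => le_antisymm ?_ ?_
  · obtain ⟨b, hb, h⟩ := hu.2 i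
    rw [← h]
    exact hv.1 b hb i
  · obtain ⟨b, hb, h⟩ := hv.2 i
    rw [← h]
    exact hu.1 b hb i

open Classical in
variable (K) in
theorem exists_isSup {B : Multiset A.Pic} (hB : B ≠ 0) : ∃ u, K.IsSup u B := by
  have hne : B.toFinset.Nonempty := by
    rw [Finset.nonempty_iff_ne_empty, Ne, Multiset.toFinset_eq_empty]
    exact hB
  choose b hb hmax using fun i => Finset.exists_max_image B.toFinset (fun b => K.coord b i) hne
  refine ⟨K.coord.symm fun i => K.coord (b i) i, fun c hc i => ?_, fun i => ⟨b i, ?_, ?_⟩⟩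
  · rw [LinearEquiv.apply_symm_apply]
    exact hmax i c (Multiset.mem_toFinset.mpr hc)
  · exact Multiset.mem_toFinset.mp (hb i)
  · rw [LinearEquiv.apply_symm_apply]

theorem IsSup.nonneg {B : Multiset A.Pic} (hu : K.IsSup u B) (hB : ∀ b ∈ B, K.Nonneg b) :
    K.Nonneg u := fun i => by
  obtain ⟨b, hb, h⟩ := hu.2 i
  rw [← h]
  exact hB b hb i

theorem exists_isSup_of_isPositiveMonad (K : KahlerBasis A) {V : A.MonadData} (hN : 1 ≤ N)
    (hV : V.IsPositiveMonad N) : ∃ u, K.IsSup u V.B :=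
  K.exists_isSup fun h => by
    have := hV.rank_eq
    rw [h, Multiset.card_zero] at this
    omega

/-- Dropping the nonnegative terms from the excess inequality leaves a bound on `u` alone. -/
theorem mul_triple_ones_le (hnn : ∀ r s t, 0 ≤ A.triple (K.J r) (K.J s) (K.J t)) {V : A.MonadData}
    (hV : V.IsPositiveMonad N) (hu : K.IsSup u V.B) (r : Fin A.h) :
    N * A.triple K.ones u (K.J r) ≤ 2 * A.chern2 (K.J r) := by
  obtain ⟨h1, h2, h3, h4, h5, h6, h7⟩ := (isPositiveMonad_iff (K := K)).mp hV
  have := excess_le (K := K) (u := u) hV r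
  have := sum_map_nonneg (m := V.B) (f := fun b => A.triple (b - K.ones) (u - b) (K.J r)) fun b hb =>
    triple_nonneg hnn (.sub fun i => by rw [coord_ones]; exact h2 b hb i) (.sub (hu.1 b hb)) r
  have := sum_map_nonneg (m := V.C) (f := fun c => A.triple (c - K.ones) (c - u) (K.J r)) fun c hc =>
    triple_nonneg hnn (.sub fun i => by rw [coord_ones]; exact h3 c hc i)
      (.sub fun i => hu.le_C hV hc i) r
  linarith

theorem ones_eq_sum : K.ones = ∑ i, K.J i := by
  rw [ones, coord_symm_apply]
  simp

theorem triple_ones (x y : A.Pic) : A.triple K.ones x y = ∑ s, A.triple (K.J s) x y := by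
  rw [ones_eq_sum]
  simp only [← tripleHom_apply, map_sum, LinearMap.sum_apply]

theorem triple_mid_ones (x y : A.Pic) : A.triple x K.ones y = ∑ s, A.triple x (K.J s) y := by
  rw [ones_eq_sum]
  simp only [← tripleHom_apply, map_sum, LinearMap.sum_apply]

theorem triple_mid_add (x y y' z : A.Pic) :
    A.triple x (y + y') z = A.triple x y z + A.triple x y' z := by
  simp only [← tripleHom_apply, map_add, LinearMap.add_apply]

/-- A positive monad exists only on a candidate. -/
theorem isCandidate_of_isPositiveMonad (hnn : ∀ r s t, 0 ≤ A.triple (K.J r) (K.J s) (K.J t))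
    (hsymm : ∀ x y z, A.triple x y z = A.triple y z x)
    {V : A.MonadData} (hN : 3 ≤ N) (hV : V.IsPositiveMonad N) : A.IsCandidate := by
  rw [K.isCandidate_iff hnn]
  intro r
  obtain ⟨u, hu⟩ := K.exists_isSup_of_isPositiveMonad (by omega) hV
  have h1 := mul_triple_ones_le hnn hV hu r
  -- As `u - e` is nef for `e = K.ones`, replacing `u` by `e` only weakens the bound, and this
  -- yields the candidate inequality.
  have h2 : A.triple K.ones u (K.J r) =
      A.triple K.ones K.ones (K.J r) + A.triple K.ones (u - K.ones) (K.J r) := by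
    rw [← triple_mid_add, add_sub_cancel]
  have h3 := triple_nonneg hnn nonneg_ones
    (.sub (x := u) (y := K.ones) fun i => by rw [coord_ones]; exact hu.one_le hV i) r
  have h4 : A.triple K.ones K.ones (K.J r) = ∑ s, ∑ t, A.triple (K.J r) (K.J s) (K.J t) := by
    rw [triple_ones]
    refine Finset.sum_congr rfl fun s _ => ?_
    rw [triple_mid_ones]
    exact Finset.sum_congr rfl fun t _ => by rw [hsymm (K.J r)]
  have h5 := triple_nonneg hnn nonneg_ones (nonneg_ones (K := K)) r
  have hN' : (3 : ℤ) ≤ N := by exact_mod_cast hN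
  rw [← h4]
  nlinarith

/-! ### The conditions on a monad -/

theorem exists_mem_list_map {α β : Type*} {f : α → β} {l : List α} {P : β → Prop} :
    (∃ y ∈ l.map f, P y) ↔ ∃ x ∈ l, P (f x) := by simp

theorem coe_filter_bool {α : Type*} (l : List α) (p : α → Bool) :
    ((l.filter p : List α) : Multiset α) = (l : Multiset α).filter (fun x => p x = true) := by
  rw [Multiset.filter_coe]
  simp

theorem sum_map_range {R : Type*} [AddCommMonoid R] (n : ℕ) (f : ℕ → R) : ((List.range n).map f).sum = ∑ i : Fin n, f i := by
  rw [Fin.sum_univ_eq_sum_range]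
  rfl

theorem getD_code (x : A.Pic) (i : Fin A.h) : (K.code x).getD i 0 = (K.coord x i).toNat := by
  rw [code, getD_ofFn]

theorem eqL_code {x y : A.Pic} (hx : K.Nonneg x) (hy : K.Nonneg y) :
    FormData.eqL (K.code x) (K.code y) = true ↔ x = y := by
  rw [FormData.eqL, Bool.and_eq_true, leB_code hx hy, leB_code hy hx]
  exact ⟨fun h => coord_ext (K := K) fun i => le_antisymm (h.1 i) (h.2 i), fun h => by simp [h]⟩

theorem isSup_code {B : List A.Pic} (hu : K.Nonneg u) (hB : ∀ b ∈ B, K.Nonneg b) :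
    FormData.isSup A.h (K.code u) (B.map K.code) = true ↔ K.IsSup u B := by
  rw [FormData.isSup, Bool.and_eq_true, IsSup]
  simp only [lall_iff, lany_iff, List.forall_mem_map, exists_mem_list_map, Multiset.mem_coe, upTo_eq,
    List.mem_range, lget_eq, Nat.beq_eq]
  refine and_congr (forall₂_congr fun b hb => leB_code (hB b hb) hu) ⟨fun h i => ?_, fun h i hi => ?_⟩
  · obtain ⟨b, hb, h⟩ := h i i.2
    rw [getD_code, getD_code] at h
    have := hB b hb i
    have := hu i
    exact ⟨b, hb, by omega⟩
  · obtain ⟨b, hb, h⟩ := h ⟨i, hi⟩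
    refine ⟨b, hb, ?_⟩
    rw [show i = ((⟨i, hi⟩ : Fin A.h) : ℕ) from rfl, getD_code, getD_code, h]

theorem HasForm.sumL_quad (hD : K.HasForm D) {C : List A.Pic} (hC : ∀ c ∈ C, K.Nonneg c) :
    sumL A.h (lmap (fun c => quad D.t c c) (C.map K.code)) =
      List.ofFn fun r => (C.map fun c => (A.triple c c (K.J r)).toNat).sum := by
  have e : lmap (fun c => quad D.t c c) (C.map K.code) =
      (C.map fun c r => (A.triple c c (K.J r)).toNat).map List.ofFn := by
    rw [lmap_eq, List.map_map, List.map_map]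
    exact List.map_congr_left fun c hc => hD.quad_code (hC c hc) (hC c hc)
  rw [e, sumL_ofFn]
  simp only [List.map_map]
  rfl

theorem cast_list_sum_toNat {α : Type*} {l : List α} {f : α → ℤ} (hf : ∀ x ∈ l, 0 ≤ f x) :
    (((l.map fun x => (f x).toNat).sum : ℕ) : ℤ) = ((l : Multiset α).map f).sum := by
  have := cast_sum_toNat (m := (l : Multiset α)) hf
  simpa using this

/-- The conditions on all pairs `b`, `c` are tested against `u` alone: `b ≤ c` for all `b` amounts
to `u ≤ c`, and a class common to `B` and `C` lies below and above `u`, hence equals `u`. -/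
theorem HasForm.isMonad_code (hD : K.HasForm D) {B C : List A.Pic} (hu : K.IsSup u B)
    (hB : ∀ b ∈ B, K.Nonneg b) (hC : ∀ c ∈ C, K.Nonneg c) :
    D.isMonad A.h N (K.code u) (B.map K.code, C.map K.code) = true ↔
      (⟨B, C⟩ : A.MonadData).IsPositiveMonad N := by
  have hu0 : K.Nonneg u := hu.nonneg hB
  have hanomaly : leB (sumL A.h (lmap (fun c => quad D.t c c) (C.map K.code)))
      (addL (sumL A.h (lmap (fun b => quad D.t b b) (B.map K.code))) (smulL 2 D.c2)) = true ↔
      ∀ r, ((C : Multiset A.Pic).map fun c => A.triple c c (K.J r)).sum ≤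
        ((B : Multiset A.Pic).map fun b => A.triple b b (K.J r)).sum + 2 * A.chern2 (K.J r) := by
    rw [hD.sumL_quad hC, hD.sumL_quad hB]
    conv_lhs => rw [hD.c2_eq]
    rw [smulL_ofFn, addL_ofFn, leB_ofFn]
    refine forall_congr' fun r => ?_
    rw [← Nat.cast_le (α := ℤ), Nat.cast_add, Nat.cast_mul,
      cast_list_sum_toNat fun c hc => triple_nonneg hD.triple_J_nonneg (hC c hc) (hC c hc) r,
      cast_list_sum_toNat fun b hb => triple_nonneg hD.triple_J_nonneg (hB b hb) (hB b hb) r,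
      hD.chern2_J]
    rfl
  have hsum : FormData.eqL (sumL A.h (B.map K.code)) (sumL A.h (C.map K.code)) = true ↔
      (B : Multiset A.Pic).sum = (C : Multiset A.Pic).sum := by
    rw [sumL_code hB, sumL_code hC, eqL_code (nonneg_sum hB) (nonneg_sum hC), Multiset.sum_coe,
      Multiset.sum_coe]
  have h1 : (lall (fun b => Nat.beq b.length A.h && leB (constL 1 A.h) b && leB b (K.code u))
      (B.map K.code)) = true ↔ ∀ b ∈ B, ∀ i, 1 ≤ K.coord b i := by
    rw [lall_iff, List.forall_mem_map]
    refine forall₂_congr fun b hb => ?_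
    rw [Bool.and_eq_true, Bool.and_eq_true, constL_eq_code, leB_code nonneg_ones (hB b hb),
      leB_code (hB b hb) hu0, length_code, Nat.beq_eq]
    simp only [coord_ones, true_and]
    exact and_iff_left (hu.1 b hb)
  have h2 : (lall (fun c => Nat.beq c.length A.h && leB (K.code u) c) (C.map K.code)) = true ↔
      ∀ c ∈ C, ∀ i, K.coord u i ≤ K.coord c i := by
    rw [lall_iff, List.forall_mem_map]
    refine forall₂_congr fun c hc => ?_
    rw [Bool.and_eq_true, leB_code hu0 (hC c hc), length_code, Nat.beq_eq]
    exact and_iff_right rfl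
  have h3 : (!(lany (FormData.eqL (K.code u)) (B.map K.code) &&
      lany (FormData.eqL (K.code u)) (C.map K.code))) = true ↔ ¬ (u ∈ B ∧ u ∈ C) := by
    rw [Bool.not_eq_true', ← Bool.not_eq_true, Bool.and_eq_true, lany_iff, lany_iff,
      exists_mem_list_map, exists_mem_list_map]
    refine not_congr (and_congr ⟨?_, ?_⟩ ⟨?_, ?_⟩)
    · rintro ⟨b, hb, h⟩
      rwa [(eqL_code hu0 (hB b hb)).mp h]
    · exact fun h => ⟨u, h, (eqL_code hu0 hu0).mpr rfl⟩
    · rintro ⟨b, hb, h⟩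
      rwa [(eqL_code hu0 (hC b hb)).mp h]
    · exact fun h => ⟨u, h, (eqL_code hu0 hu0).mpr rfl⟩
  rw [FormData.isMonad, Bool.and_eq_true, Bool.and_eq_true, Bool.and_eq_true, Bool.and_eq_true,
    Bool.and_eq_true, h1, h2, h3, hsum, hanomaly, isPositiveMonad_iff (K := K), Nat.beq_eq, lenN_eq,
    lenN_eq, List.length_map, List.length_map]
  simp only [Multiset.coe_card, Multiset.mem_coe]
  constructor
  · rintro ⟨⟨⟨⟨⟨g1, g2⟩, g3⟩, g4⟩, g5⟩, g6⟩
    refine ⟨g4, g1, fun c hc i => ?_, fun b hb c hc i => (hu.1 b hb i).trans (g2 c hc i),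
      fun b hb c hc hbc => g3 ?_, g5, g6⟩
    · obtain ⟨b, hb, h⟩ := hu.2 i
      exact (g1 b hb i).trans (h.le.trans (g2 c hc i))
    · obtain rfl : u = b := coord_ext (K := K) fun i =>
        le_antisymm ((g2 c hc i).trans (by rw [hbc])) (hu.1 b hb i)
      exact ⟨hb, hbc ▸ hc⟩
  · rintro ⟨g1, g2, g3, g4, g5, g6, g7⟩
    refine ⟨⟨⟨⟨⟨g2, fun c hc i => ?_⟩, fun h => g5 u h.1 u h.2 rfl⟩, g1⟩, g6⟩, g7⟩
    obtain ⟨b, hb, h⟩ := hu.2 i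
    rw [← h]
    exact g4 b hb c hc i

/-! ### Completeness of the list of pairs -/

variable (K) in
/-- The monad with the given multidegrees. -/
def decodePair (P : Pair) : A.MonadData := ⟨P.1.map K.decode, P.2.map K.decode⟩

theorem decodePair_eq_of_coe_eq {V : A.MonadData} {P : Pair} (hB : ∀ b ∈ V.B, K.Nonneg b)
    (hC : ∀ c ∈ V.C, K.Nonneg c) (h1 : (P.1 : Multiset (List ℕ)) = V.B.map K.code)
    (h2 : (P.2 : Multiset (List ℕ)) = V.C.map K.code) : K.decodePair P = V := by
  have key : ∀ (m : Multiset A.Pic) (l : List (List ℕ)), (∀ b ∈ m, K.Nonneg b) →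
      (l : Multiset (List ℕ)) = m.map K.code → ((l.map K.decode : List A.Pic) : Multiset A.Pic) = m := by
    intro m l hm h
    rw [← Multiset.map_coe, h, Multiset.map_map]
    conv_rhs => rw [← Multiset.map_id m]
    exact Multiset.map_congr rfl fun b hb => decode_code (hm b hb)
  exact MonadData.ext (key _ _ hB h1) (key _ _ hC h2)

theorem map_code_decode {l : List (List ℕ)} (hl : ∀ x ∈ l, x.length = A.h) :
    (l.map K.decode).map K.code = l := by
  rw [List.map_map]
  conv_rhs => rw [← List.map_id l]
  exact List.map_congr_left fun x hx => code_decode (hl x hx)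

theorem natRec_cons_eq_replicate {α : Type} (u : α) (n : ℕ) :
    (Nat.rec [] (fun _ ih => u :: ih) n : List α) = List.replicate n u := by
  induction n with
  | zero => rfl
  | succ n ih => rw [List.replicate_succ, ← ih]

open Classical in
-- The decomposition determines the summands other than `u`; the copies of `u` are recovered from
-- the rank.
theorem HasForm.exists_complete (hD : K.HasForm D) {V : A.MonadData} (hN : 1 ≤ N)
    (hV : V.IsPositiveMonad N) (hu : K.IsSup u V.B) :
    ∃ P ∈ lmap (FormData.complete N (K.code u)) (decompositions (groups A.h (D.parts A.h N (K.code u)))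
        (lappend (smulL N (K.code u)) (D.slack A.h N (K.code u))) []),
      (P.1 : Multiset (List ℕ)) = V.B.map K.code ∧ (P.2 : Multiset (List ℕ)) = V.C.map K.code := by
  obtain ⟨o, ho, hm⟩ := hD.exists_decomposition hN hV hu
  refine ⟨_, by rw [lmap_eq]; exact List.mem_map_of_mem ho, ?_⟩
  have hsplit : ∀ m : Multiset A.Pic, Multiset.replicate (m.count u) (K.code u) +
      (m.filter (· ≠ u)).map K.code = m.map K.code := fun m => by
    conv_rhs => rw [← Multiset.filter_add_not (· = u) m, Multiset.map_add, Multiset.filter_eq',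
      Multiset.map_replicate]
  have hcard : ∀ m : Multiset A.Pic, m.count u + Multiset.card (m.filter (· ≠ u)) =
      Multiset.card m := fun m => by
    conv_rhs => rw [← Multiset.filter_add_not (· = u) m, Multiset.card_add, Multiset.filter_eq',
      Multiset.card_replicate]
  have hfB : ((lmap Prod.snd (lfilter (fun p => !p.1) o) : List (List ℕ)) : Multiset (List ℕ)) =
      (V.B.filter (· ≠ u)).map K.code := by
    rw [lmap_eq, lfilter_eq, ← Multiset.map_coe, coe_filter_bool, hm, Multiset.filter_add,
      Multiset.filter_map, Multiset.filter_map, Multiset.map_add, Multiset.map_map, Multiset.map_map]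
    simp
  have hfC : ((lmap Prod.snd (lfilter (fun p => p.1) o) : List (List ℕ)) : Multiset (List ℕ)) =
      (V.C.filter (· ≠ u)).map K.code := by
    rw [lmap_eq, lfilter_eq, ← Multiset.map_coe, coe_filter_bool, hm, Multiset.filter_add,
      Multiset.filter_map, Multiset.filter_map, Multiset.map_add, Multiset.map_map, Multiset.map_map]
    simp
  have hlB : lenN (lmap Prod.snd (lfilter (fun p => !p.1) o)) =
      Multiset.card (V.B.filter (· ≠ u)) := by
    rw [lenN_eq, ← Multiset.coe_card, hfB, Multiset.card_map]
  have hlC : lenN (lmap Prod.snd (lfilter (fun p => p.1) o)) =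
      Multiset.card (V.C.filter (· ≠ u)) := by
    rw [lenN_eq, ← Multiset.coe_card, hfC, Multiset.card_map]
  have hrank := hV.rank_eq
  have hB := hcard V.B
  have hC := hcard V.C
  -- By nontriviality at most one of the two multiplicities is nonzero, so both are given by
  -- truncated differences.
  have hzero : V.B.count u = 0 ∨ V.C.count u = 0 := by
    by_contra! h
    exact hV.nontrivial u (Multiset.count_ne_zero.mp h.1) u (Multiset.count_ne_zero.mp h.2) rfl
  simp only [FormData.complete, natRec_cons_eq_replicate, lappend_eq, ← Multiset.coe_add, hfB, hfC,
    hlB, hlC, Multiset.coe_replicate, Nat.add_eq, Nat.sub_eq]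
  rw [show Multiset.card (V.C.filter (· ≠ u)) + N - Multiset.card (V.B.filter (· ≠ u)) = V.B.count u by
      omega,
    show Multiset.card (V.B.filter (· ≠ u)) - (Multiset.card (V.C.filter (· ≠ u)) + N) = V.C.count u by
      omega]
  exact ⟨hsplit _, hsplit _⟩

/-- The supremum of `B` is among those that the search considers. -/
theorem HasForm.coord_sup_le (hD : K.HasForm D) {k : ℕ} (hk : D.boundCheck A.h N k = true)
    {V : A.MonadData} (hV : V.IsPositiveMonad N) (hu : K.IsSup u V.B) (s : Fin A.h) :
    K.coord u s ≤ k + 1 := by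
  by_contra! hs
  rw [FormData.boundCheck] at hk
  rw [constL_eq_code (K := K), hD.quad_code nonneg_ones nonneg_ones] at hk
  simp only [lall_iff, lany_iff, upTo_eq, List.mem_range] at hk
  obtain ⟨r, hr, h⟩ := hk s s.2
  obtain ⟨r, rfl⟩ : ∃ i : Fin A.h, r = i := ⟨⟨r, hr⟩, rfl⟩
  have e1 : lget 0 (K.formCode K.ones K.ones) r = (A.triple K.ones K.ones (K.J r)).toNat := by
    rw [lget_eq, formCode, getD_ofFn]
  have hle := mul_triple_ones_le hD.triple_J_nonneg hV hu r
  have e2 : ((sumN (lmap (fun q => D.d r q s) (List.range A.h)) : ℕ) : ℤ) =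
      A.triple K.ones (K.J s) (K.J r) := by
    rw [sumN_eq, lmap_eq, sum_map_range, triple_ones, Nat.cast_sum]
    exact Finset.sum_congr rfl fun q _ => (hD.triple_J r q s).symm
  -- A coordinate `s` of `u` of size at least `k + 2` gives `u ≥ e + (k + 1) J_s`. The row `r`
  -- provided by `boundCheck` then contradicts the bound on `u`.
  have e3 : A.triple K.ones u (K.J r) = A.triple K.ones K.ones (K.J r) +
      A.triple K.ones (K.J s) (K.J r) * (k + 1) +
        A.triple K.ones (u - K.ones - (k + 1) • K.J s) (K.J r) := by
    simp only [← tripleHom_apply, map_sub, LinearMap.sub_apply, map_nsmul, LinearMap.smul_apply]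
    rw [nsmul_eq_mul]
    push_cast
    ring
  have e4 : 0 ≤ A.triple K.ones (u - K.ones - (k + 1) • K.J s) (K.J r) := by
    refine triple_nonneg hD.triple_J_nonneg nonneg_ones (fun i => ?_) r
    rw [map_sub, map_sub, map_nsmul, Pi.sub_apply, Pi.sub_apply, coord_ones, Pi.smul_apply, coord_J,
      nsmul_eq_mul]
    have := hu.one_le hV i
    split_ifs with his
    · subst his
      push_cast
      linarith
    · simp
      linarith
  have h' := Nat.ble_eq.mp h
  rw [e1, ← Nat.cast_le (α := ℤ), lget_eq] at h'
  push_cast at h'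
  rw [e2, Int.toNat_of_nonneg (triple_nonneg hD.triple_J_nonneg nonneg_ones nonneg_ones r)] at h'
  rw [hD.chern2_J, e3] at hle
  have : 0 ≤ (N : ℤ) * A.triple K.ones (u - K.ones - (k + 1) • K.J s) (K.J r) :=
    mul_nonneg (by positivity) e4
  linarith

end KahlerBasis

end ToricSpace

end ToricMonad

/-! ### Canonical representatives and the number of equivalence classes. -/

namespace ToricMonad

theorem length_of_mem_box {w x : List ℕ} (h : x ∈ box w) : x.length = w.length := by
  induction w generalizing x with
  | nil =>
    have : x = [] := by simpa [box] using h
    rw [this]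
  | cons a w ih =>
    rw [box_cons, List.mem_flatMap] at h
    obtain ⟨i, -, h⟩ := h
    obtain ⟨y, hy, rfl⟩ := List.mem_map.mp h
    rw [List.length_cons, List.length_cons, ih hy]

namespace ToricSpace

variable {A : ToricSpace}

namespace KahlerBasis

variable {K : KahlerBasis A} {D : FormData} {N : ℕ} {u v : A.Pic} {G : List (List ℕ)}

/-! ### Permutations of the coordinates -/

/-- The list of the values of a permutation. -/
def permCode {n : ℕ} (p : Equiv.Perm (Fin n)) : List ℕ := List.ofFn fun i => (p i : ℕ)

variable (K) in
/-- The automorphism that permutes the coordinates. -/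
def permHom (p : Equiv.Perm (Fin A.h)) : A.Pic ≃+ A.Pic :=
  (K.coord ≪≫ₗ LinearEquiv.funCongrLeft ℤ ℤ p ≪≫ₗ K.coord.symm).toAddEquiv

theorem coord_permHom (p : Equiv.Perm (Fin A.h)) (x : A.Pic) (i : Fin A.h) :
    K.coord (K.permHom p x) i = K.coord x (p i) := by
  have : K.permHom p x = K.coord.symm (LinearEquiv.funCongrLeft ℤ ℤ p (K.coord x)) := rfl
  rw [this, LinearEquiv.apply_symm_apply]
  rfl

/-- The image of a monad under an automorphism of `Pic`. -/
def _root_.ToricMonad.ToricSpace.MonadData.map (V : A.MonadData) (φ : A.Pic ≃+ A.Pic) : A.MonadData :=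
  ⟨V.B.map φ, V.C.map φ⟩

theorem permL_code (p : Equiv.Perm (Fin A.h)) (x : A.Pic) :
    FormData.permL (permCode p) (K.code x) = K.code (K.permHom p x) := by
  rw [FormData.permL, permCode, lmap_eq, List.map_ofFn, code]
  congr 1
  ext i
  rw [Function.comp_apply, lget_eq, getD_ofFn, coord_permHom]

theorem IsSup.permHom {B : Multiset A.Pic} (hu : K.IsSup u B) (p : Equiv.Perm (Fin A.h)) :
    K.IsSup (K.permHom p u) (B.map (K.permHom p)) := by
  refine ⟨fun b hb i => ?_, fun i => ?_⟩
  · obtain ⟨b, hb', rfl⟩ := Multiset.mem_map.mp hb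
    rw [coord_permHom, coord_permHom]
    exact hu.1 b hb' _
  · obtain ⟨b, hb, h⟩ := hu.2 (p i)
    refine ⟨_, Multiset.mem_map_of_mem _ hb, ?_⟩
    rw [coord_permHom, coord_permHom, h]

/-- The list `G` describes the equivalence of monads. -/
structure IsExchangeList (K : KahlerBasis A) (D : FormData) (G : List (List ℕ)) : Prop where
  exists_eq : ∀ σ ∈ G, ∃ p : Equiv.Perm (Fin A.h), σ = permCode p
  rel_iff : ∀ V W : A.MonadData, A.monadSetoid V W ↔
    ∃ p : Equiv.Perm (Fin A.h), permCode p ∈ G ∧ W = V.map (K.permHom p)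
  d_perm : ∀ p : Equiv.Perm (Fin A.h), permCode p ∈ G → ∀ r s t,
    D.d (p r) (p s) (p t) = D.d r s t
  c2_perm : ∀ p : Equiv.Perm (Fin A.h), permCode p ∈ G → ∀ r, D.c2.getD (p r) 0 = D.c2.getD r 0

theorem HasForm.triple_eq (hD : K.HasForm D) (x y z : A.Pic) : A.triple x y z =
    ∑ r, ∑ s, ∑ t, K.coord x s * K.coord y t * K.coord z r * D.d r s t := by
  conv_lhs => rw [K.eq_sum z]
  rw [← tripleHom_apply, map_sum]
  refine Finset.sum_congr rfl fun r _ => ?_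
  rw [map_smul, tripleHom_apply, triple_eq_sum_left, smul_eq_mul, Finset.mul_sum]
  refine Finset.sum_congr rfl fun s _ => ?_
  rw [Finset.mul_sum]
  refine Finset.sum_congr rfl fun t _ => ?_
  rw [hD.triple_J]
  ring

theorem IsExchangeList.triple_permHom (hG : K.IsExchangeList D G) (hD : K.HasForm D)
    {p : Equiv.Perm (Fin A.h)} (hp : permCode p ∈ G) (x y z : A.Pic) :
    A.triple (K.permHom p x) (K.permHom p y) (K.permHom p z) = A.triple x y z := by
  rw [hD.triple_eq, hD.triple_eq]
  conv_rhs => rw [← Equiv.sum_comp p]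
  refine Finset.sum_congr rfl fun r _ => ?_
  conv_rhs => rw [← Equiv.sum_comp p]
  refine Finset.sum_congr rfl fun s _ => ?_
  conv_rhs => rw [← Equiv.sum_comp p]
  refine Finset.sum_congr rfl fun t _ => ?_
  rw [coord_permHom, coord_permHom, coord_permHom, hG.d_perm p hp]

theorem permHom_J (p : Equiv.Perm (Fin A.h)) (i : Fin A.h) : K.permHom p (K.J (p i)) = K.J i :=
  coord_ext (K := K) fun j => by
    rw [coord_permHom, coord_J, coord_J]
    simp

theorem IsExchangeList.isPositiveMonad_map (hG : K.IsExchangeList D G) (hD : K.HasForm D)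
    {p : Equiv.Perm (Fin A.h)} (hp : permCode p ∈ G) {V : A.MonadData} (hV : V.IsPositiveMonad N) :
    (V.map (K.permHom p)).IsPositiveMonad N := by
  rw [isPositiveMonad_iff (K := K)] at hV ⊢
  obtain ⟨h1, h2, h3, h4, h5, h6, h7⟩ := hV
  simp only [MonadData.map, Multiset.card_map, Multiset.mem_map, forall_exists_index, and_imp,
    forall_apply_eq_imp_iff₂, coord_permHom, Multiset.map_map, Function.comp_def]
  refine ⟨h1, fun b hb i => h2 b hb _, fun c hc i => h3 c hc _, fun b hb c hc i => h4 b hb c hc _,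
    fun b hb c hc h => h5 b hb c hc ((K.permHom p).injective h), ?_, fun r => ?_⟩
  · rw [← map_multiset_sum, ← map_multiset_sum, h6]
  · rw [← permHom_J p r]
    simp only [hG.triple_permHom hD hp]
    rw [permHom_J, hD.chern2_J, ← hG.c2_perm p hp r, ← hD.chern2_J]
    exact h7 (p r)

theorem IsExchangeList.isThreeFamily_map (hG : K.IsExchangeList D G) (hD : K.HasForm D)
    {p : Equiv.Perm (Fin A.h)} (hp : permCode p ∈ G) {V : A.MonadData} (hV : V.IsThreeFamily) :
    (V.map (K.permHom p)).IsThreeFamily := by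
  have : (V.map (K.permHom p)).index = V.index := by
    rw [MonadData.index, MonadData.index]
    simp only [MonadData.map, Multiset.map_map, Function.comp_def, hG.triple_permHom hD hp]
  rw [MonadData.IsThreeFamily] at hV ⊢
  rwa [this]

/-! ### The hash and the three-family constraint -/

/-- The contribution of a summand to the hash. -/
def hashTerm (x : List ℕ) : ℕ :=
  let e := Nat.add 3 (digits x)
  Nat.mod (Nat.mul e (Nat.mul e e)) 1000003

theorem hash_eq (P : Pair) : FormData.hash P = ((P.1 : Multiset (List ℕ)).map hashTerm).sum +
    1009 * ((P.2 : Multiset (List ℕ)).map hashTerm).sum := by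
  rw [Multiset.map_coe, Multiset.map_coe, Multiset.sum_coe, Multiset.sum_coe, ← sumN_eq, ← sumN_eq,
    ← lmap_eq, ← lmap_eq]
  rfl

/-- The lists code the summands of the monad. -/
def Codes (K : KahlerBasis A) (P : Pair) (V : A.MonadData) : Prop :=
  (P.1 : Multiset (List ℕ)) = V.B.map K.code ∧ (P.2 : Multiset (List ℕ)) = V.C.map K.code

theorem Codes.hash_eq_hash {V : A.MonadData} {P Q : Pair} (hP : K.Codes P V) (hQ : K.Codes Q V) :
    FormData.hash P = FormData.hash Q := by
  rw [hash_eq, hash_eq, hP.1, hP.2, hQ.1, hQ.2]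

theorem Codes.permPair {V : A.MonadData} {P : Pair} (hP : K.Codes P V) (p : Equiv.Perm (Fin A.h)) :
    K.Codes (FormData.permPair (permCode p) P) (V.map (K.permHom p)) := by
  rw [Codes, FormData.permPair]
  constructor
  · rw [lmap_eq, ← Multiset.map_coe, hP.1]
    simp only [MonadData.map, Multiset.map_map, Function.comp_def, permL_code]
  · rw [lmap_eq, lmap_eq, ← Multiset.map_coe, hP.2]
    simp only [MonadData.map, Multiset.map_map, Function.comp_def, permL_code]

theorem HasForm.cubic_code (hD : K.HasForm D) {l : List A.Pic} (hl : ∀ x ∈ l, K.Nonneg x) :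
    ((D.cubic (l.map K.code) : ℕ) : ℤ) = ((l : Multiset A.Pic).map fun x => A.triple x x x).sum := by
  induction l with
  | nil => rfl
  | cons x l ih =>
    have hx := hl x (by simp)
    have e : D.cubic ((x :: l).map K.code) =
        dotN (K.code x) (quad D.t (K.code x) (K.code x)) + D.cubic (l.map K.code) := rfl
    rw [e, Nat.cast_add, ih fun y hy => hl y (by simp [hy]), ← Multiset.cons_coe, Multiset.map_cons,
      Multiset.sum_cons, hD.quad_code hx hx, formCode, dotN_ofFn_right, Nat.cast_sum]
    congr 1
    conv_rhs =>
      rw [← tripleHom_apply]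
      arg 2
      rw [K.eq_sum x]
    rw [map_sum]
    refine Finset.sum_congr rfl fun i _ => ?_
    rw [getD_code, map_smul, tripleHom_apply, smul_eq_mul, Nat.cast_mul, Int.toNat_of_nonneg (hx i),
      Int.toNat_of_nonneg (triple_nonneg hD.triple_J_nonneg hx hx i)]

theorem HasForm.isThreeFamily_code (hD : K.HasForm D) {B C : List A.Pic}
    (hB : ∀ b ∈ B, K.Nonneg b) (hC : ∀ c ∈ C, K.Nonneg c) :
    D.isThreeFamily (B.map K.code, C.map K.code) = true ↔
      (⟨B, C⟩ : A.MonadData).IsThreeFamily := by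
  have hb := hD.cubic_code hB
  have hc := hD.cubic_code hC
  set b := D.cubic (B.map K.code) with hb'
  set c := D.cubic (C.map K.code) with hc'
  have e : D.isThreeFamily (B.map K.code, C.map K.code) =
      (Nat.blt 0 ((b - c) + (c - b)) && Nat.beq (((b - c) + (c - b)) % 18) 0 &&
        Nat.beq (D.euler.natAbs % (((b - c) + (c - b)) / 18)) 0) := rfl
  have hidx : (⟨B, C⟩ : A.MonadData).index = (((b : ℤ) - c : ℤ) : ℚ) / 3 / 2 := by
    rw [MonadData.index, hb, hc]
  have hm : (b - c) + (c - b) = ((b : ℤ) - c).natAbs := by omega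
  rw [e, hm, Bool.and_eq_true, Bool.and_eq_true, Nat.beq_eq, Nat.beq_eq, MonadData.IsThreeFamily, hidx,
    hD.euler]
  generalize (b : ℤ) - c = z
  have hk : ∀ k : ℤ, (z : ℚ) / 3 / 2 = 3 * (k : ℚ) ↔ z = 18 * k := fun k => by
    rw [← Int.cast_inj (α := ℚ), Int.cast_mul, Int.cast_ofNat]
    constructor <;> intro h <;> linarith
  simp only [hk]
  constructor
  · rintro ⟨⟨h1, h2⟩, h3⟩
    have h1' : 0 < z.natAbs := Nat.ble_eq.mp h1
    obtain ⟨k, rfl⟩ : (18 : ℤ) ∣ z := by omega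
    refine ⟨k, by rintro rfl; simp at h1', rfl, ?_⟩
    rw [Int.natAbs_mul, show Int.natAbs 18 = 18 from rfl, Nat.mul_div_cancel_left _ (by norm_num)] at h3
    exact Int.natAbs_dvd_natAbs.mp (Nat.dvd_of_mod_eq_zero h3)
  · rintro ⟨k, hk0, rfl, hdvd⟩
    rw [Int.natAbs_mul, show Int.natAbs 18 = 18 from rfl, Nat.mul_div_cancel_left _ (by norm_num),
      Nat.mul_mod_right]
    refine ⟨⟨Nat.ble_eq.mpr ?_, rfl⟩, Nat.mod_eq_zero_of_dvd (Int.natAbs_dvd_natAbs.mpr hdvd)⟩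
    have := Int.natAbs_pos.mpr hk0
    omega

/-! ### The numbers of classes -/

/-- What is known about a pair found by the search. -/
structure IsFound (K : KahlerBasis A) (N : ℕ) (G : List (List ℕ)) (P : Pair) (u : A.Pic) : Prop where
  codes : K.Codes P (K.decodePair P)
  isPositiveMonad : (K.decodePair P).IsPositiveMonad N
  isSup : K.IsSup u (K.decodePair P).B
  digits_le : ∀ σ ∈ G, digits (K.code u) ≤ digits (FormData.permL σ (K.code u))
  canonical : FormData.isCanonical G (K.code u) P = true

theorem HasForm.length_of_mem_suprema {x : List ℕ} {k : ℕ} (hx : x ∈ D.suprema A.h N G k) :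
    x.length = A.h := by
  rw [FormData.suprema, lfilter_eq, List.mem_filter, lmap_eq] at hx
  obtain ⟨y, hy, rfl⟩ := List.mem_map.mp hx.1
  rw [lmap_eq, List.length_map, length_of_mem_box hy, constL_eq_ofFn, List.length_ofFn]

theorem HasForm.mem_monads (hD : K.HasForm D) {k : ℕ} {P : Pair} (hP : P ∈ D.monads A.h N G k) :
    ∃ u, K.IsFound N G P u ∧
      (D.isThreeFamily P = true ↔ (K.decodePair P).IsThreeFamily) := by
  rw [FormData.monads, lbind_eq, List.mem_flatMap] at hP
  obtain ⟨x, hx, hP⟩ := hP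
  have hxl := HasForm.length_of_mem_suprema hx
  rw [FormData.monadsWithSup, lfilter_eq, List.mem_filter, Bool.and_eq_true, Bool.and_eq_true] at hP
  obtain ⟨-, ⟨hsup, hcan⟩, hmon⟩ := hP
  rw [FormData.suprema, lfilter_eq, List.mem_filter, Bool.and_eq_true, lall_iff] at hx
  have hdig := hx.2.2
  have hl1 : ∀ y ∈ P.1, y.length = A.h := by
    rw [FormData.isMonad] at hmon
    simp only [Bool.and_eq_true, lall_iff, Nat.beq_eq] at hmon
    exact fun y hy => (hmon.1.1.1.1.1 y hy).1.1
  have hl2 : ∀ y ∈ P.2, y.length = A.h := by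
    rw [FormData.isMonad] at hmon
    simp only [Bool.and_eq_true, lall_iff, Nat.beq_eq] at hmon
    exact fun y hy => (hmon.1.1.1.1.2 y hy).1
  have hn : ∀ l : List (List ℕ), ∀ b ∈ l.map K.decode, K.Nonneg b := by
    intro l b hb
    obtain ⟨y, -, rfl⟩ := List.mem_map.mp hb
    exact nonneg_decode y
  have e : P = ((P.1.map K.decode).map K.code, (P.2.map K.decode).map K.code) := by
    rw [map_code_decode hl1, map_code_decode hl2]
  have eu := code_decode (K := K) hxl
  have hu : K.IsSup (K.decode x) (P.1.map K.decode : List A.Pic) := by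
    rw [← isSup_code (nonneg_decode x) (hn _), eu, map_code_decode hl1]
    exact hsup
  refine ⟨K.decode x, ⟨⟨?_, ?_⟩, ?_, hu, ?_, ?_⟩, ?_⟩
  · rw [decodePair, Multiset.map_coe, map_code_decode hl1]
  · rw [decodePair, Multiset.map_coe, map_code_decode hl2]
  · refine (hD.isMonad_code hu (hn _) (hn _)).mp ?_
    rw [← e, eu]
    exact hmon
  · rw [eu]
    exact fun σ hσ => Nat.ble_eq.mp (hdig σ hσ)
  · rwa [eu]
  · conv_lhs => rw [e]
    exact hD.isThreeFamily_code (hn _) (hn _)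

theorem isCanonical_iff {x : List ℕ} {P : Pair} : FormData.isCanonical G x P = true ↔
    ∀ σ ∈ G, digits (FormData.permL σ x) = digits x →
      FormData.hash P ≤ FormData.hash (FormData.permPair σ P) := by
  rw [FormData.isCanonical, lall_iff]
  refine forall₂_congr fun σ _ => ?_
  rw [Bool.or_eq_true, Bool.not_eq_true', ← Bool.not_eq_true, Nat.beq_eq, Nat.ble_eq]
  exact imp_iff_not_or.symm

/-- An equivalence carries the supremum of one monad to that of the other, so minimality under
permutations compares the two directly. Applied in both directions it gives equal encodings and
equal hashes. Injectivity of `digits` or of the hash on monads is not needed. -/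
theorem IsFound.hash_le (hG : K.IsExchangeList D G) {P Q : Pair} (hP : K.IsFound N G P u)
    (hQ : K.IsFound N G Q v) (h : A.monadSetoid (K.decodePair P) (K.decodePair Q)) :
    digits (K.code u) ≤ digits (K.code v) ∧
      (digits (K.code u) = digits (K.code v) → FormData.hash P ≤ FormData.hash Q) := by
  obtain ⟨p, hp, he⟩ := (hG.rel_iff _ _).mp h
  have hv : v = K.permHom p u := by
    have := hQ.isSup
    rw [he] at this
    exact this.unique (hP.isSup.permHom p)
  rw [hv, ← permL_code]
  refine ⟨hP.digits_le _ hp, fun hd => ?_⟩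
  refine (isCanonical_iff.mp hP.canonical _ hp hd.symm).trans ?_
  have h1 := hP.codes.permPair p
  rw [← he] at h1
  rw [h1.hash_eq_hash hQ.codes]

/-- Every class contains a monad that the search keeps: one whose encoded supremum and hash are
lexicographically minimal in the orbit. -/
theorem HasForm.exists_mem_monads (hD : K.HasForm D) (hG : K.IsExchangeList D G) (hN : 1 ≤ N) {k : ℕ}
    (hk : D.boundCheck A.h N k = true) {V : A.MonadData} (hV : V.IsPositiveMonad N) :
    ∃ P ∈ D.monads A.h N G k, A.monadSetoid V (K.decodePair P) := by
  classical
  obtain ⟨u, hu⟩ := K.exists_isSup_of_isPositiveMonad hN hV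
  obtain ⟨P, -, hP⟩ := hD.exists_complete hN hV hu
  have hP : K.Codes P V := hP
  -- The code of the supremum is minimized first and the hash second, which are the respective tests
  -- of `suprema` and `isCanonical`.
  set key : Equiv.Perm (Fin A.h) → ℕ ×ₗ ℕ := fun p =>
    toLex (digits (K.code (K.permHom p u)), FormData.hash (FormData.permPair (permCode p) P)) with hkey
  obtain ⟨p₁, hp₁, -⟩ := (hG.rel_iff V V).mp (A.monadSetoid.refl V)
  obtain ⟨p, hp, hmin⟩ := Finset.exists_min_image
    (Finset.univ.filter fun p : Equiv.Perm (Fin A.h) => permCode p ∈ G) key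
    ⟨p₁, Finset.mem_filter.mpr ⟨Finset.mem_univ _, hp₁⟩⟩
  replace hp := (Finset.mem_filter.mp hp).2
  set W := V.map (K.permHom p) with hWdef
  set w := K.permHom p u with hwdef
  have hW : W.IsPositiveMonad N := hG.isPositiveMonad_map hD hp hV
  have hw : K.IsSup w W.B := hu.permHom p
  have hVW : A.monadSetoid V W := (hG.rel_iff _ _).mpr ⟨p, hp, rfl⟩
  obtain ⟨Q, hQ, hQW⟩ := hD.exists_complete hN hW hw
  have hQW : K.Codes Q W := hQW
  have hkeyW : key p = toLex (digits (K.code w), FormData.hash Q) := by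
    change toLex (_, FormData.hash _) = _
    rw [(hP.permPair p).hash_eq_hash hQW]
  -- A further permutation stays in the orbit of `V` by transitivity of the equivalence, so
  -- minimality of `p` applies; closure of `G` under composition is not needed separately.
  have hkeyq : ∀ q, permCode q ∈ G → toLex (digits (K.code w), FormData.hash Q) ≤
      toLex (digits (K.code (K.permHom q w)), FormData.hash (FormData.permPair (permCode q) Q)) := by
    intro q hq
    have h1 : A.monadSetoid V (W.map (K.permHom q)) :=
      A.monadSetoid.trans hVW ((hG.rel_iff _ _).mpr ⟨q, hq, rfl⟩)
    obtain ⟨q', hq', he⟩ := (hG.rel_iff _ _).mp h1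
    have h2 : K.permHom q w = K.permHom q' u := by
      have := hw.permHom q
      have h3 := hu.permHom q'
      have he' : W.B.map (K.permHom q) = V.B.map (K.permHom q') := congrArg MonadData.B he
      rw [he'] at this
      exact this.unique h3
    have h3 := hQW.permPair q
    rw [he] at h3
    rw [← hkeyW, h2, h3.hash_eq_hash (hP.permPair q')]
    exact hmin q' (Finset.mem_filter.mpr ⟨Finset.mem_univ _, hq'⟩)
  have hW' := (isPositiveMonad_iff (K := K)).mp hW
  have hnB : ∀ b ∈ W.B, K.Nonneg b := fun b hb => nonneg_of_one_le (hW'.2.1 b hb)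
  have hnC : ∀ c ∈ W.C, K.Nonneg c := fun c hc => nonneg_of_one_le (hW'.2.2.1 c hc)
  have hdec : K.decodePair Q = W := decodePair_eq_of_coe_eq hnB hnC hQW.1 hQW.2
  have hw1 := hw.one_le hW
  have hw0 := nonneg_of_one_le hw1
  refine ⟨Q, ?_, by rw [hdec]; exact hVW⟩
  rw [FormData.monads, lbind_eq, List.mem_flatMap]
  refine ⟨K.code w, ?_, ?_⟩
  · rw [FormData.suprema, lfilter_eq, List.mem_filter, lmap_eq]
    refine ⟨List.mem_map.mpr ⟨K.code (w - K.ones), ?_, ?_⟩, ?_⟩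
    · rw [constL_eq_ofFn]
      refine mem_box_ofFn fun i => ?_
      have := hD.coord_sup_le hk hW hw i
      rw [map_sub, Pi.sub_apply, coord_ones]
      omega
    · rw [lmap_eq, code, List.map_ofFn, code]
      congr 1
      ext i
      have := hw1 i
      rw [Function.comp_apply, map_sub, Pi.sub_apply, coord_ones]
      omega
    · rw [Bool.and_eq_true, lall_iff, constL_eq_code (K := K), hD.quad_code nonneg_ones hw0, formCode,
        smulL_ofFn]
      constructor
      · conv_lhs => rw [hD.c2_eq]
        rw [smulL_ofFn, leB_ofFn]
        intro r
        have := mul_triple_ones_le hD.triple_J_nonneg hW hw r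
        rw [hD.chern2_J] at this
        rw [← Nat.cast_le (α := ℤ), Nat.cast_mul, Nat.cast_mul,
          Int.toNat_of_nonneg (triple_nonneg hD.triple_J_nonneg nonneg_ones hw0 r)]
        exact this
      · intro σ hσ
        obtain ⟨q, rfl⟩ := hG.exists_eq σ hσ
        rw [permL_code, Nat.ble_eq]
        rcases Prod.Lex.le_iff.mp (hkeyq q hσ) with h | h
        · exact le_of_lt h
        · exact h.1.le
  · have e1 : (Q.1.map K.decode).map K.code = Q.1 := map_code_decode fun y hy => by
      have : y ∈ (Q.1 : Multiset (List ℕ)) := hy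
      rw [hQW.1] at this
      obtain ⟨b, -, rfl⟩ := Multiset.mem_map.mp this
      exact length_code
    have e2 : (Q.2.map K.decode).map K.code = Q.2 := map_code_decode fun y hy => by
      have : y ∈ (Q.2 : Multiset (List ℕ)) := hy
      rw [hQW.2] at this
      obtain ⟨b, -, rfl⟩ := Multiset.mem_map.mp this
      exact length_code
    have hn : ∀ l : List (List ℕ), ∀ b ∈ l.map K.decode, K.Nonneg b := by
      intro l b hb
      obtain ⟨y, -, rfl⟩ := List.mem_map.mp hb
      exact nonneg_decode y
    have hw' : K.IsSup w (Q.1.map K.decode : List A.Pic) := by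
      have := congrArg MonadData.B hdec
      rw [← this] at hw
      exact hw
    rw [FormData.monadsWithSup, lfilter_eq, List.mem_filter, Bool.and_eq_true, Bool.and_eq_true]
    refine ⟨hQ, ⟨?_, ?_⟩, ?_⟩
    · rw [← e1, isSup_code hw0 (hn _)]
      exact hw'
    · rw [isCanonical_iff]
      intro σ hσ hd
      obtain ⟨q, rfl⟩ := hG.exists_eq σ hσ
      rw [permL_code] at hd
      rcases Prod.Lex.le_iff.mp (hkeyq q hσ) with h | h
      · exact absurd h (by simp [hd])
      · exact h.2
    · have := (hD.isMonad_code (N := N) hw' (hn Q.1) (hn Q.2)).mpr (by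
        have e : (⟨(Q.1.map K.decode : List A.Pic), (Q.2.map K.decode : List A.Pic)⟩ : A.MonadData) = W :=
          hdec
        rw [e]
        exact hW)
      rwa [e1, e2] at this

/-- The list of found pairs maps bijectively to the set of classes: surjectively by completeness of
the search, injectively because equivalent pairs have equal hashes while the hashes in the list are
distinct. The three-family constraint is invariant, so the filtered list counts the corresponding
classes. -/
theorem HasForm.encard_classes (hD : K.HasForm D) (hG : K.IsExchangeList D G) (hN : 1 ≤ N)
    {k m m' : ℕ} (hc : D.monadCheck A.h N G k m m' = true) :
    (A.positiveClasses N).encard = m ∧ (A.threeFamilyClasses N).encard = m' := by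
  classical
  have e : D.monadCheck A.h N G k m m' = (D.boundCheck A.h N k && Nat.beq (lenN (D.monads A.h N G k)) m &&
      nodupB (lmap FormData.hash (D.monads A.h N G k)) &&
      Nat.beq (lenN (lfilter D.isThreeFamily (D.monads A.h N G k))) m') := rfl
  rw [e, Bool.and_eq_true, Bool.and_eq_true, Bool.and_eq_true, Nat.beq_eq, Nat.beq_eq, lenN_eq, lenN_eq,
    lfilter_eq, lmap_eq] at hc
  obtain ⟨⟨⟨hb, rfl⟩, hnd⟩, rfl⟩ := hc
  replace hnd := nodup_of_nodupB hnd
  set L := D.monads A.h N G k with hL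
  have hnodup : L.Nodup := List.Nodup.of_map _ hnd
  -- Canonicity in both directions gives equality of the codes of the suprema and next of the
  -- hashes; distinctness of the hashes identifies the pairs.
  have hinj : Set.InjOn (fun P => Quotient.mk A.monadSetoid (K.decodePair P)) {P | P ∈ L} := by
    intro P hP Q hQ h
    obtain ⟨u, hu, -⟩ := hD.mem_monads hP
    obtain ⟨v, hv, -⟩ := hD.mem_monads hQ
    have hPQ : A.monadSetoid (K.decodePair P) (K.decodePair Q) := Quotient.exact h
    have h1 := hu.hash_le hG hv hPQ
    have h2 := hv.hash_le hG hu (A.monadSetoid.symm hPQ)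
    have hd := le_antisymm h1.1 h2.1
    exact List.inj_on_of_nodup_map hnd hP hQ (le_antisymm (h1.2 hd) (h2.2 hd.symm))
  have hcard : ∀ l : List Pair, l.Nodup → (∀ P ∈ l, P ∈ L) →
      ((fun P => Quotient.mk A.monadSetoid (K.decodePair P)) '' {P | P ∈ l}).encard = l.length := by
    intro l hl hsub
    rw [Set.InjOn.encard_image (hinj.mono (show {P | P ∈ l} ⊆ {P | P ∈ L} from hsub)), ← List.toFinset_card_of_nodup hl,
      ← Set.encard_coe_eq_coe_finsetCard]
    congr 1
    ext P
    simp
  constructor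
  · rw [← hcard L hnodup fun P hP => hP]
    congr 1
    ext x
    constructor
    · rintro ⟨V, hV, rfl⟩
      obtain ⟨P, hP, h⟩ := hD.exists_mem_monads hG hN hb hV
      exact ⟨P, hP, Quotient.sound (A.monadSetoid.symm h)⟩
    · rintro ⟨P, hP, rfl⟩
      obtain ⟨u, hu, -⟩ := hD.mem_monads hP
      exact ⟨_, hu.isPositiveMonad, rfl⟩
  · rw [← hcard (L.filter D.isThreeFamily) (hnodup.filter _) fun P hP => (List.mem_filter.mp hP).1]
    congr 1
    ext x
    constructor
    · rintro ⟨V, ⟨hV, hV3⟩, rfl⟩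
      obtain ⟨P, hP, h⟩ := hD.exists_mem_monads hG hN hb hV
      obtain ⟨u, -, h3⟩ := hD.mem_monads hP
      obtain ⟨p, hp, he⟩ := (hG.rel_iff _ _).mp h
      refine ⟨P, List.mem_filter.mpr ⟨hP, h3.mpr ?_⟩, Quotient.sound (A.monadSetoid.symm h)⟩
      rw [he]
      exact hG.isThreeFamily_map hD hp hV3
    · rintro ⟨P, hP, rfl⟩
      obtain ⟨hP, hP3⟩ := List.mem_filter.mp hP
      obtain ⟨u, hu, h3⟩ := hD.mem_monads hP
      exact ⟨_, ⟨hu.isPositiveMonad, h3.mp hP3⟩, rfl⟩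

end KahlerBasis

end ToricSpace

end ToricMonad

/-! ### Automorphisms that exchange projective space factors, and the checked spaces. -/

namespace ToricMonad

namespace ToricSpace

variable {A : ToricSpace}

namespace KahlerBasis

variable {K : KahlerBasis A} {D : FormData} {G : List (List ℕ)}

/-! ### Exchanges of projective space factors -/

theorem permHom_one : K.permHom 1 = AddEquiv.refl A.Pic := by
  ext1 x
  exact coord_ext (K := K) fun i => by rw [coord_permHom]; rfl

theorem permCode_injective {n : ℕ} : Function.Injective (permCode (n := n)) := fun p q h => by
  have := List.ofFn_injective h
  ext i
  exact congrFun this i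

theorem permCode_one {n : ℕ} : permCode (1 : Equiv.Perm (Fin n)) = List.range n := by
  rw [permCode]
  exact List.ext_getElem (by simp) fun i h1 h2 => by simp

theorem getD_permCode {n : ℕ} (p : Equiv.Perm (Fin n)) (i : Fin n) : (permCode p).getD i 0 = p i := by
  rw [permCode, getD_ofFn]

theorem _root_.ToricMonad.ToricSpace.MonadData.map_refl (V : A.MonadData) :
    V.map (AddEquiv.refl A.Pic) = V :=
  MonadData.ext (Multiset.map_id _) (Multiset.map_id _)

/-- If the space is not a product of projective spaces, different monads are inequivalent. -/
theorem isExchangeList_of_not_isProjectiveProduct (K : KahlerBasis A) (D : FormData)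
    (hA : ¬ A.IsProjectiveProduct) : K.IsExchangeList D [List.range A.h] := by
  have key : ∀ p : Equiv.Perm (Fin A.h), permCode p ∈ [List.range A.h] → p = 1 := fun p hp => by
    rw [List.mem_singleton, ← permCode_one] at hp
    exact permCode_injective hp
  refine ⟨fun σ hσ => ⟨1, ?_⟩, fun V W => ⟨?_, ?_⟩, fun p hp r s t => ?_, fun p hp r => ?_⟩
  · rw [List.mem_singleton.mp hσ, permCode_one]
  · rintro (rfl | ⟨φ, h, -⟩)
    · exact ⟨1, by rw [permCode_one]; exact List.mem_singleton.mpr rfl, by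
        rw [permHom_one, MonadData.map_refl]⟩
    · exact absurd h.1 hA
  · rintro ⟨p, hp, rfl⟩
    rw [key p hp, permHom_one, MonadData.map_refl]
  · rw [key p hp]
    rfl
  · rw [key p hp]
    rfl

/-- The factors of a product of projective spaces: `f ρ` is the factor to which `ρ` belongs. -/
structure IsFactorMap (K : KahlerBasis A) (f : A.Ray → Fin A.h) : Prop where
  surjective : Function.Surjective f
  sum_vertex : ∀ r, ∑ ρ ∈ Finset.univ.filter (fun ρ => f ρ = r), A.vertex ρ = 0
  divisor_eq : ∀ ρ, A.divisor ρ = K.J (f ρ)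

theorem IsFactorMap.isProjectiveProduct {f : A.Ray → Fin A.h} (hf : K.IsFactorMap f) :
    A.IsProjectiveProduct := ⟨f, hf.surjective, hf.sum_vertex⟩

theorem J_injective : Function.Injective K.J := fun i j h => by
  have := coord_J (K := K) i j
  rw [← h, coord_J, if_pos rfl] at this
  by_contra hij
  rw [if_neg hij] at this
  exact one_ne_zero this

theorem addEquiv_ext {φ ψ : A.Pic ≃+ A.Pic} (h : ∀ i, φ (K.J i) = ψ (K.J i)) : φ = ψ := by
  ext1 x
  rw [K.eq_sum x, map_sum, map_sum]
  exact Finset.sum_congr rfl fun i _ => by rw [map_zsmul, map_zsmul, h]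

/-- All toric divisors of a factor have the same hyperplane class, so an exchange permutes the
generators `J`. The permutation `g` of the rays maps the fibres of `f` bijectively to each other and
so preserves their sizes. -/
theorem IsFactorMap.exists_perm {f : A.Ray → Fin A.h} (hf : K.IsFactorMap f) {φ : A.Pic ≃+ A.Pic}
    (hφ : A.IsFactorExchange φ) : ∃ p : Equiv.Perm (Fin A.h), φ = K.permHom p ∧ ∀ i,
      (Finset.univ.filter fun ρ => f ρ = p i).card = (Finset.univ.filter fun ρ => f ρ = i).card := by
  obtain ⟨-, g, hg⟩ := hφ
  have h1 : ∀ ρ, φ (K.J (f ρ)) = K.J (f (g ρ)) := fun ρ => by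
    rw [← hf.divisor_eq, ← hf.divisor_eq, hg]
  have h2 : ∀ i, ∃ j, φ (K.J i) = K.J j := fun i => by
    obtain ⟨ρ, rfl⟩ := hf.surjective i
    exact ⟨_, h1 ρ⟩
  choose q hq using h2
  have hqinj : Function.Injective q := fun i j h => by
    apply K.J_injective
    apply φ.injective
    rw [hq, hq, h]
  set e : Equiv.Perm (Fin A.h) := Equiv.ofBijective q (Finite.injective_iff_bijective.mp hqinj)
  have he : ∀ i, e i = q i := fun i => rfl
  have hfg : ∀ ρ, f (g ρ) = e (f ρ) := fun ρ => by
    apply K.J_injective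
    rw [← h1, hq, he]
  -- The inverse appears because `permHom p` permutes coordinates by composition with `p` and
  -- therefore sends `J (p i)` to `J i`.
  refine ⟨e.symm, addEquiv_ext (K := K) fun i => ?_, fun i => ?_⟩
  · rw [hq, ← he, ← permHom_J (K := K) e.symm (e i), e.symm_apply_apply]
  · refine Finset.card_bij' (fun ρ _ => g ρ) (fun ρ _ => g.symm ρ) ?_ ?_ ?_ ?_
    · intro ρ hρ
      rw [Finset.mem_filter] at hρ ⊢
      exact ⟨Finset.mem_univ _, by rw [hfg, hρ.2, e.apply_symm_apply]⟩
    · intro ρ hρ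
      rw [Finset.mem_filter] at hρ ⊢
      refine ⟨Finset.mem_univ _, ?_⟩
      rw [Equiv.eq_symm_apply, ← hfg, g.apply_symm_apply, hρ.2]
    · intro ρ _
      simp
    · intro ρ _
      simp

theorem IsFactorMap.isFactorExchange {f : A.Ray → Fin A.h} (hf : K.IsFactorMap f)
    {p : Equiv.Perm (Fin A.h)} (hp : ∀ i,
      (Finset.univ.filter fun ρ => f ρ = p i).card = (Finset.univ.filter fun ρ => f ρ = i).card) :
    A.IsFactorExchange (K.permHom p) := by
  refine ⟨hf.isProjectiveProduct, ?_⟩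
  have e : ∀ i, Nonempty ({ρ // p.symm (f ρ) = i} ≃ {ρ // f ρ = i}) := fun i => by
    refine Fintype.card_eq.mp ?_
    rw [Fintype.card_subtype, Fintype.card_subtype, ← hp i]
    congr 1
    ext ρ
    simp only [Finset.mem_filter, Finset.mem_univ, true_and]
    exact p.symm_apply_eq
  refine ⟨Equiv.ofFiberEquiv (f := fun ρ => p.symm (f ρ)) (g := f) fun i => (e i).some, fun ρ => ?_⟩
  have hmap := Equiv.ofFiberEquiv_map (f := fun ρ => p.symm (f ρ)) (g := f) (fun i => (e i).some) ρ
  rw [hf.divisor_eq, hf.divisor_eq, hmap, ← permHom_J (K := K) p (p.symm (f ρ)), p.apply_symm_apply]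

/-- The conditions on a list of permutations to describe the exchanges of factors. -/
theorem IsFactorMap.isExchangeList {f : A.Ray → Fin A.h} (hf : K.IsFactorMap f)
    (h1 : ∀ σ ∈ G, ∃ p : Equiv.Perm (Fin A.h), σ = permCode p)
    (h2 : ∀ p : Equiv.Perm (Fin A.h), permCode p ∈ G ↔ ∀ i,
      (Finset.univ.filter fun ρ => f ρ = p i).card = (Finset.univ.filter fun ρ => f ρ = i).card)
    (h3 : ∀ σ ∈ G, ∀ r s t : Fin A.h,
      D.d (σ.getD r 0) (σ.getD s 0) (σ.getD t 0) = D.d r s t ∧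
        D.c2.getD (σ.getD r 0) 0 = D.c2.getD r 0) : K.IsExchangeList D G := by
  refine ⟨h1, fun V W => ⟨?_, ?_⟩, fun p hp r s t => ?_, fun p hp r => ?_⟩
  · rintro (rfl | ⟨φ, h, hB, hC⟩)
    · exact ⟨1, (h2 1).mpr fun i => rfl, by rw [permHom_one, MonadData.map_refl]⟩
    · obtain ⟨p, rfl, hp⟩ := hf.exists_perm h
      exact ⟨p, (h2 p).mpr hp, MonadData.ext hB hC⟩
  · rintro ⟨p, hp, rfl⟩
    exact Or.inr ⟨_, hf.isFactorExchange ((h2 p).mp hp), rfl, rfl⟩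
  · have := (h3 _ hp r s t).1
    rwa [getD_permCode, getD_permCode, getD_permCode] at this
  · have := (h3 _ hp r r r).2
    rwa [getD_permCode] at this

end KahlerBasis

end ToricSpace

/-! ### The spaces of the list -/

open ToricSpace KahlerBasis

/-- The list `l` gives the factor to which each ray belongs, and `exchanges n` is correct. -/
def IsProductData (n : ℕ) (l : List ℕ) : Prop :=
  (∀ ρ : (space n).Ray, l.getD ρ 0 < (space n).h) ∧
    (∀ i : Fin (space n).h, ∃ ρ : (space n).Ray, l.getD ρ 0 = i) ∧
    (∀ r : Fin (space n).h, ∑ ρ ∈ Finset.univ.filter (fun ρ : (space n).Ray => l.getD ρ 0 = r),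
      (space n).vertex ρ = 0) ∧
    (∀ ρ : (space n).Ray,
      (space n).divisor ρ = (space n).functional ((nefClasses n).getD (l.getD ρ 0) [])) ∧
    (∀ σ ∈ exchanges n, ∃ p : Equiv.Perm (Fin (space n).h), σ = permCode p) ∧
    (∀ p : Equiv.Perm (Fin (space n).h), permCode p ∈ exchanges n ↔ ∀ i,
      (Finset.univ.filter fun ρ : (space n).Ray => l.getD ρ 0 = p i).card =
        (Finset.univ.filter fun ρ : (space n).Ray => l.getD ρ 0 = i).card) ∧
    ∀ σ ∈ exchanges n, ∀ r s t : Fin (space n).h,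
      (formData n).d (σ.getD r 0) (σ.getD s 0) (σ.getD t 0) = (formData n).d r s t ∧
        (formData n).c2.getD (σ.getD r 0) 0 = (formData n).c2.getD r 0

instance (n : ℕ) (l : List ℕ) : Decidable (IsProductData n l) := by
  unfold IsProductData
  infer_instance

/-- The factors of the products of projective spaces. -/
def factorList : ℕ → List ℕ
  | 1 => [0, 0, 0, 0, 0]
  | 2 => [1, 0, 0, 0, 1, 0]
  | 7 => [0, 1, 1, 0, 1, 0]
  | 26 => [1, 2, 0, 0, 2, 1, 0]
  | 40 => [0, 1, 2, 3, 3, 2, 1, 0]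
  | _ => []

theorem isProductData : ∀ n ∈ productNumbers, IsProductData n (factorList n) := by
  decide +kernel

theorem exists_isFactorMap {n : ℕ} (hn : n ∈ productNumbers) {K : KahlerBasis (space n)}
    (hJ : ∀ j, K.J j = (space n).functional ((nefClasses n).getD j [])) :
    (space n).IsProjectiveProduct ∧ K.IsExchangeList (formData n) (exchanges n) := by
  obtain ⟨h1, h2, h3, h4, h5, h6, h7⟩ := isProductData n hn
  have hf : K.IsFactorMap fun ρ => ⟨(factorList n).getD ρ 0, h1 ρ⟩ :=
    ⟨fun i => (h2 i).imp fun ρ h => Fin.ext h, fun r => by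
      rw [← h3 r]
      congr 1
      ext ρ
      simp [Fin.ext_iff], fun ρ => by rw [h4, hJ]⟩
  refine ⟨hf.isProjectiveProduct, hf.isExchangeList h5 (fun p => ?_) h7⟩
  rw [h6]
  simp only [Fin.ext_iff]

/-- What the check of a simple space shows. -/
structure IsChecked (n : ℕ) (K : KahlerBasis (space n)) : Prop where
  J_eq : ∀ j, K.J j = (space n).functional ((nefClasses n).getD j [])
  existsUnique : ∃! κ, (space n).IsIntersectionForm κ
  triple_rotate : ∀ x y z, (space n).triple x y z = (space n).triple y z x
  triple_nonneg : ∀ r s t, 0 ≤ (space n).triple (K.J r) (K.J s) (K.J t)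
  hasForm : n ∈ candidateNumbers → K.HasForm (formData n)
  not_isCandidate : n ∉ candidateNumbers → ¬ (space n).IsCandidate
  not_isProjectiveProduct : n ∉ productNumbers → ¬ (space n).IsProjectiveProduct

theorem length_of_mem_nefClasses {n : ℕ} {x : List ℤ} (hx : x ∈ nefClasses n) :
    x.length = (space n).h := by
  obtain ⟨a, -, rfl⟩ := List.mem_map.mp hx
  rw [digitVec, List.length_map, upTo_eq, List.length_range]

theorem not_isSimple_of_spaceCheck {n : ℕ} (h : spaceCheck n = true) (hn : n ∈ nonsimpleNumbers) :
    ¬ (space n).IsSimple := by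
  simp only [spaceCheck, if_pos hn] at h
  exact not_isSimple_of_check (fun c hc => length_of_mem_nefClasses hc) h

theorem exists_isChecked {n : ℕ} (h : spaceCheck n = true) (hn : n ∉ nonsimpleNumbers) :
    ∃ K, IsChecked n K := by
  simp only [spaceCheck, if_neg hn, Bool.and_eq_true] at h
  obtain ⟨⟨hs, hp⟩, hc⟩ := h
  have hlenJ := fun x hx => length_of_mem_nefClasses (n := n) (x := x) hx
  set K := kahlerBasisOfCheck hlenJ hs with hK
  have hlen : (nefClasses n).length = (space n).h := by
    simp only [simpleCheck, Bool.and_eq_true, Nat.beq_eq, length_rows] at hs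
    exact hs.1.1.1.1.1
  have hF : (fanData (space n).rows (relations n)).check (relations n) = true := by
    simp only [simpleCheck, Bool.and_eq_true] at hs
    exact hs.1.1.1.1.2
  have hI : (fanData (space n).rows (relations n)).intersectionCheck (space n).h = true := by
    simp only [simpleCheck, Bool.and_eq_true, length_rows] at hs
    exact hs.2
  obtain ⟨hκ, hloc⟩ := exists_intersectionForm_of_check hF hI
  have hloc : (space n).Localizes (localForms (space n).h (fanData (space n).rows (relations n))) :=
    hloc
  have hrep : ∀ j : Fin (space n).h, Represents ((nefClasses n).getD j []) (K.J j) := fun j => by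
    refine represents_functional (hlenJ _ ?_)
    rw [List.getD_eq_getElem _ _ (by rw [hlen]; exact j.2)]
    exact List.getElem_mem _
  have hW : (0 : ℤ) < commonDenom := by decide
  have hT := tripleSum_eq hlen hrep hloc
  have hC := chern2Sum_eq hlen hrep hloc
  have hE := eulerSum_eq hlen hrep hloc
  have hform : n ∈ candidateNumbers → K.HasForm (formData n) := fun hn => by
    rw [if_pos hn] at hc
    simp only [formDataCheck, length_rows, Bool.and_eq_true, Nat.beq_eq, lall_iff, upTo_eq, List.mem_range,
      eqB_iff] at hc
    obtain ⟨⟨⟨⟨h1, h2⟩, h3⟩, h4⟩, h5⟩ := hc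
    refine ⟨h1, h2, fun r s t => ?_, fun r => ?_, ?_⟩
    · rw [← hloc.triple_rotate]
      have := h3 r r.2 s s.2 t t.2
      rw [hT] at this
      exact mul_left_cancel₀ hW.ne' this
    · have := h4 r r.2
      rw [hC, lget_eq] at this
      exact mul_left_cancel₀ hW.ne' this
    · rw [hE] at h5
      exact mul_left_cancel₀ hW.ne' h5
  have hnon : n ∉ candidateNumbers → (∀ r s t, 0 ≤ (space n).triple (K.J r) (K.J s) (K.J t)) ∧
      ∃ r, 2 * (space n).chern2 (K.J r) < 3 * ∑ s, ∑ t, (space n).triple (K.J r) (K.J s) (K.J t) :=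
      fun hn => by
    rw [if_neg hn] at hc
    simp only [noncandidateCheck, length_rows, Bool.and_eq_true, lall_iff, lany_iff, upTo_eq,
      List.mem_range, nonnegB_iff, posB_iff] at hc
    obtain ⟨h1, r, hr, h2⟩ := hc
    have key : ∀ r s t : Fin (space n).h, s ≤ r → t ≤ s →
        0 ≤ (space n).triple (K.J r) (K.J s) (K.J t) := fun r s t hsr hts => by
      have := h1 r r.2 s (Nat.lt_succ_of_le hsr) t (Nat.lt_succ_of_le hts)
      rw [hT] at this
      exact nonneg_of_mul_nonneg_right this hW
    refine ⟨fun r s t => ?_, ⟨r, hr⟩, ?_⟩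
    -- A swap and a rotation generate all permutations of the arguments, so each index triple is
    -- brought into the nonincreasing order covered by the check.
    · have hrot := hloc.triple_rotate
      have hsw := hloc.triple_swap
      rcases le_total s r with h1 | h1 <;> rcases le_total t s with h2 | h2 <;>
        rcases le_total t r with h3 | h3
      · exact key r s t h1 h2
      · exact key r s t h1 h2
      · rw [hsw, hrot]
        exact key r t s h3 h2
      · rw [hrot, hrot]
        exact key t r s h3 h1
      · rw [hsw]
        exact key s r t h1 h3
      · rw [hrot]
        exact key s t r h2 h3
      · rw [hrot, hsw]
        exact key t s r h2 h1
      · rw [hrot, hsw]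
        exact key t s r h2 h1
    · obtain ⟨r, rfl⟩ : ∃ i : Fin (space n).h, r = i := ⟨⟨r, hr⟩, rfl⟩
      simp only [lsum_eq, lmap_eq, sum_map_range, hT, hC, ← Finset.mul_sum] at h2
      change 0 < 3 * (commonDenom * _) - 2 * (commonDenom * _) at h2
      refine lt_of_mul_lt_mul_left ?_ hW.le
      linarith
  have hnn : ∀ r s t, 0 ≤ (space n).triple (K.J r) (K.J s) (K.J t) := by
    by_cases hn : n ∈ candidateNumbers
    · exact (hform hn).triple_J_nonneg
    · exact (hnon hn).1
  refine ⟨K, fun j => rfl, hκ, hloc.triple_rotate, hnn, hform, fun hn hcan => ?_, fun hn => ?_⟩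
  · obtain ⟨r, hr⟩ := (hnon hn).2
    exact absurd ((K.isCandidate_iff hnn).mp hcan r) (not_le.mpr hr)
  · rw [if_neg hn] at hp
    exact not_isProjectiveProduct_of_check hp

end ToricMonad

namespace ToricMonad

open ToricSpace KahlerBasis

/-! ### Evaluation of the checks -/

/-- The component of a triple for the rank `N`. -/
def component (N : ℕ) (x : ℕ × ℕ × ℕ) : ℕ :=
  if N = 3 then x.1 else if N = 4 then x.2.1 else x.2.2

/-- The numbers of monads of rank `3`, `4` and `5` with the three-family constraint. -/
def threeFamilyTable : ℕ → ℕ × ℕ × ℕ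
  | 1 => (4, 3, 2)
  | 2 => (50, 7, 0)
  | 3 => (1, 0, 0)
  | 4 => (1, 0, 0)
  | 6 => (28, 5, 0)
  | 7 => (7, 3, 2)
  | 12 => (12, 0, 0)
  | 17 => (8, 0, 0)
  | 22 => (9, 0, 0)
  | 26 => (69, 39, 0)
  | 40 => (15, 0, 0)
  | _ => (0, 0, 0)

/-- The entries of the supremum of `B` exceed these numbers by at most one. -/
def boundTable : ℕ → ℕ × ℕ × ℕ
  | 1 => (5, 4, 3)
  | 2 => (4, 3, 1)
  | 6 => (5, 3, 1)
  | 7 => (2, 1, 0)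
  | 8 => (0, 0, 0)
  | 22 => (0, 0, 0)
  | 24 => (0, 0, 0)
  | 26 => (2, 0, 0)
  | 27 => (0, 0, 0)
  | 78 => (0, 0, 0)
  | _ => (1, 0, 0)

/-- The numbers of monads on the candidate number `n` are as in the tables. -/
def countCheck (n : ℕ) : Bool :=
  lall (fun N => (formData n).monadCheck (space n).h N (exchanges n) (component N (boundTable n))
    (component N (monadTable n)) (component N (threeFamilyTable n))) [3, 4, 5]

set_option maxRecDepth 100000 in
theorem spaceCheck_upFrom_30_1 : lall spaceCheck (upFrom 30 1) = true := by decide +kernel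

set_option maxRecDepth 100000 in
theorem spaceCheck_upFrom_30_31 : lall spaceCheck (upFrom 30 31) = true := by decide +kernel

set_option maxRecDepth 100000 in
theorem spaceCheck_upFrom_30_61 : lall spaceCheck (upFrom 30 61) = true := by decide +kernel

set_option maxRecDepth 100000 in
theorem spaceCheck_upFrom_34_91 : lall spaceCheck (upFrom 34 91) = true := by decide +kernel

theorem spaceCheck_eq_true {n : ℕ} (hn : n ∈ Set.Icc 1 124) : spaceCheck n = true := by
  have h1 := spaceCheck_upFrom_30_1
  have h2 := spaceCheck_upFrom_30_31
  have h3 := spaceCheck_upFrom_30_61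
  have h4 := spaceCheck_upFrom_34_91
  simp only [lall_iff, upFrom_eq, List.mem_range'_1] at h1 h2 h3 h4
  obtain ⟨hl, hr⟩ := hn
  by_cases a : n < 31
  · exact h1 n (by omega)
  · by_cases b : n < 61
    · exact h2 n (by omega)
    · by_cases c : n < 91
      · exact h3 n (by omega)
      · exact h4 n (by omega)

set_option maxRecDepth 100000 in
theorem countCheck_eq_true : lall countCheck candidateNumbers = true := by decide +kernel

theorem formData_bound : ∀ n ∈ candidateNumbers, ∀ r : Fin (space n).h,
    3 * ∑ s : Fin (space n).h, ∑ t : Fin (space n).h, (formData n).d r s t ≤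
      2 * (formData n).c2.getD r 0 := by
  decide +kernel

end ToricMonad

namespace ToricMonad

open ToricSpace KahlerBasis

/-! ### The classification -/

theorem isSimple_iff {n : ℕ} (hn : n ∈ Set.Icc 1 124) :
    (space n).IsSimple ↔ n ∉ nonsimpleNumbers := by
  constructor
  · exact fun h h' => not_isSimple_of_spaceCheck (spaceCheck_eq_true hn) h' h
  · intro h
    obtain ⟨K, -⟩ := exists_isChecked (spaceCheck_eq_true hn) h
    exact K.isSimple

/-- The numbers of the simple spaces. -/
def simpleNumbers : Finset ℕ := (Finset.Icc 1 124).filter (· ∉ nonsimpleNumbers)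

theorem simpleSpaces_eq : simpleSpaces = simpleNumbers := by
  ext n
  simp only [simpleSpaces, simpleNumbers, Set.mem_ofPred_eq, Finset.coe_filter, Finset.mem_Icc]
  exact and_congr_right fun hn => isSimple_iff hn

theorem exists_isChecked_of_mem {n : ℕ} (hn : n ∈ simpleNumbers) : ∃ K, IsChecked n K := by
  rw [simpleNumbers, Finset.mem_filter, Finset.mem_Icc] at hn
  exact exists_isChecked (spaceCheck_eq_true hn.1) hn.2

theorem IsChecked.isCandidate {n : ℕ} {K : KahlerBasis (space n)} (hK : IsChecked n K)
    (hn : n ∈ candidateNumbers) : (space n).IsCandidate := by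
  rw [K.isCandidate_iff hK.triple_nonneg]
  intro r
  have h := formData_bound n hn r
  rw [(hK.hasForm hn).chern2_J]
  have e : ∀ s t, (space n).triple (K.J r) (K.J s) (K.J t) = (formData n).d r s t := fun s t => by
    rw [hK.triple_rotate, (hK.hasForm hn).triple_J]
  simp only [e]
  exact_mod_cast h

theorem mem_simpleNumbers_of_mem_candidateNumbers : ∀ n ∈ candidateNumbers, n ∈ simpleNumbers := by
  decide +kernel

theorem productNumbers_subset : ∀ n ∈ productNumbers, n ∈ candidateNumbers := by
  decide

theorem candidateSpaces_eq : candidateSpaces = candidateNumbers.toFinset := by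
  ext n
  rw [candidateSpaces, Set.mem_ofPred_eq, simpleSpaces_eq, Finset.mem_coe, Finset.mem_coe,
    List.mem_toFinset]
  constructor
  · rintro ⟨hn, h⟩
    obtain ⟨K, hK⟩ := exists_isChecked_of_mem hn
    by_contra hc
    exact hK.not_isCandidate hc h
  · intro hn
    have hs := mem_simpleNumbers_of_mem_candidateNumbers n hn
    obtain ⟨K, hK⟩ := exists_isChecked_of_mem hs
    exact ⟨hs, hK.isCandidate hn⟩

theorem mem_productSpaces {n : ℕ} : n ∈ productSpaces ↔ n ∈ productNumbers := by
  rw [productSpaces, Set.mem_ofPred_eq, simpleSpaces_eq, Finset.mem_coe]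
  constructor
  · rintro ⟨hn, h⟩
    obtain ⟨K, hK⟩ := exists_isChecked_of_mem hn
    by_contra hc
    exact hK.not_isProjectiveProduct hc h
  · intro hn
    have hs := mem_simpleNumbers_of_mem_candidateNumbers n (productNumbers_subset n hn)
    obtain ⟨K, hK⟩ := exists_isChecked_of_mem hs
    exact ⟨hs, (exists_isFactorMap hn hK.J_eq).1⟩

theorem exchanges_eq {n : ℕ} (hn : n ∉ productNumbers) : exchanges n = [List.range (space n).h] := by
  unfold exchanges
  split <;> first | rfl | exact absurd (by decide) hn

theorem IsChecked.isExchangeList {n : ℕ} {K : KahlerBasis (space n)} (hK : IsChecked n K) :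
    K.IsExchangeList (formData n) (exchanges n) := by
  by_cases hn : n ∈ productNumbers
  · exact (exists_isFactorMap hn hK.J_eq).2
  · rw [exchanges_eq hn]
    exact isExchangeList_of_not_isProjectiveProduct K _ (hK.not_isProjectiveProduct hn)

theorem tables_eq_zero {n : ℕ} (hn : n ∉ candidateNumbers) :
    monadTable n = (0, 0, 0) ∧ threeFamilyTable n = (0, 0, 0) := by
  constructor
  · unfold monadTable
    split <;> first | rfl | exact absurd (by decide) hn
  · unfold threeFamilyTable
    split <;> first | rfl | exact absurd (by decide) hn

/-- On candidates the count is that of the search. On the other simple spaces a monad of rank at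
least `3` would make the space a candidate, so all counts are zero. -/
theorem encard_classes {n : ℕ} (hn : n ∈ simpleNumbers) {N : ℕ} (hN : N ∈ [3, 4, 5]) :
    ((space n).positiveClasses N).encard = component N (monadTable n) ∧
      ((space n).threeFamilyClasses N).encard = component N (threeFamilyTable n) := by
  obtain ⟨K, hK⟩ := exists_isChecked_of_mem hn
  have hN3 : 3 ≤ N := by
    simp only [List.mem_cons, List.not_mem_nil, or_false] at hN
    omega
  by_cases hc : n ∈ candidateNumbers
  · have h := countCheck_eq_true
    rw [lall_iff] at h
    have h' := h n hc
    rw [countCheck, lall_iff] at h'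
    exact (hK.hasForm hc).encard_classes hK.isExchangeList (by omega) (h' N hN)
  · have hno : ∀ V : (space n).MonadData, ¬ V.IsPositiveMonad N := fun V hV =>
      hK.not_isCandidate hc (isCandidate_of_isPositiveMonad hK.triple_nonneg hK.triple_rotate hN3 hV)
    have e : component N (0, 0, 0) = 0 := by simp [component]
    rw [(tables_eq_zero hc).1, (tables_eq_zero hc).2, e, Nat.cast_zero, Set.encard_eq_zero,
      Set.encard_eq_zero, positiveClasses, threeFamilyClasses, Set.image_eq_empty, Set.image_eq_empty]
    exact ⟨Set.eq_empty_of_forall_notMem hno, Set.eq_empty_of_forall_notMem fun V hV => hno V hV.1⟩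

theorem threeFamilyClasses_subset (A : ToricSpace) (N : ℕ) :
    A.threeFamilyClasses N ⊆ A.positiveClasses N :=
  Set.image_mono fun _ h => h.1

theorem disjoint_positiveClasses (A : ToricSpace) {N M : ℕ} (h : N ≠ M) :
    Disjoint (A.positiveClasses N) (A.positiveClasses M) := by
  rw [Set.disjoint_left]
  rintro _ ⟨V, hV, rfl⟩ ⟨W, hW, hVW⟩
  have h1 := hV.rank_eq
  have h2 := hW.rank_eq
  rcases Quotient.exact hVW with rfl | ⟨φ, -, hB, hC⟩
  · omega
  · rw [hB, hC, Multiset.card_map, Multiset.card_map] at h1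
    omega

/-- The number of elements of a disjoint union. -/
theorem encard_sigma {β : ℕ → Type*} (S : Finset ℕ) (T : ∀ n, Set (β n)) (f : ℕ → ℕ)
    (hf : ∀ n ∈ S, (T n).encard = f n) :
    {x : Σ n, β n | x.1 ∈ S ∧ x.2 ∈ T x.1}.encard = (∑ n ∈ S, f n : ℕ) := by
  induction S using Finset.induction_on with
  | empty => simp
  | insert a S ha ih =>
    have e : {x : Σ n, β n | x.1 ∈ insert a S ∧ x.2 ∈ T x.1} =
        Sigma.mk a '' T a ∪ {x : Σ n, β n | x.1 ∈ S ∧ x.2 ∈ T x.1} := by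
      ext ⟨n, y⟩
      simp only [Finset.mem_insert, Set.mem_ofPred_eq, Set.mem_union, Set.mem_image, Sigma.mk.injEq]
      constructor
      · rintro ⟨rfl | hn, hy⟩
        · exact Or.inl ⟨y, hy, rfl, HEq.rfl⟩
        · exact Or.inr ⟨hn, hy⟩
      · rintro (⟨z, hz, rfl, hzy⟩ | ⟨hn, hy⟩)
        · exact ⟨Or.inl rfl, eq_of_heq hzy ▸ hz⟩
        · exact ⟨Or.inr hn, hy⟩
    rw [e, Set.encard_union_eq, sigma_mk_injective.encard_image, hf a (Finset.mem_insert_self a S),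
      ih fun n hn => hf n (Finset.mem_insert_of_mem hn), Finset.sum_insert ha, Nat.cast_add]
    rw [Set.disjoint_left]
    rintro _ ⟨z, -, rfl⟩ ⟨hn, -⟩
    exact ha hn

theorem encard_positiveClasses_union {n : ℕ} (hn : n ∈ simpleNumbers) :
    ((space n).positiveClasses 3 ∪ (space n).positiveClasses 4 ∪ (space n).positiveClasses 5).encard =
      ((component 3 (monadTable n) + component 4 (monadTable n) + component 5 (monadTable n) : ℕ) : ℕ∞) := by
  rw [Set.encard_union_eq, Set.encard_union_eq, (encard_classes hn (by simp)).1,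
    (encard_classes hn (by simp)).1, (encard_classes hn (by simp)).1, Nat.cast_add, Nat.cast_add]
  · exact disjoint_positiveClasses _ (by norm_num)
  · exact Set.disjoint_union_left.mpr
      ⟨disjoint_positiveClasses _ (by norm_num), disjoint_positiveClasses _ (by norm_num)⟩

theorem encard_threeFamilyClasses_union {n : ℕ} (hn : n ∈ simpleNumbers) :
    ((space n).threeFamilyClasses 3 ∪ (space n).threeFamilyClasses 4 ∪
      (space n).threeFamilyClasses 5).encard = ((component 3 (threeFamilyTable n) +
        component 4 (threeFamilyTable n) + component 5 (threeFamilyTable n) : ℕ) : ℕ∞) := by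
  have hd : ∀ N M, N ≠ M → Disjoint ((space n).threeFamilyClasses N) ((space n).threeFamilyClasses M) :=
    fun N M h => (disjoint_positiveClasses _ h).mono (threeFamilyClasses_subset _ _)
      (threeFamilyClasses_subset _ _)
  rw [Set.encard_union_eq, Set.encard_union_eq, (encard_classes hn (by simp)).2,
    (encard_classes hn (by simp)).2, (encard_classes hn (by simp)).2, Nat.cast_add, Nat.cast_add]
  · exact hd _ _ (by norm_num)
  · exact Set.disjoint_union_left.mpr ⟨hd _ _ (by norm_num), hd _ _ (by norm_num)⟩

/-- The numbers of the products of projective spaces, and of the other simple spaces. -/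
def simpleNumbersOf (isProduct : Bool) : Finset ℕ :=
  simpleNumbers.filter fun n => decide (n ∈ productNumbers) = isProduct

theorem mem_onProducts {x : Σ n : ℕ, (space n).MonadClass} :
    x ∈ onProducts ↔ x.1 ∈ productNumbers := mem_productSpaces

theorem mem_monadSpaces {n : ℕ} : n ∈ monadSpaces ↔
    n ∈ simpleNumbers ∧ ∃ N ∈ ({3, 4, 5} : Finset ℕ), component N (monadTable n) ≠ 0 := by
  rw [monadSpaces, Set.mem_ofPred_eq, simpleSpaces_eq, Finset.mem_coe]
  refine and_congr_right fun hn => exists_congr fun N => ?_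
  refine and_congr_right fun hN => ?_
  have h := (encard_classes (N := N) hn (by simpa using hN)).1
  rw [← Nat.cast_ne_zero (R := ℕ∞), ← h, Set.encard_ne_zero, positiveClasses, Set.image_nonempty]
  rfl

theorem monadSpaces_eq : monadSpaces = {1, 2, 3, 4, 6, 7, 12, 17, 22, 26, 40} := by
  have h : simpleNumbers.filter (fun n => ∃ N ∈ ({3, 4, 5} : Finset ℕ), component N (monadTable n) ≠ 0) =
      {1, 2, 3, 4, 6, 7, 12, 17, 22, 26, 40} := by
    decide +kernel
  ext n
  rw [mem_monadSpaces, ← Finset.mem_filter (p := fun n => ∃ N ∈ ({3, 4, 5} : Finset ℕ),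
    component N (monadTable n) ≠ 0), h]
  simp

end ToricMonad

open ToricMonad
theorem mainTheorem2 :
    -- the intersection form is well defined on each of the 101 simple spaces, 18 of which are
    -- candidates; positive monads exist on exactly 11 of these 18
    (∀ n ∈ simpleSpaces, ∃! κ, (space n).IsIntersectionForm κ) ∧
    simpleSpaces.encard = 101 ∧
    candidateSpaces.encard = 18 ∧
    productSpaces = {1, 2, 7, 26, 40} ∧
    monadSpaces = {1, 2, 3, 4, 6, 7, 12, 17, 22, 26, 40} ∧
    productSpaces ∪ monadSpaces ⊆ candidateSpaces ∧
    -- the numbers of positive monads for each space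
    (∀ n ∈ simpleSpaces,
      ((space n).positiveClasses 3).encard = (monadTable n).1 ∧
      ((space n).positiveClasses 4).encard = (monadTable n).2.1 ∧
      ((space n).positiveClasses 5).encard = (monadTable n).2.2) ∧
    -- the totals, those on products of projective spaces, and the new ones
    (models 3 ∪ models 4 ∪ models 5).encard = 2190 ∧
    ((models 3 ∪ models 4 ∪ models 5) ∩ onProducts).encard = 1853 ∧
    ((models 3 ∪ models 4 ∪ models 5) \ onProducts).encard = 337 ∧
    (models 3).encard = 1507 ∧ (models 3 \ onProducts).encard = 283 ∧
    (models 4).encard = 589 ∧ (models 4 \ onProducts).encard = 35 ∧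
    (models 5).encard = 94 ∧ (models 5 \ onProducts).encard = 19 ∧
    -- the same with the three-family constraint
    (threeFamilyModels 3 ∪ threeFamilyModels 4 ∪ threeFamilyModels 5).encard = 265 ∧
    ((threeFamilyModels 3 ∪ threeFamilyModels 4 ∪ threeFamilyModels 5) \ onProducts).encard = 64 ∧
    (threeFamilyModels 3).encard = 204 ∧ (threeFamilyModels 3 \ onProducts).encard = 59 ∧
    (threeFamilyModels 4).encard = 57 ∧ (threeFamilyModels 4 \ onProducts).encard = 5 ∧
    (threeFamilyModels 5).encard = 4 ∧ (threeFamilyModels 5 \ onProducts).encard = 0 := by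
  -- Replacing the set of simple spaces by an explicit finite set turns each total into a finite sum
  -- over the tables; the same is done below for the products and for the remaining spaces.
  have hset : ∀ (T : ∀ n, Set (space n).MonadClass),
      {x : Σ n : ℕ, (space n).MonadClass | x.1 ∈ simpleSpaces ∧ x.2 ∈ T x.1} =
        {x | x.1 ∈ simpleNumbers ∧ x.2 ∈ T x.1} := fun T => by
    rw [simpleSpaces_eq]
    rfl
  have hinter : ∀ (T : ∀ n, Set (space n).MonadClass),
      {x : Σ n : ℕ, (space n).MonadClass | x.1 ∈ simpleSpaces ∧ x.2 ∈ T x.1} ∩ onProducts =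
        {x | x.1 ∈ simpleNumbersOf true ∧ x.2 ∈ T x.1} := fun T => by
    ext x
    rw [hset, Set.mem_inter_iff, mem_onProducts]
    simp only [Set.mem_ofPred_eq, simpleNumbersOf, Finset.mem_filter, decide_eq_true_eq]
    tauto
  have hdiff : ∀ (T : ∀ n, Set (space n).MonadClass),
      {x : Σ n : ℕ, (space n).MonadClass | x.1 ∈ simpleSpaces ∧ x.2 ∈ T x.1} \ onProducts =
        {x | x.1 ∈ simpleNumbersOf false ∧ x.2 ∈ T x.1} := fun T => by
    ext x
    rw [hset, Set.mem_sdiff, mem_onProducts]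
    simp only [Set.mem_ofPred_eq, simpleNumbersOf, Finset.mem_filter, decide_eq_false_iff_not]
    tauto
  have hsub : ∀ b, ∀ n ∈ simpleNumbersOf b, n ∈ simpleNumbers := fun b n hn =>
    (Finset.mem_filter.mp hn).1
  have hm : models 3 ∪ models 4 ∪ models 5 = {x | x.1 ∈ simpleSpaces ∧
      x.2 ∈ (space x.1).positiveClasses 3 ∪ (space x.1).positiveClasses 4 ∪
        (space x.1).positiveClasses 5} := by
    ext x
    simp only [models, Set.mem_union, Set.mem_ofPred_eq]
    rw [and_or_left, and_or_left]
  have hf : threeFamilyModels 3 ∪ threeFamilyModels 4 ∪ threeFamilyModels 5 =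
      {x | x.1 ∈ simpleSpaces ∧ x.2 ∈ (space x.1).threeFamilyClasses 3 ∪
        (space x.1).threeFamilyClasses 4 ∪ (space x.1).threeFamilyClasses 5} := by
    ext x
    simp only [threeFamilyModels, Set.mem_union, Set.mem_ofPred_eq]
    rw [and_or_left, and_or_left]
  have count : ∀ (S : Finset ℕ) (T : ∀ n, Set (space n).MonadClass) (f : ℕ → ℕ) (m : ℕ),
      (∀ n ∈ S, (T n).encard = f n) → ∑ n ∈ S, f n = m →
        {x : Σ n : ℕ, (space n).MonadClass | x.1 ∈ S ∧ x.2 ∈ T x.1}.encard = m :=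
    fun S T f m h hm => by rw [encard_sigma S T f h, hm]
  refine ⟨fun n hn => ?_, ?_, ?_, ?_, monadSpaces_eq, ?_, fun n hn => ?_, ?_, ?_, ?_, ?_, ?_, ?_, ?_,
    ?_, ?_, ?_, ?_, ?_, ?_, ?_, ?_, ?_, ?_⟩
  · rw [simpleSpaces_eq] at hn
    obtain ⟨K, hK⟩ := exists_isChecked_of_mem hn
    exact hK.existsUnique
  · rw [simpleSpaces_eq, Set.encard_coe_eq_coe_finsetCard,
      show simpleNumbers.card = 101 by decide +kernel]
    rfl
  · rw [candidateSpaces_eq, Set.encard_coe_eq_coe_finsetCard]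
    rfl
  · ext n
    rw [mem_productSpaces]
    simp [productNumbers]
  · rw [monadSpaces_eq, candidateSpaces_eq]
    rintro n (hn | hn)
    · rw [mem_productSpaces] at hn
      exact List.mem_toFinset.mpr (productNumbers_subset n hn)
    · simp only [Set.mem_insert_iff, Set.mem_singleton_iff] at hn
      rw [Finset.mem_coe, List.mem_toFinset]
      rcases hn with rfl | rfl | rfl | rfl | rfl | rfl | rfl | rfl | rfl | rfl | rfl <;> decide
  · rw [simpleSpaces_eq] at hn
    exact ⟨(encard_classes hn (by simp)).1, (encard_classes hn (by simp)).1,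
      (encard_classes hn (by simp)).1⟩
  · rw [hm, hset fun n => (space n).positiveClasses 3 ∪ (space n).positiveClasses 4 ∪ (space n).positiveClasses 5]
    exact count _ _ _ _ (fun n hn => encard_positiveClasses_union hn) (by decide +kernel)
  · rw [hm, hinter fun n => (space n).positiveClasses 3 ∪ (space n).positiveClasses 4 ∪ (space n).positiveClasses 5]
    exact count _ _ _ _ (fun n hn => encard_positiveClasses_union (hsub _ n hn)) (by decide +kernel)
  · rw [hm, hdiff fun n => (space n).positiveClasses 3 ∪ (space n).positiveClasses 4 ∪ (space n).positiveClasses 5]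
    exact count _ _ _ _ (fun n hn => encard_positiveClasses_union (hsub _ n hn)) (by decide +kernel)
  · rw [models, hset fun n => (space n).positiveClasses 3]
    exact count _ _ _ _ (fun n hn => (encard_classes hn (by simp)).1) (by decide +kernel)
  · rw [models, hdiff fun n => (space n).positiveClasses 3]
    exact count _ _ _ _ (fun n hn => (encard_classes (hsub _ n hn) (by simp)).1) (by decide +kernel)
  · rw [models, hset fun n => (space n).positiveClasses 4]
    exact count _ _ _ _ (fun n hn => (encard_classes hn (by simp)).1) (by decide +kernel)
  · rw [models, hdiff fun n => (space n).positiveClasses 4]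
    exact count _ _ _ _ (fun n hn => (encard_classes (hsub _ n hn) (by simp)).1) (by decide +kernel)
  · rw [models, hset fun n => (space n).positiveClasses 5]
    exact count _ _ _ _ (fun n hn => (encard_classes hn (by simp)).1) (by decide +kernel)
  · rw [models, hdiff fun n => (space n).positiveClasses 5]
    exact count _ _ _ _ (fun n hn => (encard_classes (hsub _ n hn) (by simp)).1) (by decide +kernel)
  · rw [hf, hset fun n => (space n).threeFamilyClasses 3 ∪ (space n).threeFamilyClasses 4 ∪ (space n).threeFamilyClasses 5]
    exact count _ _ _ _ (fun n hn => encard_threeFamilyClasses_union hn) (by decide +kernel)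
  · rw [hf, hdiff fun n => (space n).threeFamilyClasses 3 ∪ (space n).threeFamilyClasses 4 ∪ (space n).threeFamilyClasses 5]
    exact count _ _ _ _ (fun n hn => encard_threeFamilyClasses_union (hsub _ n hn)) (by decide +kernel)
  · rw [threeFamilyModels, hset fun n => (space n).threeFamilyClasses 3]
    exact count _ _ _ _ (fun n hn => (encard_classes hn (by simp)).2) (by decide +kernel)
  · rw [threeFamilyModels, hdiff fun n => (space n).threeFamilyClasses 3]
    exact count _ _ _ _ (fun n hn => (encard_classes (hsub _ n hn) (by simp)).2) (by decide +kernel)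
  · rw [threeFamilyModels, hset fun n => (space n).threeFamilyClasses 4]
    exact count _ _ _ _ (fun n hn => (encard_classes hn (by simp)).2) (by decide +kernel)
  · rw [threeFamilyModels, hdiff fun n => (space n).threeFamilyClasses 4]
    exact count _ _ _ _ (fun n hn => (encard_classes (hsub _ n hn) (by simp)).2) (by decide +kernel)
  · rw [threeFamilyModels, hset fun n => (space n).threeFamilyClasses 5]
    exact count _ _ _ _ (fun n hn => (encard_classes hn (by simp)).2) (by decide +kernel)
  · rw [threeFamilyModels, hdiff fun n => (space n).threeFamilyClasses 5]
    exact count _ _ _ _ (fun n hn => (encard_classes (hsub _ n hn) (by simp)).2) (by decide +kernel)
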